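/- Let $M$ be a (Hausdorff, second countable) smooth manifold with a foliation $\mathcal F$ of codimension $q$, given by adapted charts $(x^1,\dots,x^p,y^1,\dots,y^q)$, and let $N(M,\mathcal F)=TM/T\mathcal F$ be its normal bundle; write $\bar X$ for the section of $N(M,\mathcal F)$ defined by a vector field $X$. Let $(D,g)$ be a normal Hessian structure: $g$ is a smooth Riemannian metric in $N(M,\mathcal F)$, and $D$ is a smooth connection in $N(M,\mathcal F)$ that is normal ($D_XZ=0$ for $X\in T\mathcal F$ and local foliated sections $Z$), torsion-free ($D_X\bar Y-D_Y\bar X=\overline{[X,Y]}$), flat, and satisfies the Codazzi equation $(D_Xg)(\bar Y,Z)=(D_Yg)(\bar X,Z)$ for all local infinitesimal automorphisms $X,Y$ of $\mathcal F$ and all local foliated sections $Z$ of $N(M,\mathcal F)$. The Koszul forms are the normal $1$-form $\alpha$ with $D_X\omega=\alpha(\bar X)\,\omega$ for the local normal volume forms $\omega$ of $g$ (that is, $\omega(v_1,\dots,v_q)^2=\det[g(v_i,v_j)]$), and the normal bilinear form $\beta=D\alpha$. The structure $(D,g)$ is Einstein–Hessian if $\beta=\lambda g$ for some function $\lambda$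 on $M$ (necessarily $\lambda=\beta^i{}_i/q$ if $q>0$). The total space $N(M,\mathcal F)$ carries the foliation $\mathcal F^N$ of codimension $2q$ with adapted charts $(x^i,y^j,dy^j)$. The normal Kähler structure $(J^N,g^N)$ of $(N(M,\mathcal F),\mathcal F^N)$ induced by $(D,g)$ is given by $J^N(a^h)=a^v$, $J^N(a^v)=-a^h$, $g^N(a^h,b^h)=g^N(a^v,b^v)=g(a,b)$, $g^N(a^h,b^v)=0$, where $a^h$ and $a^v$ are the $D$-horizontal and vertical lifts of a normal vector $a$; in adapted charts whose transverse coordinates are affine for $D$ this says that $z^j=y^j+\sqrt{-1}\,dy^j$ are holomorphic and $g^N=\sum g_{ij}\,dz^i\,d\bar z^j$. It is Einstein–Kähler if $g^N$ is a foliated Riemannian metric, $J^N$ is a foliated Hermitian complex structure that is parallel for the normal Levi-Civita connection of $g^N$, and the normal Ricci tensor satisfies $\mathrm{Ric}^N=\mu\, g^N$ for some function $\mu$ on $N(M,\mathcal F)$. Then $(D,g)$ is Einstein–Hessian if and only if $(J^N,g^N)$ is Einstein–Kähler. The same equivalence holds if in both definitions the factors $\lambda$ and $\mu$ are required to be constant.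 -/

import Mathlib

open Set Bundle Manifold
open scoped ContDiff Topology

noncomputable section

/-! ## Foliated manifolds

A manifold with a foliation of codimension `q` is a topological space with a foliated atlas: charts
with values in `A × B` (`A` the leaf direction, `B` the transverse direction) whose changes of
coordinates are smooth and, locally, of the form `(x, y) ↦ (x'(x, y), y'(y))`. -/

section Foliation

variable (A B : Type*) [NormedAddCommGroup A] [NormedSpace ℝ A]
  [NormedAddCommGroup B] [NormedSpace ℝ B]

/-- Smooth maps `(x, y) ↦ (x', y')` of open subsets of `A × B` with `∂y'/∂x = 0`. -/
def foliationPregroupoid : Pregroupoid (A × B) where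
  property f s := ContDiffOn ℝ ∞ f s ∧ ∀ z ∈ s, ∀ a : A, (fderiv ℝ f z (a, 0)).2 = 0
  comp {f g u v} hf hg hu hv huv := by
    refine ⟨hg.1.comp (hf.1.mono inter_subset_left) (fun z hz => hz.2), ?_⟩
    rintro z ⟨hzu, hzv⟩ a
    have h1 : DifferentiableAt ℝ f z :=
      (hf.1.contDiffAt (hu.mem_nhds hzu)).differentiableAt (by simp)
    have h2 : DifferentiableAt ℝ g (f z) :=
      (hg.1.contDiffAt (hv.mem_nhds hzv)).differentiableAt (by simp)
    rw [fderiv_comp z h2 h1, ContinuousLinearMap.comp_apply]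
    have h3 : fderiv ℝ f z (a, 0) = ((fderiv ℝ f z (a, 0)).1, 0) :=
      Prod.ext rfl (hf.2 z hzu a)
    rw [h3]
    exact hg.2 _ hzv _
  id_mem := ⟨contDiff_id.contDiffOn, fun z _ a => by simp⟩
  locality {f u} hu H := by
    constructor
    · intro z hz
      obtain ⟨v, hv, hzv, h⟩ := H z hz
      exact ((h.1.contDiffAt ((hu.inter hv).mem_nhds ⟨hz, hzv⟩))).contDiffWithinAt
    · intro z hz a
      obtain ⟨v, hv, hzv, h⟩ := H z hz
      exact h.2 z ⟨hz, hzv⟩ a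
  congr {f g u} hu fg hf := by
    refine ⟨hf.1.congr fg, fun z hz a => ?_⟩
    have : g =ᶠ[𝓝 z] f := Filter.eventually_of_mem (hu.mem_nhds hz) fg
    rw [this.fderiv_eq]
    exact hf.2 z hz a

/-- The pseudogroup of foliated local diffeomorphisms of `A × B`. -/
def foliationGroupoid : StructureGroupoid (A × B) := (foliationPregroupoid A B).groupoid

/-- `M`, with its charts in `A × B`, is a foliated manifold: the charts are adapted charts. -/
abbrev IsFoliated (M : Type*) [TopologicalSpace M] [ChartedSpace (A × B) M] : Prop :=
  HasGroupoid M (foliationGroupoid A B)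

variable (M : Type*) [TopologicalSpace M] [ChartedSpace (A × B) M] [IsFoliated A B M]

instance IsFoliated.isManifold : IsManifold 𝓘(ℝ, A × B) ∞ M := by
  have hle : foliationGroupoid A B ≤ contDiffGroupoid ∞ 𝓘(ℝ, A × B) := by
    apply groupoid_of_pregroupoid_le
    intro f s h
    simpa [contDiffPregroupoid] using h.1
  have : HasGroupoid M (contDiffGroupoid ∞ 𝓘(ℝ, A × B)) := hasGroupoid_of_le inferInstance hle
  exact IsManifold.mk' _ _ _

variable {A B M} in
theorem IsFoliated.transition {i j : OpenPartialHomeomorph M (A × B)}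
    (hi : i ∈ atlas (A × B) M) (hj : j ∈ atlas (A × B) M) :
    ContDiffOn ℝ ∞ (j ∘ i.symm) (i.symm.trans j).source ∧
      ∀ z ∈ (i.symm.trans j).source, ∀ a : A, (fderiv ℝ (j ∘ i.symm) z (a, 0)).2 = 0 :=
  (mem_groupoid_of_pregroupoid.1
    ((inferInstance : IsFoliated A B M).compatible hi hj)).1

variable {A B M} in
theorem IsFoliated.tangent_coordChange (i j : atlas (A × B) M) (x : M) :
    (tangentBundleCore 𝓘(ℝ, A × B) M).coordChange i j x =
      fderiv ℝ (j.1 ∘ i.1.symm) (i.1 x) := by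
  simp [tangentBundleCore, OpenPartialHomeomorph.extend, fderivWithin_univ]

variable {A B M} in
theorem IsFoliated.tangent_coordChange_snd (i j : atlas (A × B) M) {x : M}
    (hi : x ∈ i.1.source) (hj : x ∈ j.1.source) (a : A) :
    ((tangentBundleCore 𝓘(ℝ, A × B) M).coordChange i j x (a, 0)).2 = 0 := by
  rw [IsFoliated.tangent_coordChange]
  exact (IsFoliated.transition i.2 j.2).2 _ (by simp [hi, hj]) a

/-! ## The normal bundle -/

/-- The normal bundle `TM / TF`. The adapted charts identify `TF` with `A × 0`, hence `TM / TF`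
with `B`; the change of coordinates is the one that the tangent bundle induces on the quotient, that
is, the derivative of the change of the transverse coordinates. -/
def normalBundleCore : VectorBundleCore ℝ M B (atlas (A × B) M) where
  baseSet i := i.1.source
  isOpen_baseSet i := i.1.open_source
  indexAt := achart (A × B)
  mem_baseSet_at := mem_chart_source (A × B)
  coordChange i j x :=
    (ContinuousLinearMap.snd ℝ A B).comp
      (((tangentBundleCore 𝓘(ℝ, A × B) M).coordChange i j x).comp (ContinuousLinearMap.inr ℝ A B))
  coordChange_self i x hx v := by
    have := (tangentBundleCore 𝓘(ℝ, A × B) M).coordChange_self i x hx ((0 : A), v)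
    simpa using congrArg Prod.snd this
  continuousOn_coordChange i j := by
    have := (tangentBundleCore 𝓘(ℝ, A × B) M).continuousOn_coordChange i j
    exact continuousOn_const.clm_comp (this.clm_comp continuousOn_const)
  coordChange_comp i j k x hx v := by
    obtain ⟨⟨hi, hj⟩, hk⟩ := hx
    have h := (tangentBundleCore 𝓘(ℝ, A × B) M).coordChange_comp i j k x ⟨⟨hi, hj⟩, hk⟩
      ((0 : A), v)
    set w := (tangentBundleCore 𝓘(ℝ, A × B) M).coordChange i j x ((0 : A), v) with hw
    have hsplit : w = (w.1, 0) + (0, w.2) := by simp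
    have h0 := IsFoliated.tangent_coordChange_snd j k hj hk w.1
    have h2 := congrArg Prod.snd h
    rw [hsplit, map_add, Prod.snd_add, h0, zero_add] at h2
    simpa [hw] using h2

variable {M}

/-- The fibre `N_x = T_x M / T_x F` of the normal bundle, read in the preferred adapted chart
at `x`. -/
abbrev NormalFiber (x : M) : Type _ := (normalBundleCore A B M).Fiber x

instance (x : M) : IsTopologicalAddGroup (NormalFiber A B x) :=
  inferInstanceAs (IsTopologicalAddGroup B)

instance (x : M) : ContinuousSMul ℝ (NormalFiber A B x) :=
  inferInstanceAs (ContinuousSMul ℝ B)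

/-- The projection `T_x M → N_x`, written `X ↦ X̄`; both spaces are read in the preferred chart
at `x`. -/
def normalProj (x : M) : TangentSpace 𝓘(ℝ, A × B) x →L[ℝ] NormalFiber A B x :=
  ContinuousLinearMap.snd ℝ A B

/-- The tangent space `T_x F` of the leaf through `x`. -/
def leafSpace (x : M) : Submodule ℝ (TangentSpace 𝓘(ℝ, A × B) x) :=
  LinearMap.ker (LinearMap.snd ℝ A B)

/-- The vector `(0, a)` of `T_x M` in the preferred chart at `x`, whose normal part is `a`. -/
def transverseLift (x : M) : NormalFiber A B x →ₗ[ℝ] TangentSpace 𝓘(ℝ, A × B) x :=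
  LinearMap.inr ℝ A B

/-- The normal space is the quotient of the tangent space by the tangent space of the leaf. -/
def normalFiberEquiv (x : M) :
    (TangentSpace 𝓘(ℝ, A × B) x ⧸ leafSpace A B x) ≃ₗ[ℝ] NormalFiber A B x :=
  LinearMap.quotKerEquivOfSurjective (M₂ := B) (LinearMap.snd ℝ A B) LinearMap.snd_surjective

variable (M) in
/-- The total space `N(M, F)` of the normal bundle. -/
abbrev NormalBundle : Type _ := TotalSpace B (NormalFiber A B : M → Type _)

variable {A B} in
/-- The derivative `X f` of a function `f` at `x` in the direction `X`. -/
def dirDeriv (f : M → ℝ) (x : M) (X : TangentSpace 𝓘(ℝ, A × B) x) : ℝ :=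
  mfderiv 𝓘(ℝ, A × B) 𝓘(ℝ, ℝ) f x X

variable {A B} in
/-- A section of the normal bundle is smooth on `U`. -/
def IsSmoothSectionOn (U : Set M) (Z : ∀ x : M, NormalFiber A B x) : Prop :=
  ContMDiffOn 𝓘(ℝ, A × B) (𝓘(ℝ, A × B).prod 𝓘(ℝ, B)) ∞
    (fun x => (⟨x, Z x⟩ : NormalBundle A B M)) U

variable {A B} in
/-- A vector field is smooth on `U`. -/
def IsSmoothFieldOn (U : Set M) (X : ∀ x : M, TangentSpace 𝓘(ℝ, A × B) x) : Prop :=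
  ContMDiffOn 𝓘(ℝ, A × B) (𝓘(ℝ, A × B).prod 𝓘(ℝ, A × B)) ∞
    (fun x => (⟨x, X x⟩ : TangentBundle 𝓘(ℝ, A × B) M)) U

variable {A B} in
/-- A foliated section on `U`: its components in the frames of the normal bundle given by the
adapted charts are constant along the leaves. -/
def IsFoliatedSectionOn (U : Set M) (Z : ∀ x : M, NormalFiber A B x) : Prop :=
  IsSmoothSectionOn U Z ∧
    ∀ x₀ : M, ∀ x ∈ U ∩ (chartAt (A × B) x₀).source, ∀ v ∈ leafSpace A B x,
      mfderiv 𝓘(ℝ, A × B) 𝓘(ℝ, B)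
        (fun y => (trivializationAt B (NormalFiber A B) x₀ ⟨y, Z y⟩).2) x v = 0

variable {A B} in
/-- An infinitesimal automorphism of the foliation on `U`: a vector field whose normal part is a
foliated section (its flow maps leaves to leaves). -/
def IsInfAutOn (U : Set M) (X : ∀ x : M, TangentSpace 𝓘(ℝ, A × B) x) : Prop :=
  IsSmoothFieldOn U X ∧ IsFoliatedSectionOn U (fun x => normalProj A B x (X x))

/-! ## The foliation of the total space of the normal bundle -/

/-- The chart `(x, y, dy)` of `N(M, F)` that an adapted chart `(x, y)` of `M` induces. -/
def normalBundleChart (e : atlas (A × B) M) :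
    OpenPartialHomeomorph (NormalBundle A B M) (A × (B × B)) :=
  (((normalBundleCore A B M).localTriv e).toOpenPartialHomeomorph.trans
    (e.1.prod (OpenPartialHomeomorph.refl B))).trans
    (Homeomorph.prodAssoc A B B).toOpenPartialHomeomorph

variable {A B} in
theorem mem_normalBundleChart_source (e : atlas (A × B) M) (v : NormalBundle A B M) :
    v ∈ (normalBundleChart A B e).source ↔ v.1 ∈ e.1.source := by
  have : v.1 ∈ ((normalBundleCore A B M).localTriv e).baseSet ↔ v.1 ∈ e.1.source := Iff.rfl
  simp only [normalBundleChart, mfld_simps, Trivialization.mem_source, this]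

variable {A B} in
theorem mem_normalBundleChart_target (e : atlas (A × B) M) (z : A × (B × B)) :
    z ∈ (normalBundleChart A B e).target ↔ (z.1, z.2.1) ∈ e.1.target := by
  have : ((normalBundleCore A B M).localTriv e).baseSet = e.1.source := rfl
  simp only [normalBundleChart, mfld_simps, Trivialization.target_eq, this]
  exact ⟨fun h => h.1, fun h => ⟨h, e.1.map_target h⟩⟩

instance normalBundleChartedSpace : ChartedSpace (A × (B × B)) (NormalBundle A B M) where
  atlas := range (normalBundleChart A B (M := M))
  chartAt v := normalBundleChart A B (achart (A × B) v.1)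
  mem_chart_source v :=
    (mem_normalBundleChart_source _ v).2 (mem_chart_source (A × B) v.1)
  chart_mem_atlas _ := mem_range_self _

variable {A B} in
/-- Read in two induced charts, the change of coordinates is `(x, y, dy) ↦ (x', y', dy')`. -/
theorem normalBundleChart_transition (i j : atlas (A × B) M) (z : A × (B × B))
    (hz : (z.1, z.2.1) ∈ ((i.1.symm.trans j.1).source)) :
    normalBundleChart A B j ((normalBundleChart A B i).symm z) =
      ((j.1 (i.1.symm (z.1, z.2.1))).1, ((j.1 (i.1.symm (z.1, z.2.1))).2,
        (fderiv ℝ (j.1 ∘ i.1.symm) (z.1, z.2.1) (0, z.2.2)).2)) := by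
  obtain ⟨x, y, η⟩ := z
  have hi : (x, y) ∈ i.1.target := by simpa using hz.1
  have hj : i.1.symm (x, y) ∈ j.1.source := hz.2
  set p := i.1.symm (x, y) with hp
  have hpi : p ∈ i.1.source := i.1.map_target hi
  have h1 : (normalBundleChart A B i).symm (x, y, η) =
      ⟨p, (normalBundleCore A B M).coordChange i (achart (A × B) p) p η⟩ := rfl
  have h2 : normalBundleChart A B j
      ⟨p, (normalBundleCore A B M).coordChange i (achart (A × B) p) p η⟩ =
      ((j.1 p).1, (j.1 p).2, (normalBundleCore A B M).coordChange (achart (A × B) p) j p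
        ((normalBundleCore A B M).coordChange i (achart (A × B) p) p η)) := rfl
  rw [h1, h2, (normalBundleCore A B M).coordChange_comp i (achart (A × B) p) j p
    ⟨⟨hpi, mem_chart_source (A × B) p⟩, hj⟩]
  have h3 : (normalBundleCore A B M).coordChange i j p η =
      ((tangentBundleCore 𝓘(ℝ, A × B) M).coordChange i j p (0, η)).2 := rfl
  rw [h3, IsFoliated.tangent_coordChange, hp, i.1.right_inv hi]

/-- The foliation `F^N` of the total space of the normal bundle: its adapted charts are the induced
charts `(x, y, dy)`, with transverse coordinates `(y, dy)`. -/
instance normalBundle_isFoliated : IsFoliated A (B × B) (NormalBundle A B M) := by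
  refine hasGroupoid_of_pregroupoid (foliationPregroupoid A (B × B)) ?_
  rintro _ _ ⟨i, rfl⟩ ⟨j, rfl⟩
  obtain ⟨hs, hl⟩ := IsFoliated.transition i.2 j.2
  set τ := j.1 ∘ i.1.symm with hτ
  set S := (i.1.symm.trans j.1).source with hS
  have hSo : IsOpen S := (i.1.symm.trans j.1).open_source
  set pr : A × (B × B) → A × B := fun z => (z.1, z.2.1) with hpr
  have hprs : ContDiff ℝ ∞ pr := by fun_prop
  set Φ : A × (B × B) → A × (B × B) := fun z =>
    ((τ (pr z)).1, ((τ (pr z)).2, (fderiv ℝ τ (pr z) (0, z.2.2)).2)) with hΦ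
  have hmem : ∀ z ∈ ((normalBundleChart A B i).symm.trans (normalBundleChart A B j)).source,
      pr z ∈ S := by
    intro z hz
    have h1 : pr z ∈ i.1.target := (mem_normalBundleChart_target i z).1 hz.1
    refine ⟨h1, ?_⟩
    exact (mem_normalBundleChart_source j _).1 hz.2
  have heq : EqOn ((normalBundleChart A B i).symm.trans (normalBundleChart A B j)) Φ
      ((normalBundleChart A B i).symm.trans (normalBundleChart A B j)).source :=
    fun z hz => normalBundleChart_transition i j z (hmem z hz)
  have hopen := ((normalBundleChart A B i).symm.trans (normalBundleChart A B j)).open_source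
  refine (foliationPregroupoid A (B × B)).congr hopen heq ?_
  have hτs : ∀ z, pr z ∈ S → ContDiffAt ℝ ∞ τ (pr z) := fun z hz =>
    hs.contDiffAt (hSo.mem_nhds hz)
  have hds : ∀ z, pr z ∈ S → ContDiffAt ℝ ∞ (fderiv ℝ τ) (pr z) := fun z hz =>
    (hτs z hz).fderiv_right (by simp)
  constructor
  · intro z hz
    have h := hmem z hz
    have h1 : ContDiffAt ℝ ∞ (fun z => τ (pr z)) z := (hτs z h).comp z hprs.contDiffAt
    have h2 : ContDiffAt ℝ ∞ (fun z => fderiv ℝ τ (pr z)) z := (hds z h).comp z hprs.contDiffAt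
    have h3 : ContDiffAt ℝ ∞ (fun z : A × (B × B) => ((0 : A), z.2.2)) z := by fun_prop
    exact (h1.fst.prodMk (h1.snd.prodMk (h2.clm_apply h3).snd)).contDiffWithinAt
  · intro z hz a
    have h := hmem z hz
    have hdτ : DifferentiableAt ℝ τ (pr z) := (hτs z h).differentiableAt (by simp)
    have hddτ : DifferentiableAt ℝ (fderiv ℝ τ) (pr z) := (hds z h).differentiableAt (by simp)
    set prL : A × (B × B) →L[ℝ] A × B := (ContinuousLinearMap.fst ℝ A (B × B)).prod
      ((ContinuousLinearMap.fst ℝ B B).comp (ContinuousLinearMap.snd ℝ A (B × B))) with hprL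
    set qL : A × (B × B) →L[ℝ] A × B := (ContinuousLinearMap.inr ℝ A B).comp
      ((ContinuousLinearMap.snd ℝ B B).comp (ContinuousLinearMap.snd ℝ A (B × B))) with hqL
    have hpr' : HasFDerivAt pr prL z := prL.hasFDerivAt
    have hq' : HasFDerivAt (fun z : A × (B × B) => ((0 : A), z.2.2)) qL z := qL.hasFDerivAt
    have e1 : HasFDerivAt (fun z => τ (pr z)) ((fderiv ℝ τ (pr z)).comp prL) z :=
      hdτ.hasFDerivAt.comp z hpr'
    have e2 : HasFDerivAt (fun z => fderiv ℝ τ (pr z))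
      ((fderiv ℝ (fderiv ℝ τ) (pr z)).comp prL) z := hddτ.hasFDerivAt.comp z hpr'
    have e3 := e2.clm_apply hq'
    have e4 : HasFDerivAt Φ _ z := e1.fst.prodMk (e1.snd.prodMk e3.snd)
    have hsymm : IsSymmSndFDerivAt ℝ τ (pr z) := (hτs z h).isSymmSndFDerivAt <| by
      simpa using WithTop.coe_le_coe.2 (le_top : (2 : ℕ∞) ≤ ⊤)
    have e5 : (fderiv ℝ (fderiv ℝ τ) (pr z) (0, z.2.2) (a, 0)).2 = 0 := by
      have e6 : HasFDerivAt (fun w => (fderiv ℝ τ w (a, 0)).2) _ (pr z) :=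
        (hddτ.hasFDerivAt.clm_apply (hasFDerivAt_const ((a, 0) : A × B) (pr z))).snd
      have e7 : (fun w => (fderiv ℝ τ w (a, 0)).2) =ᶠ[𝓝 (pr z)] fun _ => 0 :=
        Filter.eventually_of_mem (hSo.mem_nhds h) fun w hw => hl w hw a
      have e8 := e6.unique ((hasFDerivAt_const (0 : B) (pr z)).congr_of_eventuallyEq e7)
      simpa using congrArg (fun L => L (0, z.2.2)) e8
    rw [e4.fderiv]
    have e9 : prL (a, 0) = (a, 0) := rfl
    have e10 : qL (a, 0) = 0 := rfl
    simp only [ContinuousLinearMap.prod_apply, ContinuousLinearMap.comp_apply,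
      add_apply, ContinuousLinearMap.flip_apply, e9, e10, map_zero,
      ContinuousLinearMap.coe_snd', zero_add]
    rw [hsymm.eq (a, 0) (0, z.2.2), e5, hl _ h a]
    rfl

end Foliation

/-! ## Normal Riemannian metrics, their curvature, and normal Kähler structures -/

section Metric

variable {A B : Type*} [NormedAddCommGroup A] [NormedSpace ℝ A]
  [NormedAddCommGroup B] [NormedSpace ℝ B]
  {M : Type*} [TopologicalSpace M] [ChartedSpace (A × B) M] [IsFoliated A B M]

/-- The normal vector with components `u` in the preferred adapted chart at `x₀`, at the point with
coordinates `z` in that chart. -/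
def normalVector (x₀ : M) (z : A × B) (u : B) :
    NormalFiber A B ((chartAt (A × B) x₀).symm z) :=
  (trivializationAt B (NormalFiber A B) x₀).symm ((chartAt (A × B) x₀).symm z) u

/-- The components `g(u, w)` of a normal bilinear form in the preferred adapted chart at `x₀`. -/
def formInChart (g : ∀ x : M, LinearMap.BilinForm ℝ (NormalFiber A B x)) (x₀ : M)
    (z : A × B) (u w : B) : ℝ :=
  g ((chartAt (A × B) x₀).symm z) (normalVector x₀ z u) (normalVector x₀ z w)

/-- The components `J u` of a normal endomorphism field in the preferred adapted chart at `x₀`. -/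
def endInChart (J : ∀ x : M, NormalFiber A B x →ₗ[ℝ] NormalFiber A B x) (x₀ : M)
    (z : A × B) (u : B) : B :=
  (trivializationAt B (NormalFiber A B) x₀
    ⟨(chartAt (A × B) x₀).symm z, J ((chartAt (A × B) x₀).symm z) (normalVector x₀ z u)⟩).2

/-- A smooth Riemannian metric in the normal bundle. -/
structure IsNormalMetric (g : ∀ x : M, LinearMap.BilinForm ℝ (NormalFiber A B x)) : Prop where
  symm : ∀ x u w, g x u w = g x w u
  pos : ∀ x u, u ≠ 0 → 0 < g x u u
  smooth : ∀ x₀ u w,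
    ContDiffOn ℝ ∞ (fun z => formInChart g x₀ z u w) (chartAt (A × B) x₀).target

/-- The Christoffel symbols `Γ(u, w)` of the normal Levi-Civita connection of a foliated metric, in
the transverse coordinates of the preferred adapted chart at `x₀`:
`2 g(Γ(u, w), t) = ∂_u g(w, t) + ∂_w g(u, t) - ∂_t g(u, w)` for all `t`. -/
def christoffel (g : ∀ x : M, LinearMap.BilinForm ℝ (NormalFiber A B x)) (x₀ : M)
    (z : A × B) (u w : B) : B :=
  Classical.epsilon fun γ : B => ∀ t : B,
    2 * formInChart g x₀ z γ t =
      fderiv ℝ (fun z' => formInChart g x₀ z' w t) z (0, u) +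
      fderiv ℝ (fun z' => formInChart g x₀ z' u t) z (0, w) -
      fderiv ℝ (fun z' => formInChart g x₀ z' u w) z (0, t)

/-- The curvature `R(u, w) t = ∇_u ∇_w t - ∇_w ∇_u t` of the normal Levi-Civita connection, for
coordinate vectors `u`, `w`, `t`. -/
def normalCurvature (g : ∀ x : M, LinearMap.BilinForm ℝ (NormalFiber A B x)) (x₀ : M)
    (z : A × B) (u w t : B) : B :=
  fderiv ℝ (fun z' => christoffel g x₀ z' w t) z (0, u) -
    fderiv ℝ (fun z' => christoffel g x₀ z' u t) z (0, w) +
    christoffel g x₀ z u (christoffel g x₀ z w t) -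
    christoffel g x₀ z w (christoffel g x₀ z u t)

/-- The normal Ricci tensor `Ric(w, t) = trace (u ↦ R(u, w) t)` at `x`, computed in the preferred
adapted chart at `x`. -/
def normalRicci [FiniteDimensional ℝ B]
    (g : ∀ x : M, LinearMap.BilinForm ℝ (NormalFiber A B x)) (x : M)
    (w t : NormalFiber A B x) : ℝ :=
  ∑ i, (Module.finBasis ℝ B).coord i
    (normalCurvature g x (chartAt (A × B) x x) (Module.finBasis ℝ B i)
      (trivializationAt B (NormalFiber A B) x ⟨x, w⟩).2
      (trivializationAt B (NormalFiber A B) x ⟨x, t⟩).2)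

/-- `(J, g)` is a normal Kähler structure: `g` is a foliated Riemannian metric and `J` a foliated
Hermitian complex structure in the normal bundle, parallel for the Levi-Civita connection. -/
structure IsNormalKahler (J : ∀ x : M, NormalFiber A B x →ₗ[ℝ] NormalFiber A B x)
    (g : ∀ x : M, LinearMap.BilinForm ℝ (NormalFiber A B x)) : Prop where
  metric : IsNormalMetric g
  metric_foliated : ∀ x₀ u w, ∀ z ∈ (chartAt (A × B) x₀).target, ∀ a : A,
    fderiv ℝ (fun z' => formInChart g x₀ z' u w) z (a, 0) = 0
  complex_smooth : ∀ x₀ u,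
    ContDiffOn ℝ ∞ (fun z => endInChart J x₀ z u) (chartAt (A × B) x₀).target
  complex_foliated : ∀ x₀ u, ∀ z ∈ (chartAt (A × B) x₀).target, ∀ a : A,
    fderiv ℝ (fun z' => endInChart J x₀ z' u) z (a, 0) = 0
  complex_sq : ∀ x u, J x (J x u) = -u
  hermitian : ∀ x u w, g x (J x u) (J x w) = g x u w
  parallel : ∀ x₀ u w, ∀ z ∈ (chartAt (A × B) x₀).target,
    fderiv ℝ (fun z' => endInChart J x₀ z' w) z (0, u) +
      christoffel g x₀ z u (endInChart J x₀ z w) -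
      endInChart J x₀ z (christoffel g x₀ z u w) = 0

/-- `(J, g)` is an Einstein–Kähler normal structure with factor `μ`: it is Kähler and
`Ric = μ g`. -/
def IsEinsteinKahler [FiniteDimensional ℝ B]
    (J : ∀ x : M, NormalFiber A B x →ₗ[ℝ] NormalFiber A B x)
    (g : ∀ x : M, LinearMap.BilinForm ℝ (NormalFiber A B x)) (μ : M → ℝ) : Prop :=
  IsNormalKahler J g ∧ ∀ x u w, normalRicci g x u w = μ x * g x u w

/-! ## Normal Hessian structures -/

variable (A B M) in
/-- Connections in the normal bundle; `D Z x X` stands for `(D_X Z)_x`. -/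
abbrev NormalConnection : Type _ :=
  CovariantDerivative 𝓘(ℝ, A × B) B (NormalFiber A B : M → Type _)

/-- `(D, g)` is a normal Hessian structure: `g` is a Riemannian metric in the normal bundle, and `D`
is a normal, torsion-free and flat connection in the normal bundle that satisfies the Codazzi
equation `(D_X g)(Ȳ, Z) = (D_Y g)(X̄, Z)` for local infinitesimal automorphisms `X`, `Y` and local
foliated sections `Z`. -/
structure IsNormalHessian (D : NormalConnection A B M)
    (g : ∀ x : M, LinearMap.BilinForm ℝ (NormalFiber A B x)) : Prop where
  metric : IsNormalMetric g
  smooth : CovariantDerivative.ContMDiffCovariantDerivative D ∞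
  normal : ∀ (U : Set M), IsOpen U → ∀ Z, IsFoliatedSectionOn U Z →
    ∀ x ∈ U, ∀ v ∈ leafSpace A B x, D Z x v = 0
  torsion_free : ∀ (U : Set M), IsOpen U → ∀ X Y, IsSmoothFieldOn U X → IsSmoothFieldOn U Y →
    ∀ x ∈ U,
      D (fun y => normalProj A B y (Y y)) x (X x) - D (fun y => normalProj A B y (X y)) x (Y x) =
        normalProj A B x (VectorField.mlieBracket 𝓘(ℝ, A × B) X Y x)
  flat : ∀ (U : Set M), IsOpen U → ∀ X Y Z, IsSmoothFieldOn U X → IsSmoothFieldOn U Y →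
    IsSmoothSectionOn U Z → ∀ x ∈ U,
      D (fun y => D Z y (Y y)) x (X x) - D (fun y => D Z y (X y)) x (Y x) -
        D Z x (VectorField.mlieBracket 𝓘(ℝ, A × B) X Y x) = 0
  codazzi : ∀ (U : Set M), IsOpen U → ∀ X Y Z, IsInfAutOn U X → IsInfAutOn U Y →
    IsFoliatedSectionOn U Z → ∀ x ∈ U,
      dirDeriv (A := A) (B := B) (fun y => g y (normalProj A B y (Y y)) (Z y)) x (X x) -
          g x (D (fun y => normalProj A B y (Y y)) x (X x)) (Z x) -
          g x (normalProj A B x (Y x)) (D Z x (X x)) =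
        dirDeriv (A := A) (B := B) (fun y => g y (normalProj A B y (X y)) (Z y)) x (Y x) -
          g x (D (fun y => normalProj A B y (X y)) x (Y x)) (Z x) -
          g x (normalProj A B x (X x)) (D Z x (Y x))

/-! ## The normal Kähler structure of the normal bundle

A point `v` of `N(M, F)` over `x` has coordinates `(x, y, dy)` in the chart induced by the preferred
adapted chart at `x`, so that normal vectors of `F^N` at `v` are pairs `(a, b)` with components
`a` along `∂/∂y` and `b` along `∂/∂(dy)`. -/

/-- The differential `N_v(N(M, F), F^N) → N_x(M, F)` of the bundle projection, `(a, b) ↦ a`. -/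
def normalBundleProj (v : NormalBundle A B M) :
    NormalFiber A (B × B) v →ₗ[ℝ] NormalFiber A B v.1 :=
  LinearMap.fst ℝ B B

/-- The component `b` of a normal vector `(a, b)` at `v`. -/
def fibreComponent (v : NormalBundle A B M) :
    NormalFiber A (B × B) v →ₗ[ℝ] NormalFiber A B v.1 :=
  LinearMap.snd ℝ B B

/-- The normal vector `(a, 0)` at `v`. -/
def coordinateLift (v : NormalBundle A B M) :
    NormalFiber A B v.1 →ₗ[ℝ] NormalFiber A (B × B) v :=
  LinearMap.inl ℝ B B

/-- The inclusion `N_x(M, F) → N_v(N(M, F), F^N)`, `b ↦ (0, b)`, of the vectors tangent to the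
fibre. -/
def verticalLift (v : NormalBundle A B M) :
    NormalFiber A B v.1 →ₗ[ℝ] NormalFiber A (B × B) v :=
  LinearMap.inr ℝ B B

/-- The map `a ↦ D_a s`, where `s` is the local section of the normal bundle through `v` with
constant components in the preferred adapted chart at `x`. -/
def connectionTerm (D : NormalConnection A B M) (v : NormalBundle A B M) :
    NormalFiber A B v.1 →ₗ[ℝ] NormalFiber A B v.1 :=
  (D (fun y => (trivializationAt B (NormalFiber A B) v.1).symm y
      (trivializationAt B (NormalFiber A B) v.1 v).2) v.1).toLinearMap ∘ₗ transverseLift A B v.1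

/-- The connector of `D`, `K(a, b) = b + D_a s`. For a section `s` with `s(x) = v` it maps the
derivative of `s` in the direction `X` to `D_X s`, and it is the identity on vertical vectors. If
the transverse coordinates `y` are affine for `D`, then `K(a, b) = b`. -/
def connector (D : NormalConnection A B M) (v : NormalBundle A B M) :
    NormalFiber A (B × B) v →ₗ[ℝ] NormalFiber A B v.1 :=
  fibreComponent v + connectionTerm D v ∘ₗ normalBundleProj v

/-- The `D`-horizontal lift `N_x(M, F) → N_v(N(M, F), F^N)`, `a ↦ (a, -D_a s)`. -/
def horizontalLift (D : NormalConnection A B M) (v : NormalBundle A B M) :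
    NormalFiber A B v.1 →ₗ[ℝ] NormalFiber A (B × B) v :=
  coordinateLift v - verticalLift v ∘ₗ connectionTerm D v

/-- The complex structure `J^N`: it sends the horizontal lift of `a` to the vertical lift of `a`,
and the vertical lift of `b` to minus the horizontal lift of `b`. In affine transverse coordinates
it is multiplication by `√-1` for `z = y + √-1 dy`. -/
def inducedComplex (D : NormalConnection A B M) (v : NormalBundle A B M) :
    NormalFiber A (B × B) v →ₗ[ℝ] NormalFiber A (B × B) v :=
  verticalLift v ∘ₗ normalBundleProj v - horizontalLift D v ∘ₗ connector D v

/-- The metric `g^N`, the orthogonal sum of `g` on the horizontal and on the vertical vectors. In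
affine transverse coordinates it is `∑ g_ij dz^i dz̄^j`. -/
def inducedMetric (D : NormalConnection A B M)
    (g : ∀ x : M, LinearMap.BilinForm ℝ (NormalFiber A B x)) (v : NormalBundle A B M) :
    LinearMap.BilinForm ℝ (NormalFiber A (B × B) v) :=
  (g v.1).comp (normalBundleProj v) (normalBundleProj v) +
    (g v.1).comp (connector D v) (connector D v)

end Metric

/-! ## Koszul forms -/

section Koszul

variable {A : Type*} [NormedAddCommGroup A] [NormedSpace ℝ A] {q : ℕ}
  {M : Type*} [TopologicalSpace M] [ChartedSpace (A × EuclideanSpace ℝ (Fin q)) M]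
  [IsFoliated A (EuclideanSpace ℝ (Fin q)) M]

/-- A smooth normal volume form of `g` on `U`: a normal `q`-form with
`vol(v_1, …, v_q)² = det (g(v_i, v_j))`. -/
structure IsVolumeFormOn
    (g : ∀ x : M, LinearMap.BilinForm ℝ (NormalFiber A (EuclideanSpace ℝ (Fin q)) x)) (U : Set M)
    (vol : ∀ x : M, NormalFiber A (EuclideanSpace ℝ (Fin q)) x [⋀^Fin q]→ₗ[ℝ] ℝ) : Prop where
  sq : ∀ x ∈ U, ∀ v, (vol x v) ^ 2 = (Matrix.of fun i j => g x (v i) (v j)).det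
  smooth : ∀ V ⊆ U, IsOpen V → ∀ Z : Fin q → ∀ x : M, NormalFiber A (EuclideanSpace ℝ (Fin q)) x,
    (∀ i, IsSmoothSectionOn V (Z i)) →
    ContMDiffOn 𝓘(ℝ, A × EuclideanSpace ℝ (Fin q)) 𝓘(ℝ, ℝ) ∞ (fun x => vol x fun i => Z i x) V

/-- The first normal Koszul form `α`: `D_X vol = α(X) vol` for the local normal volume forms `vol`
of `g`. -/
def IsFirstKoszulForm (D : NormalConnection A (EuclideanSpace ℝ (Fin q)) M)
    (g : ∀ x : M, LinearMap.BilinForm ℝ (NormalFiber A (EuclideanSpace ℝ (Fin q)) x))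
    (α : ∀ x : M, NormalFiber A (EuclideanSpace ℝ (Fin q)) x →ₗ[ℝ] ℝ) : Prop :=
  ∀ U : Set M, IsOpen U → ∀ vol, IsVolumeFormOn g U vol →
    ∀ Z : Fin q → ∀ x : M, NormalFiber A (EuclideanSpace ℝ (Fin q)) x,
    (∀ i, IsSmoothSectionOn U (Z i)) → ∀ x ∈ U, ∀ X,
      dirDeriv (A := A) (B := EuclideanSpace ℝ (Fin q)) (fun y => vol y fun i => Z i y) x X -
          ∑ i, vol x (Function.update (fun j => Z j x) i (D (Z i) x X)) =
        α x (normalProj A (EuclideanSpace ℝ (Fin q)) x X) * vol x fun i => Z i x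

/-- The second normal Koszul form `β = D α`, that is `β(X, Y) = X (α(Y)) - α(D_X Y)`. -/
def IsSecondKoszulForm (D : NormalConnection A (EuclideanSpace ℝ (Fin q)) M)
    (α : ∀ x : M, NormalFiber A (EuclideanSpace ℝ (Fin q)) x →ₗ[ℝ] ℝ)
    (β : ∀ x : M, LinearMap.BilinForm ℝ (NormalFiber A (EuclideanSpace ℝ (Fin q)) x)) : Prop :=
  ∀ U : Set M, IsOpen U → ∀ Y, IsSmoothSectionOn U Y → ∀ x ∈ U, ∀ X,
    dirDeriv (A := A) (B := EuclideanSpace ℝ (Fin q)) (fun y => α y (Y y)) x X -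
        α x (D Y x X) =
      β x (normalProj A (EuclideanSpace ℝ (Fin q)) x X) (Y x)

/-- `(D, g)` is Einstein–Hessian with factor `l`: its second normal Koszul form is `β = l g`. -/
def IsEinsteinHessian (D : NormalConnection A (EuclideanSpace ℝ (Fin q)) M)
    (g : ∀ x : M, LinearMap.BilinForm ℝ (NormalFiber A (EuclideanSpace ℝ (Fin q)) x))
    (l : M → ℝ) : Prop :=
  ∃ α β, IsFirstKoszulForm D g α ∧ IsSecondKoszulForm D α β ∧
    ∀ x u w, β x u w = l x * g x u w

end Koszul

end

/-! In an adapted chart the structure becomes a metric `g` and connection coefficients `Γ` that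
depend on the transverse coordinates only. Let `γ` be half of `g⁻¹ (D g)`, the `differenceTensor`.
The Codazzi equation makes `γ` symmetric, and `Γ + γ` preserves `g`, so `Γ + γ` is the Levi-Civita
connection of `g`. The volume forms of `g` are parallel for `Γ + γ`, hence `D vol = tr(γ) vol`: the
first Koszul form is the trace of `γ`, and the second one is the trace of `D γ`
(`traceCLM_differenceDeriv`).

A normal vector of the total space is the pair of its horizontal and vertical parts, that is, a
vector of the complexified normal bundle. In this frame (`splitMap`) the complex structure is the
constant rotation, the metric is `g ⊕ g`, and the Levi-Civita connection form is `Γ` plus the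
complex bilinear extension of `γ` (`localChristoffel_totalMetric`). Absence of torsion uses the
symmetry of `Γ` and `γ` and the flatness of `D`. Complex linearity of the connection form makes the
complex structure parallel, so the Kähler condition always holds and only the Einstein conditions
have to be compared.

The curvature in this frame (`gauge_curvature`) contains first derivatives of `γ` and products of
two copies of `γ`. Flatness of `D`, in the form of `differenceDeriv_comm`, removes the products from
the trace (`frameCurvature_trace_part`). What remains is `Ric = -β` on horizontal vectors, `-β` on
vertical vectors, and no mixed terms (`ricci_total`, `normalRicci_inducedMetric`). Since `β` and `g`
both come from `M`, the equation `Ric = μ g^N` says that `β = -μ g` at every point of the total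
space. Thus `μ = -λ ∘ π` in one direction, and `λ` is `-μ` on the zero section in the other.

Affine coordinates are never chosen: all computations keep `Γ`, so that they can be compared
directly with definitions stated in arbitrary adapted charts. The passage from the global axioms to
a chart is `isHessianChart`; for the induced structure it rests on `connector_coordSection`, the
transformation law of Christoffel symbols. The Koszul forms are identified with their local
expressions through `volumeForm_deriv` and `firstKoszulForm_deriv`. -/

noncomputable section

set_option maxSynthPendingDepth 3

/-! ## Bilinear maps depending on a parameter -/

section Bilinear

variable {E V W F : Type*} [NormedAddCommGroup E] [NormedSpace ℝ E]
  [NormedAddCommGroup V] [NormedSpace ℝ V] [FiniteDimensional ℝ V]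
  [NormedAddCommGroup W] [NormedSpace ℝ W] [FiniteDimensional ℝ W]
  [NormedAddCommGroup F] [NormedSpace ℝ F]

open Classical in
/-- The continuous bilinear map with values `f u w`, or zero if `f` is not bilinear. -/
def bilinearBundle (f : V → W → F) : V →L[ℝ] W →L[ℝ] F :=
  if h : IsBilinearMap ℝ f then h.toContinuousBilinearMap else 0

theorem bilinearBundle_apply {f : V → W → F} (h : IsBilinearMap ℝ f) (u : V) (w : W) :
    bilinearBundle f u w = f u w := by
  simp [bilinearBundle, h]

theorem contDiffOn_bilinear {f : E → V →L[ℝ] W →L[ℝ] F} {T : Set E}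
    (hf : ∀ u w, ContDiffOn ℝ ∞ (fun z => f z u w) T) : ContDiffOn ℝ ∞ f T := by
  rw [contDiffOn_clm_apply]
  intro u
  rw [contDiffOn_clm_apply]
  exact hf u

omit [FiniteDimensional ℝ V] [FiniteDimensional ℝ W] in
theorem fderiv_bilinear_apply {f : E → V →L[ℝ] W →L[ℝ] F} {z : E} (hf : DifferentiableAt ℝ f z)
    (X : E) (u : V) (w : W) : fderiv ℝ f z X u w = fderiv ℝ (fun z => f z u w) z X := by
  have h1 := (hf.hasFDerivAt.clm_apply (hasFDerivAt_const u z)).clm_apply (hasFDerivAt_const w z)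
  rw [h1.fderiv]
  simp

/-- The trace of an endomorphism. -/
def traceCLM (V : Type*) [NormedAddCommGroup V] [NormedSpace ℝ V] [FiniteDimensional ℝ V] :
    (V →L[ℝ] V) →L[ℝ] ℝ :=
  LinearMap.toContinuousLinearMap
    ((LinearMap.trace ℝ V).comp (ContinuousLinearMap.coeLM ℝ))

theorem traceCLM_apply (f : V →L[ℝ] V) : traceCLM V f = LinearMap.trace ℝ V f := rfl

theorem traceCLM_comp_comm (f h : V →L[ℝ] V) : traceCLM V (f.comp h) = traceCLM V (h.comp f) :=
  LinearMap.trace_mul_comm ℝ (f : V →ₗ[ℝ] V) (h : V →ₗ[ℝ] V)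

/-- Insert the identity `inl ∘ fst + inr ∘ snd` after `f` and use the cyclicity of the trace. The
blocks will be the horizontal and the vertical one. -/
theorem trace_prod_eq (f : (V × W) →ₗ[ℝ] (V × W)) :
    LinearMap.trace ℝ (V × W) f =
      LinearMap.trace ℝ V (LinearMap.fst ℝ V W ∘ₗ f ∘ₗ LinearMap.inl ℝ V W) +
        LinearMap.trace ℝ W (LinearMap.snd ℝ V W ∘ₗ f ∘ₗ LinearMap.inr ℝ V W) := by
  have h : f = f ∘ₗ LinearMap.inl ℝ V W ∘ₗ LinearMap.fst ℝ V W +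
      f ∘ₗ LinearMap.inr ℝ V W ∘ₗ LinearMap.snd ℝ V W := by
    ext x <;> simp [← Prod.zero_eq_mk]
  conv_lhs => rw [h]
  rw [map_add]
  exact congrArg₂ (· + ·)
    (LinearMap.trace_comp_comm' (LinearMap.fst ℝ V W) (f ∘ₗ LinearMap.inl ℝ V W))
    (LinearMap.trace_comp_comm' (LinearMap.snd ℝ V W) (f ∘ₗ LinearMap.inr ℝ V W))

end Bilinear

/-! ## Christoffel symbols and curvature in local coordinates -/

section Local

variable {A V : Type*} [NormedAddCommGroup A] [NormedSpace ℝ A]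
  [NormedAddCommGroup V] [NormedSpace ℝ V]

/-- The Christoffel symbols of the coefficients `h` of a metric. -/
def localChristoffel (h : A × V → V → V → ℝ) (z : A × V) (u w : V) : V :=
  Classical.epsilon fun γ : V => ∀ t : V,
    2 * h z γ t =
      fderiv ℝ (fun z' => h z' w t) z (0, u) +
      fderiv ℝ (fun z' => h z' u t) z (0, w) -
      fderiv ℝ (fun z' => h z' u w) z (0, t)

/-- The curvature of the Christoffel symbols `c`. -/
def localCurvature (c : A × V → V → V → V) (z : A × V) (u w t : V) : V :=
  fderiv ℝ (fun z' => c z' w t) z (0, u) - fderiv ℝ (fun z' => c z' u t) z (0, w) +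
    c z u (c z w t) - c z w (c z u t)

/-- A symmetric metric connection is the Levi-Civita connection. -/
theorem localChristoffel_eq {h : A × V → V → V → ℝ} {z : A × V} {c : V → V → V}
    (hsub : ∀ u v t, h z (u - v) t = h z u t - h z v t)
    (hsymm : ∀ u v, h z u v = h z v u)
    (hpos : ∀ u, u ≠ 0 → 0 < h z u u) (csymm : ∀ u w, c u w = c w u)
    (hc : ∀ t u w, fderiv ℝ (fun z' => h z' u w) z (0, t) = h z (c t u) w + h z u (c t w))
    (u w : V) : localChristoffel h z u w = c u w := by
  have h1 : ∀ t : V, 2 * h z (c u w) t =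
      fderiv ℝ (fun z' => h z' w t) z (0, u) +
      fderiv ℝ (fun z' => h z' u t) z (0, w) -
      fderiv ℝ (fun z' => h z' u w) z (0, t) := by
    intro t
    rw [hc, hc, hc, csymm w u, csymm t u, csymm t w, hsymm u (c w t), hsymm w (c u t)]
    ring
  -- The candidate `c u w` is a witness, so the value chosen by `epsilon` satisfies the Koszul
  -- identity as well.
  have h2 := Classical.epsilon_spec (p := fun γ : V => ∀ t : V,
    2 * h z γ t =
      fderiv ℝ (fun z' => h z' w t) z (0, u) +
      fderiv ℝ (fun z' => h z' u t) z (0, w) -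
      fderiv ℝ (fun z' => h z' u w) z (0, t)) ⟨_, h1⟩
  by_contra hne
  have h3 := hpos _ (sub_ne_zero.2 hne)
  rw [hsub] at h3
  -- Two solutions pair equally with every test vector; testing on their difference contradicts
  -- positivity.
  have h4 := h2 (localChristoffel h z u w - c u w)
  rw [← h1] at h4
  change 2 * h z (localChristoffel h z u w) _ = _ at h4
  linarith

/-- A change of frame `Q` conjugates the curvature. -/
theorem gauge_curvature {Q : A × V → V →L[ℝ] V} {Θ : A × V → V →L[ℝ] V →L[ℝ] V}
    {c : A × V → V → V → V} {z : A × V} (hQ : ContDiffAt ℝ ∞ Q z)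
    (hΘ : DifferentiableAt ℝ Θ z) (hcd : ∀ w t, DifferentiableAt ℝ (fun z => c z w t) z)
    (hc : ∀ᶠ z in 𝓝 z, ∀ u w, Q z (c z u w) = fderiv ℝ Q z (0, u) w + Θ z u (Q z w))
    (u w t : V) :
    Q z (localCurvature c z u w t) =
      fderiv ℝ Θ z (0, u) w (Q z t) - fderiv ℝ Θ z (0, w) u (Q z t) +
        Θ z u (Θ z w (Q z t)) - Θ z w (Θ z u (Q z t)) := by
  have hQ1 : DifferentiableAt ℝ Q z := hQ.differentiableAt (by simp)
  have hQ2 : DifferentiableAt ℝ (fderiv ℝ Q) z :=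
    (hQ.fderiv_right (m := ∞) (by simp)).differentiableAt (by simp)
  have hsymm : IsSymmSndFDerivAt ℝ Q z := hQ.isSymmSndFDerivAt <| by
    simpa using WithTop.coe_le_coe.2 (le_top : (2 : ℕ∞) ≤ ⊤)
  -- The defining relation of `c` differentiated in direction `x`. The second derivative of `Q` and
  -- the last two terms taken together are symmetric in `x` and `y`, so they disappear from the
  -- curvature.
  have key : ∀ x y : V, Q z (fderiv ℝ (fun z' => c z' y t) z (0, x)) +
      Q z (c z x (c z y t)) = fderiv ℝ (fderiv ℝ Q) z (0, x) (0, y) t +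
        fderiv ℝ Θ z (0, x) y (Q z t) + Θ z x (Θ z y (Q z t)) +
        Θ z y (fderiv ℝ Q z (0, x) t) + Θ z x (fderiv ℝ Q z (0, y) t) := by
    intro x y
    have e1 := hQ1.hasFDerivAt.clm_apply (hcd y t).hasFDerivAt
    have e2 := (hQ2.hasFDerivAt.clm_apply (hasFDerivAt_const ((0 : A), y) z)).clm_apply
      (hasFDerivAt_const t z)
    have e3 := (hΘ.hasFDerivAt.clm_apply (hasFDerivAt_const y z)).clm_apply
      (hQ1.hasFDerivAt.clm_apply (hasFDerivAt_const t z))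
    have e4 := (e2.add e3).congr_of_eventuallyEq
      (f₁ := fun z => Q z (c z y t)) (hc.mono fun z' hz' => hz' y t)
    have e5 := congrArg (fun L => L (0, x)) (e1.unique e4)
    have e6 := hc.self_of_nhds x (c z y t)
    have e7 := hc.self_of_nhds y t
    simp only [add_apply, ContinuousLinearMap.comp_apply, ContinuousLinearMap.flip_apply,
      zero_apply, map_zero, zero_add] at e5
    rw [e6, e7, map_add]
    linear_combination (norm := module) e5
  have k1 := key u w
  have k2 := key w u
  have k3 := congrArg (fun L => L t) (hsymm.eq (0, u) (0, w))
  simp only [localCurvature, map_sub, map_add]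
  linear_combination (norm := module) k1 - k2 + k3

end Local

/-! ## Hessian structures in local coordinates -/

section HessianLocal

variable {A B : Type*} [NormedAddCommGroup A] [NormedSpace ℝ A]
  [NormedAddCommGroup B] [NormedSpace ℝ B]

/-- The coefficients `g` of the metric and `Γ` of the connection of a normal Hessian structure in
an adapted chart with target `T`. -/
structure IsHessianChart (T : Set (A × B)) (g : A × B → B →L[ℝ] B →L[ℝ] ℝ)
    (Γ : A × B → B →L[ℝ] B →L[ℝ] B) : Prop where
  isOpen : IsOpen T
  metric_smooth : ContDiffOn ℝ ∞ g T
  conn_smooth : ContDiffOn ℝ ∞ Γ T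
  metric_symm : ∀ z ∈ T, ∀ u w, g z u w = g z w u
  metric_pos : ∀ z ∈ T, ∀ u, u ≠ 0 → 0 < g z u u
  metric_leaf : ∀ z ∈ T, ∀ a : A, fderiv ℝ g z (a, 0) = 0
  conn_leaf : ∀ z ∈ T, ∀ a : A, fderiv ℝ Γ z (a, 0) = 0
  conn_symm : ∀ z ∈ T, ∀ u w, Γ z u w = Γ z w u
  flat : ∀ z ∈ T, ∀ u w t, fderiv ℝ Γ z (0, u) w t + Γ z u (Γ z w t) =
    fderiv ℝ Γ z (0, w) u t + Γ z w (Γ z u t)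
  codazzi : ∀ z ∈ T, ∀ u w t,
    fderiv ℝ g z (0, u) w t - g z (Γ z u w) t - g z w (Γ z u t) =
      fderiv ℝ g z (0, w) u t - g z (Γ z w u) t - g z u (Γ z w t)

/-- The form `t ↦ (D_u g)(w, t)`. -/
def metricDeriv (g : A × B → B →L[ℝ] B →L[ℝ] ℝ) (Γ : A × B → B →L[ℝ] B →L[ℝ] B) (z : A × B)
    (u w : B) : B →L[ℝ] ℝ :=
  fderiv ℝ g z (0, u) w - g z (Γ z u w) - (g z w).comp (Γ z u)

variable [FiniteDimensional ℝ B]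

/-- The difference of the Levi-Civita connection of `g` and the connection `Γ`. -/
def differenceTensor (g : A × B → B →L[ℝ] B →L[ℝ] ℝ) (Γ : A × B → B →L[ℝ] B →L[ℝ] B)
    (z : A × B) : B →L[ℝ] B →L[ℝ] B :=
  bilinearBundle fun u w => (2⁻¹ : ℝ) • (g z).inverse (metricDeriv g Γ z u w)

/-- The first Koszul form: the trace of the difference tensor. -/
def koszulOne (g : A × B → B →L[ℝ] B →L[ℝ] ℝ) (Γ : A × B → B →L[ℝ] B →L[ℝ] B)
    (z : A × B) : B →L[ℝ] ℝ :=
  (traceCLM B).comp (differenceTensor g Γ z)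

/-- The second Koszul form: the covariant derivative of the first one. -/
def koszulTwo (g : A × B → B →L[ℝ] B →L[ℝ] ℝ) (Γ : A × B → B →L[ℝ] B →L[ℝ] B)
    (z : A × B) (u w : B) : ℝ :=
  fderiv ℝ (koszulOne g Γ) z (0, u) w - koszulOne g Γ z (Γ z u w)

/-- The covariant derivative of the difference tensor. -/
def differenceDeriv (g : A × B → B →L[ℝ] B →L[ℝ] ℝ) (Γ : A × B → B →L[ℝ] B →L[ℝ] B)
    (z : A × B) (a b c : B) : B :=
  fderiv ℝ (differenceTensor g Γ) z (0, a) b c + Γ z a (differenceTensor g Γ z b c) -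
    differenceTensor g Γ z (Γ z a b) c - differenceTensor g Γ z b (Γ z a c)

namespace IsHessianChart

variable {T : Set (A × B)} {g : A × B → B →L[ℝ] B →L[ℝ] ℝ} {Γ : A × B → B →L[ℝ] B →L[ℝ] B}

/-- Positive definiteness gives injectivity, and the dimensions agree. This makes `(g z).inverse` a
true inverse, and hence smooth in `z`. -/
theorem exists_equiv (h : IsHessianChart T g Γ) {z : A × B} (hz : z ∈ T) :
    ∃ e : B ≃L[ℝ] (B →L[ℝ] ℝ), (e : B →L[ℝ] (B →L[ℝ] ℝ)) = g z := by
  have hinj : Function.Injective (g z).toLinearMap := by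
    rw [← LinearMap.ker_eq_bot, LinearMap.ker_eq_bot']
    intro u hu
    by_contra hne
    have h1 := h.metric_pos z hz u hne
    have h2 : g z u = 0 := hu
    simp [h2] at h1
  have hdim : Module.finrank ℝ B = Module.finrank ℝ (B →L[ℝ] ℝ) := by
    rw [← LinearEquiv.finrank_eq (LinearMap.toContinuousLinearMap (𝕜 := ℝ) (E := B) (F' := ℝ))]
    exact (Subspace.dual_finrank_eq (K := ℝ) (V := B)).symm
  refine ⟨(LinearMap.linearEquivOfInjective (g z).toLinearMap hinj hdim).toContinuousLinearEquiv,
    ?_⟩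
  ext u w
  rfl

/-- No condition on `g` or `Γ` is needed: `metricDeriv` is always bilinear, and `inverse` is a
linear map even where `g z` is not invertible. -/
theorem _root_.differenceTensor_apply (g : A × B → B →L[ℝ] B →L[ℝ] ℝ)
    (Γ : A × B → B →L[ℝ] B →L[ℝ] B) (z : A × B) (u w : B) :
    differenceTensor g Γ z u w = (2⁻¹ : ℝ) • (g z).inverse (metricDeriv g Γ z u w) := by
  have hl : ∀ u u' : B, ((0 : A), u + u') = (0, u) + (0, u') := by simp
  have hs : ∀ (c : ℝ) (u : B), ((0 : A), c • u) = c • (0, u) := by simp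
  refine bilinearBundle_apply ⟨?_, ?_, ?_, ?_⟩ u w
  · intro u u' w
    have e : metricDeriv g Γ z (u + u') w = metricDeriv g Γ z u w + metricDeriv g Γ z u' w := by
      ext t
      simp only [metricDeriv, hl, map_add, add_apply, sub_apply, ContinuousLinearMap.comp_apply]
      ring
    rw [e, map_add, smul_add]
  · intro c u w
    have e : metricDeriv g Γ z (c • u) w = c • metricDeriv g Γ z u w := by
      ext t
      simp only [metricDeriv, hs, map_smul, smul_apply, sub_apply, smul_eq_mul,
        ContinuousLinearMap.comp_apply]
      ring
    rw [e, map_smul, smul_comm]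
  · intro u w w'
    have e : metricDeriv g Γ z u (w + w') = metricDeriv g Γ z u w + metricDeriv g Γ z u w' := by
      ext t
      simp only [metricDeriv, map_add, add_apply, sub_apply, ContinuousLinearMap.comp_apply]
      ring
    rw [e, map_add, smul_add]
  · intro c u w
    have e : metricDeriv g Γ z u (c • w) = c • metricDeriv g Γ z u w := by
      ext t
      simp only [metricDeriv, map_smul, smul_apply, sub_apply, smul_eq_mul,
        ContinuousLinearMap.comp_apply]
      ring
    rw [e, map_smul, smul_comm]

theorem metric_differenceTensor (h : IsHessianChart T g Γ) {z : A × B} (hz : z ∈ T) (u w t : B) :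
    2 * g z (differenceTensor g Γ z u w) t =
      fderiv ℝ g z (0, u) w t - g z (Γ z u w) t - g z w (Γ z u t) := by
  obtain ⟨e, he⟩ := h.exists_equiv hz
  have h1 : g z ((g z).inverse (metricDeriv g Γ z u w)) = metricDeriv g Γ z u w := by
    rw [← he, ContinuousLinearMap.inverse_equiv]
    simp
  rw [_root_.differenceTensor_apply, map_smul, h1]
  simp [metricDeriv]

omit [FiniteDimensional ℝ B] in
theorem eq_of_metric (h : IsHessianChart T g Γ) {z : A × B} (hz : z ∈ T) {u w : B}
    (huw : ∀ t, g z u t = g z w t) : u = w := by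
  by_contra hne
  have := h.metric_pos z hz _ (sub_ne_zero.2 hne)
  simp [huw] at this

omit [FiniteDimensional ℝ B] in
theorem metric_symm_deriv (h : IsHessianChart T g Γ) {z : A × B} (hz : z ∈ T) (X : A × B)
    (w t : B) : fderiv ℝ g z X w t = fderiv ℝ g z X t w := by
  have hd := (h.metric_smooth.contDiffAt (h.isOpen.mem_nhds hz)).differentiableAt (by simp)
  rw [fderiv_bilinear_apply hd, fderiv_bilinear_apply hd]
  congr 1
  apply Filter.EventuallyEq.fderiv_eq
  filter_upwards [h.isOpen.mem_nhds hz] with z hz using h.metric_symm z hz w t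

/-- By the symmetry of `g`, both `g(γ_u w, t)` and `g(w, γ_u t)` are half of `(D_u g)(w, t)`. Adding
them shows that the connection `Γ + γ` is metric. -/
theorem fderiv_metric (h : IsHessianChart T g Γ) {z : A × B} (hz : z ∈ T) (u w t : B) :
    fderiv ℝ g z (0, u) w t =
      g z (Γ z u w + differenceTensor g Γ z u w) t +
        g z w (Γ z u t + differenceTensor g Γ z u t) := by
  have h1 := h.metric_differenceTensor hz u w t
  have h2 := h.metric_differenceTensor hz u t w
  rw [h.metric_symm_deriv hz _ t w, h.metric_symm z hz _ w, h.metric_symm z hz t,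
    h.metric_symm z hz _ w] at h2
  simp only [map_add, add_apply]
  linarith

theorem metric_differenceTensor_comm (h : IsHessianChart T g Γ) {z : A × B} (hz : z ∈ T)
    (u w t : B) : g z (differenceTensor g Γ z u w) t = g z w (differenceTensor g Γ z u t) := by
  have h1 := h.metric_differenceTensor hz u w t
  have h2 := h.metric_differenceTensor hz u t w
  rw [h.metric_symm_deriv hz _ t w, h.metric_symm z hz _ w, h.metric_symm z hz t,
    h.metric_symm z hz _ w] at h2
  linarith

/-- This is the Codazzi equation after lowering an index with `g`. Together with `conn_symm` it
makes `Γ + γ` torsion-free. -/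
theorem differenceTensor_symm (h : IsHessianChart T g Γ) {z : A × B} (hz : z ∈ T) (u w : B) :
    differenceTensor g Γ z u w = differenceTensor g Γ z w u := by
  refine h.eq_of_metric hz fun t => ?_
  have h1 := h.metric_differenceTensor hz u w t
  have h2 := h.metric_differenceTensor hz w u t
  have h3 := h.codazzi z hz u w t
  linarith

theorem differenceTensor_smooth (h : IsHessianChart T g Γ) :
    ContDiffOn ℝ ∞ (differenceTensor g Γ) T := by
  refine contDiffOn_bilinear fun u w => ?_
  simp only [_root_.differenceTensor_apply]
  intro z hz
  have hn := h.isOpen.mem_nhds hz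
  obtain ⟨e, he⟩ := h.exists_equiv hz
  have hg := h.metric_smooth.contDiffAt hn
  have hΓ := h.conn_smooth.contDiffAt hn
  have h1 : ContDiffAt ℝ ∞ (fun z => (g z).inverse) z := by
    have := contDiffAt_map_inverse (𝕜 := ℝ) (n := ∞) e
    rw [he] at this
    exact this.comp z hg
  have h2 : ContDiffAt ℝ ∞ (fun z => metricDeriv g Γ z u w) z := by
    have h3 : ContDiffAt ℝ ∞ (fderiv ℝ g) z := hg.fderiv_right (by simp)
    unfold metricDeriv
    exact (((h3.clm_apply contDiffAt_const).clm_apply contDiffAt_const).sub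
      (hg.clm_apply ((hΓ.clm_apply contDiffAt_const).clm_apply contDiffAt_const))).sub
      ((hg.clm_apply contDiffAt_const).clm_comp (hΓ.clm_apply contDiffAt_const))
  exact ((h1.clm_apply h2).const_smul _).contDiffWithinAt

theorem differenceTensor_deriv_symm (h : IsHessianChart T g Γ) {z : A × B} (hz : z ∈ T)
    (X : A × B) (u w : B) :
    fderiv ℝ (differenceTensor g Γ) z X u w = fderiv ℝ (differenceTensor g Γ) z X w u := by
  have hd := (h.differenceTensor_smooth.contDiffAt (h.isOpen.mem_nhds hz)).differentiableAt
    (by simp)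
  rw [fderiv_bilinear_apply hd, fderiv_bilinear_apply hd]
  congr 1
  apply Filter.EventuallyEq.fderiv_eq
  filter_upwards [h.isOpen.mem_nhds hz] with z hz using h.differenceTensor_symm hz u w

/-- Since `D` is flat and torsion-free, the second covariant derivative of `g` is symmetric in its
two directions. Writing `D g` as `2 g(γ ·, ·)` and differentiating once more gives `D γ` plus a
product of two copies of `γ`, with coefficient `2` because `D g` itself is twice `g γ`. This is the
only consequence of flatness for `γ` that the Ricci computation needs. -/
theorem differenceDeriv_comm (h : IsHessianChart T g Γ) {z : A × B} (hz : z ∈ T) (a b c : B) :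
    differenceDeriv g Γ z a b c +
        (2 : ℝ) • differenceTensor g Γ z a (differenceTensor g Γ z b c) =
      differenceDeriv g Γ z b a c +
        (2 : ℝ) • differenceTensor g Γ z b (differenceTensor g Γ z a c) := by
  have hn := h.isOpen.mem_nhds hz
  have hg := h.metric_smooth.contDiffAt hn
  have hg1 := hg.differentiableAt (by simp)
  have hg2 : DifferentiableAt ℝ (fderiv ℝ g) z :=
    (hg.fderiv_right (m := ∞) (by simp)).differentiableAt (by simp)
  have hΓ := (h.conn_smooth.contDiffAt hn).differentiableAt (by simp)
  have hγ := (h.differenceTensor_smooth.contDiffAt hn).differentiableAt (by simp)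
  have hsymm : IsSymmSndFDerivAt ℝ g z := hg.isSymmSndFDerivAt <| by
    simpa using WithTop.coe_le_coe.2 (le_top : (2 : ℕ∞) ≤ ⊤)
  have cst : ∀ b : B, HasFDerivAt (fun _ : A × B => b) (0 : A × B →L[ℝ] B) z := fun b =>
    hasFDerivAt_const b z
  refine h.eq_of_metric hz fun d => ?_
  -- The derivative in direction `a` of the defining equation of `γ`. The difference of its
  -- instances at `(a, b)` and `(b, a)` no longer contains second derivatives of `g`.
  have key : ∀ a b : B, 2 * (fderiv ℝ g z (0, a) (differenceTensor g Γ z b c) d +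
      g z (fderiv ℝ (differenceTensor g Γ) z (0, a) b c) d) =
      fderiv ℝ (fderiv ℝ g) z (0, a) (0, b) c d -
      (fderiv ℝ g z (0, a) (Γ z b c) d + g z (fderiv ℝ Γ z (0, a) b c) d) -
      (fderiv ℝ g z (0, a) c (Γ z b d) + g z c (fderiv ℝ Γ z (0, a) b d)) := by
    intro a b
    have e1 := ((hg1.hasFDerivAt.clm_apply
      ((hγ.hasFDerivAt.clm_apply (cst b)).clm_apply (cst c))).clm_apply (cst d)).const_mul 2
    have e2 := ((hg2.hasFDerivAt.clm_apply (hasFDerivAt_const ((0 : A), b) z)).clm_apply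
      (cst c)).clm_apply (cst d)
    have e3 := (hg1.hasFDerivAt.clm_apply
      ((hΓ.hasFDerivAt.clm_apply (cst b)).clm_apply (cst c))).clm_apply (cst d)
    have e4 := (hg1.hasFDerivAt.clm_apply (cst c)).clm_apply
      ((hΓ.hasFDerivAt.clm_apply (cst b)).clm_apply (cst d))
    have e5 := ((e2.sub e3).sub e4).congr_of_eventuallyEq
      (f₁ := fun z => 2 * g z (differenceTensor g Γ z b c) d) (by
        filter_upwards [hn] with z hz using h.metric_differenceTensor hz b c d)
    have e6 := congrArg (fun L => L (0, a)) (e1.unique e5)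
    simp only [add_apply, sub_apply, smul_apply, ContinuousLinearMap.comp_apply,
      ContinuousLinearMap.flip_apply, zero_apply, map_zero, zero_add, smul_eq_mul] at e6
    linarith
  have k1 := key a b
  have k2 := key b a
  have k3 := congrArg (fun L => L c d) (hsymm.eq (0, a) (0, b))
  have k4 := congrArg (fun v => g z v d) (h.flat z hz a b c)
  have k5 := congrArg (fun v => g z c v) (h.flat z hz a b d)
  have k6 := h.conn_symm z hz a b
  -- All first derivatives of `g` are expressed by `Γ` and `γ`. With every `γ` moved to the second
  -- argument by self-adjointness, the identity is linear in the remaining terms.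
  simp only [h.fderiv_metric hz, map_add, add_apply] at k1 k2 k4 k5
  simp only [differenceDeriv, map_add, map_sub, map_smul, smul_apply, smul_eq_mul, add_apply,
    sub_apply, k6]
  simp only [h.metric_differenceTensor_comm hz] at k1 k2 ⊢
  linarith

/-- By the symmetry of `γ` the endomorphism is also `b ↦ (D_a γ)(c, b)`. Its terms `Γ_a γ_c - γ_c
Γ_a` form a commutator and have trace zero; the others are the covariant derivative of `tr γ`. -/
theorem traceCLM_differenceDeriv (h : IsHessianChart T g Γ) {z : A × B} (hz : z ∈ T) (a c : B)
    {L : B →ₗ[ℝ] B} (hL : ∀ b, L b = differenceDeriv g Γ z a b c) :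
    LinearMap.trace ℝ B L = koszulTwo g Γ z a c := by
  have hγ := (h.differenceTensor_smooth.contDiffAt (h.isOpen.mem_nhds hz)).differentiableAt
    (by simp)
  have h1 : fderiv ℝ (koszulOne g Γ) z (0, a) c =
      traceCLM B (fderiv ℝ (differenceTensor g Γ) z (0, a) c) := by
    have := (hasFDerivAt_const (traceCLM B) z).clm_comp hγ.hasFDerivAt
    unfold koszulOne
    rw [this.fderiv]
    simp
  have h2 : LinearMap.trace ℝ B L = traceCLM B (fderiv ℝ (differenceTensor g Γ) z (0, a) c +
      (Γ z a).comp (differenceTensor g Γ z c) - (differenceTensor g Γ z c).comp (Γ z a) -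
      differenceTensor g Γ z (Γ z a c)) := by
    rw [traceCLM_apply]
    congr 1
    ext b
    rw [hL]
    change _ = fderiv ℝ (differenceTensor g Γ) z (0, a) c b +
      Γ z a (differenceTensor g Γ z c b) - differenceTensor g Γ z c (Γ z a b) -
      differenceTensor g Γ z (Γ z a c) b
    rw [differenceDeriv, h.differenceTensor_symm hz c, h.differenceTensor_symm hz c,
      h.differenceTensor_deriv_symm hz _ c, h.differenceTensor_symm hz _ b]
  rw [h2, map_sub, map_sub, map_add, traceCLM_comp_comm, koszulTwo, h1]
  simp [koszulOne]

theorem koszulOne_smooth (h : IsHessianChart T g Γ) : ContDiffOn ℝ ∞ (koszulOne g Γ) T :=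
  contDiffOn_const.clm_comp h.differenceTensor_smooth

end IsHessianChart

end HessianLocal

/-! ## The induced structure of the total space in local coordinates -/

section TotalLocal

variable {A B : Type*} [NormedAddCommGroup A] [NormedSpace ℝ A]
  [NormedAddCommGroup B] [NormedSpace ℝ B]

variable (A B) in
/-- The projection `(x, y, dy) ↦ (x, y)`. -/
def baseProj : A × (B × B) →L[ℝ] A × B :=
  (ContinuousLinearMap.fst ℝ A (B × B)).prod
    ((ContinuousLinearMap.fst ℝ B B).comp (ContinuousLinearMap.snd ℝ A (B × B)))

/-- Horizontal and vertical parts `(a, b + Γ(a) dy)` of a coordinate vector `(a, b)`. -/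
def splitMap (Γ : A × B → B →L[ℝ] B →L[ℝ] B) (z : A × (B × B)) : (B × B) →L[ℝ] (B × B) :=
  (ContinuousLinearMap.fst ℝ B B).prod
    (ContinuousLinearMap.snd ℝ B B +
      ((Γ (baseProj A B z)).flip z.2.2).comp (ContinuousLinearMap.fst ℝ B B))

theorem splitMap_apply (Γ : A × B → B →L[ℝ] B →L[ℝ] B) (z : A × (B × B)) (U : B × B) :
    splitMap Γ z U = (U.1, U.2 + Γ (baseProj A B z) U.1 z.2.2) := rfl

/-- The inverse of the splitting into horizontal and vertical parts. -/
def unsplitMap (Γ : A × B → B →L[ℝ] B →L[ℝ] B) (z : A × (B × B)) : (B × B) →L[ℝ] (B × B) :=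
  (ContinuousLinearMap.fst ℝ B B).prod
    (ContinuousLinearMap.snd ℝ B B -
      ((Γ (baseProj A B z)).flip z.2.2).comp (ContinuousLinearMap.fst ℝ B B))

theorem unsplitMap_apply (Γ : A × B → B →L[ℝ] B →L[ℝ] B) (z : A × (B × B)) (U : B × B) :
    unsplitMap Γ z U = (U.1, U.2 - Γ (baseProj A B z) U.1 z.2.2) := rfl

theorem splitMap_unsplitMap (Γ : A × B → B →L[ℝ] B →L[ℝ] B) (z : A × (B × B)) (U : B × B) :
    splitMap Γ z (unsplitMap Γ z U) = U := by
  simp [splitMap_apply, unsplitMap_apply]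

theorem unsplitMap_splitMap (Γ : A × B → B →L[ℝ] B →L[ℝ] B) (z : A × (B × B)) (U : B × B) :
    unsplitMap Γ z (splitMap Γ z U) = U := by
  simp [splitMap_apply, unsplitMap_apply]

/-- The induced metric in coordinates. -/
def totalMetric (g : A × B → B →L[ℝ] B →L[ℝ] ℝ) (Γ : A × B → B →L[ℝ] B →L[ℝ] B)
    (z : A × (B × B)) (U W : B × B) : ℝ :=
  g (baseProj A B z) (splitMap Γ z U).1 (splitMap Γ z W).1 +
    g (baseProj A B z) (splitMap Γ z U).2 (splitMap Γ z W).2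

variable (B) in
/-- Multiplication by `√-1` on `B × B`. -/
def complexRotation : (B × B) →L[ℝ] (B × B) :=
  (-ContinuousLinearMap.snd ℝ B B).prod (ContinuousLinearMap.fst ℝ B B)

theorem complexRotation_apply (U : B × B) : complexRotation B U = (-U.2, U.1) := rfl

/-- The induced complex structure in coordinates. -/
def totalComplex (Γ : A × B → B →L[ℝ] B →L[ℝ] B) (z : A × (B × B)) (U : B × B) : B × B :=
  unsplitMap Γ z (complexRotation B (splitMap Γ z U))

theorem hasFDerivAt_comp_baseProj {F : Type*} [NormedAddCommGroup F] [NormedSpace ℝ F]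
    {f : A × B → F} {T : Set (A × B)} (hT : IsOpen T) (hf : ContDiffOn ℝ ∞ f T)
    {z : A × (B × B)} (hz : baseProj A B z ∈ T) :
    HasFDerivAt (fun z => f (baseProj A B z))
      ((fderiv ℝ f (baseProj A B z)).comp (baseProj A B)) z :=
  ((hf.contDiffAt (hT.mem_nhds hz)).differentiableAt (by simp)).hasFDerivAt.comp z
    (baseProj A B).hasFDerivAt

theorem hasFDerivAt_fibre (z : A × (B × B)) :
    HasFDerivAt (fun z : A × (B × B) => z.2.2)
      ((ContinuousLinearMap.snd ℝ B B).comp (ContinuousLinearMap.snd ℝ A (B × B))) z :=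
  ((ContinuousLinearMap.snd ℝ B B).comp (ContinuousLinearMap.snd ℝ A (B × B))).hasFDerivAt

variable [FiniteDimensional ℝ B]

theorem splitMap_smooth {Γ : A × B → B →L[ℝ] B →L[ℝ] B} {T : Set (A × B)}
    (hΓ : ContDiffOn ℝ ∞ Γ T) : ContDiffOn ℝ ∞ (splitMap Γ) (baseProj A B ⁻¹' T) := by
  rw [contDiffOn_clm_apply]
  intro U
  have h1 : ContDiffOn ℝ ∞ (fun z => Γ (baseProj A B z)) (baseProj A B ⁻¹' T) :=
    hΓ.comp (baseProj A B).contDiff.contDiffOn fun z hz => hz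
  exact contDiffOn_const.prodMk (contDiffOn_const.add
    ((h1.clm_apply contDiffOn_const).clm_apply (by fun_prop)))

theorem unsplitMap_smooth {Γ : A × B → B →L[ℝ] B →L[ℝ] B} {T : Set (A × B)}
    (hΓ : ContDiffOn ℝ ∞ Γ T) : ContDiffOn ℝ ∞ (unsplitMap Γ) (baseProj A B ⁻¹' T) := by
  refine (splitMap_smooth hΓ.neg).congr fun z _ => ?_
  ext U <;> simp [splitMap_apply, unsplitMap_apply, sub_eq_add_neg]

/-- The complex bilinear extension of the difference tensor. -/
def complexDifference (g : A × B → B →L[ℝ] B →L[ℝ] ℝ) (Γ : A × B → B →L[ℝ] B →L[ℝ] B)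
    (z : A × B) (α ζ : B × B) : B × B :=
  (differenceTensor g Γ z α.1 ζ.1 - differenceTensor g Γ z α.2 ζ.2,
    differenceTensor g Γ z α.1 ζ.2 + differenceTensor g Γ z α.2 ζ.1)

/-- The connection form of the Levi-Civita connection of the induced metric in the frame of
horizontal and vertical vectors. -/
def connForm (g : A × B → B →L[ℝ] B →L[ℝ] ℝ) (Γ : A × B → B →L[ℝ] B →L[ℝ] B)
    (z : A × (B × B)) : (B × B) →L[ℝ] (B × B) →L[ℝ] (B × B) :=
  bilinearBundle fun U ζ =>
    (Γ (baseProj A B z) U.1 ζ.1, Γ (baseProj A B z) U.1 ζ.2) +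
      complexDifference g Γ (baseProj A B z) (splitMap Γ z U) ζ

theorem connForm_apply (g : A × B → B →L[ℝ] B →L[ℝ] ℝ) (Γ : A × B → B →L[ℝ] B →L[ℝ] B)
    (z : A × (B × B)) (U ζ : B × B) : connForm g Γ z U ζ =
    (Γ (baseProj A B z) U.1 ζ.1, Γ (baseProj A B z) U.1 ζ.2) +
      complexDifference g Γ (baseProj A B z) (splitMap Γ z U) ζ := by
  refine bilinearBundle_apply ⟨?_, ?_, ?_, ?_⟩ U ζ <;> intros <;> ext <;>
    simp only [complexDifference, map_add, map_smul, Prod.fst_add, Prod.snd_add, Prod.smul_fst,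
      Prod.smul_snd, add_apply, smul_apply] <;> module

/-- The Christoffel symbols of the induced metric. -/
def totalChristoffel (g : A × B → B →L[ℝ] B →L[ℝ] ℝ) (Γ : A × B → B →L[ℝ] B →L[ℝ] B)
    (z : A × (B × B)) (U W : B × B) : B × B :=
  unsplitMap Γ z (fderiv ℝ (splitMap Γ) z (0, U) W + connForm g Γ z U (splitMap Γ z W))

namespace IsHessianChart

variable {T : Set (A × B)} {g : A × B → B →L[ℝ] B →L[ℝ] ℝ} {Γ : A × B → B →L[ℝ] B →L[ℝ] B}

omit [FiniteDimensional ℝ B] in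
theorem isOpen_total (h : IsHessianChart T g Γ) : IsOpen (baseProj A B ⁻¹' T) :=
  h.isOpen.preimage (baseProj A B).continuous

theorem connForm_smooth (h : IsHessianChart T g Γ) :
    ContDiffOn ℝ ∞ (connForm g Γ) (baseProj A B ⁻¹' T) := by
  refine contDiffOn_bilinear fun U ζ => ?_
  simp only [connForm_apply]
  have h1 : ContDiffOn ℝ ∞ (fun z => Γ (baseProj A B z)) (baseProj A B ⁻¹' T) :=
    h.conn_smooth.comp (baseProj A B).contDiff.contDiffOn fun z hz => hz
  have h2 : ContDiffOn ℝ ∞ (fun z => differenceTensor g Γ (baseProj A B z)) (baseProj A B ⁻¹' T) :=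
    h.differenceTensor_smooth.comp (baseProj A B).contDiff.contDiffOn fun z hz => hz
  have h3 := (splitMap_smooth h.conn_smooth).clm_apply (contDiffOn_const (c := U))
  have h4 : ∀ v w : B, ContDiffOn ℝ ∞ (fun z => Γ (baseProj A B z) v w) (baseProj A B ⁻¹' T) :=
    fun v w => (h1.clm_apply contDiffOn_const).clm_apply contDiffOn_const
  have h5 : ∀ w : B, ContDiffOn ℝ ∞
      (fun z => differenceTensor g Γ (baseProj A B z) (splitMap Γ z U).1 w)
      (baseProj A B ⁻¹' T) :=
    fun w => (h2.clm_apply h3.fst).clm_apply contDiffOn_const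
  have h6 : ∀ w : B, ContDiffOn ℝ ∞
      (fun z => differenceTensor g Γ (baseProj A B z) (splitMap Γ z U).2 w)
      (baseProj A B ⁻¹' T) :=
    fun w => (h2.clm_apply h3.snd).clm_apply contDiffOn_const
  exact ((h4 _ _).prodMk (h4 _ _)).add (((h5 _).sub (h6 _)).prodMk ((h5 _).add (h6 _)))

section

variable (h : IsHessianChart T g Γ) {z : A × (B × B)} (hz : baseProj A B z ∈ T)

include h hz

theorem hasFDerivAt_splitMap : HasFDerivAt (splitMap Γ) (fderiv ℝ (splitMap Γ) z) z :=
  (((splitMap_smooth h.conn_smooth).contDiffAt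
    (h.isOpen_total.mem_nhds hz)).differentiableAt (by simp)).hasFDerivAt

theorem fderiv_splitMap (X : A × (B × B)) (W : B × B) :
    fderiv ℝ (splitMap Γ) z X W =
      (0, fderiv ℝ Γ (baseProj A B z) (baseProj A B X) W.1 z.2.2 +
        Γ (baseProj A B z) W.1 X.2.2) := by
  have e1 := (h.hasFDerivAt_splitMap hz).clm_apply (hasFDerivAt_const W z)
  have e2 := (hasFDerivAt_const W.1 z).prodMk ((hasFDerivAt_const W.2 z).add
    (((hasFDerivAt_comp_baseProj h.isOpen h.conn_smooth hz).clm_apply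
      (hasFDerivAt_const W.1 z)).clm_apply (hasFDerivAt_fibre z)))
  have e3 := congrArg (fun L => L X) (e1.unique e2)
  simpa [add_comm] using e3

theorem fderiv_splitMap_leaf (a : A) (W : B × B) :
    fderiv ℝ (splitMap Γ) z (a, 0) W = 0 := by
  rw [h.fderiv_splitMap hz]
  have : baseProj A B (a, (0 : B × B)) = (a, 0) := rfl
  rw [this, h.conn_leaf _ hz]
  simp

theorem fderiv_connForm (U W ζ : B × B) :
    fderiv ℝ (connForm g Γ) z (0, U) W ζ =
      (fderiv ℝ Γ (baseProj A B z) (0, U.1) W.1 ζ.1,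
        fderiv ℝ Γ (baseProj A B z) (0, U.1) W.1 ζ.2) +
      (fderiv ℝ (differenceTensor g Γ) (baseProj A B z) (0, U.1) (splitMap Γ z W).1 ζ.1 -
        fderiv ℝ (differenceTensor g Γ) (baseProj A B z) (0, U.1) (splitMap Γ z W).2 ζ.2,
       fderiv ℝ (differenceTensor g Γ) (baseProj A B z) (0, U.1) (splitMap Γ z W).1 ζ.2 +
        fderiv ℝ (differenceTensor g Γ) (baseProj A B z) (0, U.1) (splitMap Γ z W).2 ζ.1) +
      complexDifference g Γ (baseProj A B z) (fderiv ℝ (splitMap Γ) z (0, U) W) ζ := by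
  have e1 := (((h.connForm_smooth.contDiffAt (h.isOpen_total.mem_nhds hz)).differentiableAt
    (by simp)).hasFDerivAt.clm_apply (hasFDerivAt_const W z)).clm_apply (hasFDerivAt_const ζ z)
  have hΓ := hasFDerivAt_comp_baseProj h.isOpen h.conn_smooth hz
  have hγ := hasFDerivAt_comp_baseProj h.isOpen h.differenceTensor_smooth hz
  have hQ := (h.hasFDerivAt_splitMap hz).clm_apply (hasFDerivAt_const W z)
  have d1 : ∀ w : B, _ := fun w => (hΓ.clm_apply (hasFDerivAt_const W.1 z)).clm_apply
    (hasFDerivAt_const w z)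
  have d2 : ∀ w : B, _ := fun w => (hγ.clm_apply hQ.fst).clm_apply (hasFDerivAt_const w z)
  have d3 : ∀ w : B, _ := fun w => (hγ.clm_apply hQ.snd).clm_apply (hasFDerivAt_const w z)
  have e2 := ((d1 ζ.1).prodMk (d1 ζ.2)).add
    (((d2 ζ.1).sub (d3 ζ.2)).prodMk ((d2 ζ.2).add (d3 ζ.1)))
  have e3 := e1.unique (e2.congr_of_eventuallyEq (f₁ := fun z => connForm g Γ z W ζ)
    (Filter.Eventually.of_forall fun z => connForm_apply g Γ z W ζ))
  have e4 := congrArg (fun L => L (0, U)) e3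
  have e5 : baseProj A B ((0 : A), U) = (0, U.1) := rfl
  simp only [add_apply, sub_apply, ContinuousLinearMap.comp_apply, ContinuousLinearMap.prod_apply,
    ContinuousLinearMap.flip_apply, zero_apply, map_zero, zero_add, e5,
    ContinuousLinearMap.coe_fst', ContinuousLinearMap.coe_snd'] at e4
  rw [e4]
  ext <;> simp only [complexDifference, Prod.fst_add, Prod.snd_add] <;> abel

omit h hz in
theorem splitMap_totalChristoffel (U W : B × B) :
    splitMap Γ z (totalChristoffel g Γ z U W) =
      fderiv ℝ (splitMap Γ) z (0, U) W + connForm g Γ z U (splitMap Γ z W) := by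
  rw [totalChristoffel, splitMap_unsplitMap]

/-- The horizontal component uses only the symmetry of `Γ` and `γ`. In the vertical component the
derivative of `splitMap` brings in `∂_U Γ(W) dy + Γ_U Γ_W dy`, whose symmetry is the flatness of
`D`. -/
theorem totalChristoffel_symm (U W : B × B) :
    totalChristoffel g Γ z U W = totalChristoffel g Γ z W U := by
  unfold totalChristoffel
  congr 1
  have e5 : ∀ U, baseProj A B ((0 : A), U) = (0, U.1) := fun _ => rfl
  have k1 := h.conn_symm _ hz
  have k2 := h.differenceTensor_symm hz
  have k3 := h.flat _ hz U.1 W.1 z.2.2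
  rw [h.fderiv_splitMap hz, h.fderiv_splitMap hz, connForm_apply, connForm_apply]
  ext
  · simp only [complexDifference, e5, Prod.fst_add, splitMap_apply]
    rw [k1 U.1 W.1, k2 U.1 W.1, k2 (U.2 + _)]
  · simp only [complexDifference, e5, Prod.snd_add, splitMap_apply]
    rw [k2 U.1 (W.2 + _), k2 (U.2 + _) W.1, map_add, map_add (Γ _ W.1), k1 U.1 W.2, k1 W.1 U.2]
    rw [← sub_eq_zero] at k3 ⊢
    rw [← k3]
    abel

theorem fderiv_totalMetric (X : A × (B × B)) (U W : B × B) :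
    fderiv ℝ (fun z => totalMetric g Γ z U W) z X =
      fderiv ℝ g (baseProj A B z) (baseProj A B X) (splitMap Γ z U).1 (splitMap Γ z W).1 +
      fderiv ℝ g (baseProj A B z) (baseProj A B X) (splitMap Γ z U).2 (splitMap Γ z W).2 +
      (g (baseProj A B z) (fderiv ℝ (splitMap Γ) z X U).1 (splitMap Γ z W).1 +
      g (baseProj A B z) (fderiv ℝ (splitMap Γ) z X U).2 (splitMap Γ z W).2) +
      (g (baseProj A B z) (splitMap Γ z U).1 (fderiv ℝ (splitMap Γ) z X W).1 +
      g (baseProj A B z) (splitMap Γ z U).2 (fderiv ℝ (splitMap Γ) z X W).2) := by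
  have hg := hasFDerivAt_comp_baseProj h.isOpen h.metric_smooth hz
  have hQ : ∀ U : B × B, _ := fun U =>
    (h.hasFDerivAt_splitMap hz).clm_apply (hasFDerivAt_const U z)
  have e1 := ((hg.clm_apply (hQ U).fst).clm_apply (hQ W).fst).add
    ((hg.clm_apply (hQ U).snd).clm_apply (hQ W).snd)
  have e2 : HasFDerivAt (fun z => totalMetric g Γ z U W) _ z := e1
  rw [e2.fderiv]
  simp only [add_apply, ContinuousLinearMap.comp_apply,
    ContinuousLinearMap.flip_apply, zero_apply, map_zero, zero_add,
    ContinuousLinearMap.coe_fst', ContinuousLinearMap.coe_snd']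
  ring

/-- `totalChristoffel` is symmetric and metric, so it is the Levi-Civita connection by
`localChristoffel_eq`. -/
theorem localChristoffel_totalMetric (U W : B × B) :
    localChristoffel (totalMetric g Γ) z U W = totalChristoffel g Γ z U W := by
  refine localChristoffel_eq ?_ ?_ ?_ (h.totalChristoffel_symm hz) ?_ U W
  · intro u v t
    simp only [totalMetric, map_sub, Prod.fst_sub, Prod.snd_sub, sub_apply]
    ring
  · intro u v
    simp only [totalMetric]
    rw [h.metric_symm _ hz, h.metric_symm _ hz (splitMap Γ z u).2]
  · intro u hu
    have hu' : splitMap Γ z u ≠ 0 := fun h0 => hu <| by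
      rw [← unsplitMap_splitMap Γ z u, h0, map_zero]
    have nn : ∀ v, 0 ≤ g (baseProj A B z) v v := fun v => by
      by_cases hv : v = 0
      · simp [hv]
      · exact (h.metric_pos _ hz v hv).le
    unfold totalMetric
    by_cases h1 : (splitMap Γ z u).1 = 0
    · have h2 : (splitMap Γ z u).2 ≠ 0 := fun h2 => hu' (Prod.ext h1 h2)
      have := h.metric_pos _ hz _ h2
      have := nn (splitMap Γ z u).1
      linarith
    · have := h.metric_pos _ hz _ h1
      have := nn (splitMap Γ z u).2
      linarith
  -- In a horizontal direction, `Γ + γ` preserves `g` on each of the two factors. In a vertical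
  -- direction the metric does not vary, and the connection form is `γ` composed with the rotation,
  -- which is skew because `γ` is self-adjoint.
  · intro t u w
    have e5 : ∀ U, baseProj A B ((0 : A), U) = (0, U.1) := fun _ => rfl
    have k := h.metric_differenceTensor_comm hz
    rw [h.fderiv_totalMetric hz, e5, h.fderiv_metric hz, h.fderiv_metric hz]
    unfold totalMetric
    rw [splitMap_totalChristoffel, splitMap_totalChristoffel, connForm_apply,
      connForm_apply]
    simp only [complexDifference, Prod.fst_add, Prod.snd_add, map_add, map_sub, add_apply,
      sub_apply, k]
    rw [show (splitMap Γ z t).1 = t.1 from rfl]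
    ring

/-- The product rule for `splitMap ∘ totalComplex = complexRotation ∘ splitMap`, whose right-hand
rotation is constant. -/
theorem fderiv_totalComplex (X : A × (B × B)) (U : B × B) :
    splitMap Γ z (fderiv ℝ (fun z => totalComplex Γ z U) z X) =
      complexRotation B (fderiv ℝ (splitMap Γ) z X U) -
        fderiv ℝ (splitMap Γ) z X (totalComplex Γ z U) := by
  have hQ := h.hasFDerivAt_splitMap hz
  have hP := (((unsplitMap_smooth h.conn_smooth).contDiffAt
    (h.isOpen_total.mem_nhds hz)).differentiableAt (by simp)).hasFDerivAt
  have d1 := (complexRotation B).hasFDerivAt.comp z (hQ.clm_apply (hasFDerivAt_const U z))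
  have d2 := hP.clm_apply d1
  have d3 : DifferentiableAt ℝ (fun z => totalComplex Γ z U) z := d2.differentiableAt
  have d4 := hQ.clm_apply d3.hasFDerivAt
  have d5 := d4.unique (d1.congr_of_eventuallyEq
    (f₁ := fun z => splitMap Γ z (totalComplex Γ z U))
    (Filter.Eventually.of_forall fun z => splitMap_unsplitMap Γ z _))
  have d6 := congrArg (fun L => L X) d5
  simp only [add_apply, ContinuousLinearMap.comp_apply,
    ContinuousLinearMap.flip_apply, zero_apply, map_zero, zero_add] at d6
  rw [eq_sub_iff_add_eq, d6]

omit [FiniteDimensional ℝ B] h hz in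
theorem _root_.splitMap_injective {Γ : A × B → B →L[ℝ] B →L[ℝ] B} {z : A × (B × B)} :
    Function.Injective (splitMap Γ z) :=
  Function.LeftInverse.injective (unsplitMap_splitMap Γ z)

theorem fderiv_totalComplex_leaf (a : A) (U : B × B) :
    fderiv ℝ (fun z => totalComplex Γ z U) z (a, 0) = 0 := by
  apply splitMap_injective (Γ := Γ) (z := z)
  rw [h.fderiv_totalComplex hz, h.fderiv_splitMap_leaf hz, h.fderiv_splitMap_leaf hz]
  simp

/-- In the frame given by `splitMap` the complex structure is a constant rotation, and `connForm`
commutes with it, being complex linear in its last argument. -/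
theorem totalComplex_parallel (U W : B × B) :
    fderiv ℝ (fun z => totalComplex Γ z W) z (0, U) +
      totalChristoffel g Γ z U (totalComplex Γ z W) -
      totalComplex Γ z (totalChristoffel g Γ z U W) = 0 := by
  apply splitMap_injective (Γ := Γ) (z := z)
  have e : ∀ V, splitMap Γ z (totalComplex Γ z V) = complexRotation B (splitMap Γ z V) :=
    fun V => splitMap_unsplitMap Γ z _
  rw [map_sub, map_add, h.fderiv_totalComplex hz, e, splitMap_totalChristoffel,
    splitMap_totalChristoffel, e, connForm_apply, connForm_apply, map_zero]
  ext
  · simp only [complexRotation_apply, complexDifference, Prod.fst_add, Prod.snd_add, Prod.fst_sub,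
      map_neg, Prod.fst_zero]
    abel
  · simp only [complexRotation_apply, complexDifference, Prod.fst_add, Prod.snd_add, Prod.snd_sub,
      map_neg, Prod.snd_zero]
    abel

theorem fderiv_totalMetric_leaf (a : A) (U W : B × B) :
    fderiv ℝ (fun z => totalMetric g Γ z U W) z (a, 0) = 0 := by
  have : baseProj A B (a, (0 : B × B)) = (a, 0) := rfl
  rw [h.fderiv_totalMetric hz, h.fderiv_splitMap_leaf hz, h.fderiv_splitMap_leaf hz, this,
    h.metric_leaf _ hz]
  simp

end

theorem totalMetric_smooth (h : IsHessianChart T g Γ) (U W : B × B) :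
    ContDiffOn ℝ ∞ (fun z => totalMetric g Γ z U W) (baseProj A B ⁻¹' T) := by
  have h1 : ContDiffOn ℝ ∞ (fun z => g (baseProj A B z)) (baseProj A B ⁻¹' T) :=
    h.metric_smooth.comp (baseProj A B).contDiff.contDiffOn fun z hz => hz
  have h2 : ∀ U : B × B, ContDiffOn ℝ ∞ (fun z => splitMap Γ z U) (baseProj A B ⁻¹' T) :=
    fun U => (splitMap_smooth h.conn_smooth).clm_apply contDiffOn_const
  exact ((h1.clm_apply (h2 U).fst).clm_apply (h2 W).fst).add
    ((h1.clm_apply (h2 U).snd).clm_apply (h2 W).snd)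

theorem totalComplex_smooth (h : IsHessianChart T g Γ) (U : B × B) :
    ContDiffOn ℝ ∞ (fun z => totalComplex Γ z U) (baseProj A B ⁻¹' T) :=
  (unsplitMap_smooth h.conn_smooth).clm_apply ((complexRotation B).contDiff.comp_contDiffOn
    ((splitMap_smooth h.conn_smooth).clm_apply contDiffOn_const))

theorem totalChristoffel_smooth (h : IsHessianChart T g Γ) (U W : B × B) :
    ContDiffOn ℝ ∞ (fun z => totalChristoffel g Γ z U W) (baseProj A B ⁻¹' T) := by
  have h1 := splitMap_smooth h.conn_smooth
  exact (unsplitMap_smooth h.conn_smooth).clm_apply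
    ((((h1.fderiv_of_isOpen h.isOpen_total (by simp)).clm_apply
      contDiffOn_const).clm_apply contDiffOn_const).add
    ((h.connForm_smooth.clm_apply contDiffOn_const).clm_apply (h1.clm_apply contDiffOn_const)))

/-! ### Curvature and Ricci tensor of the induced metric -/

/-- The endomorphism `U ↦ R(U, W) ζ` in the frame of horizontal and vertical vectors, for `U` in
the coordinate frame. -/
def frameCurvature (g : A × B → B →L[ℝ] B →L[ℝ] ℝ) (Γ : A × B → B →L[ℝ] B →L[ℝ] B)
    (z : A × (B × B)) (W ζ : B × B) : (B × B) →L[ℝ] (B × B) :=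
  (((fderiv ℝ (connForm g Γ) z).comp (ContinuousLinearMap.inr ℝ A (B × B))).flip W).flip ζ -
    (fderiv ℝ (connForm g Γ) z (0, W)).flip ζ +
    (connForm g Γ z).flip (connForm g Γ z W ζ) -
    (connForm g Γ z W).comp ((connForm g Γ z).flip ζ)

theorem frameCurvature_apply (g : A × B → B →L[ℝ] B →L[ℝ] ℝ) (Γ : A × B → B →L[ℝ] B →L[ℝ] B)
    (z : A × (B × B)) (W ζ U : B × B) : frameCurvature g Γ z W ζ U =
      fderiv ℝ (connForm g Γ) z (0, U) W ζ - fderiv ℝ (connForm g Γ) z (0, W) U ζ +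
        connForm g Γ z U (connForm g Γ z W ζ) - connForm g Γ z W (connForm g Γ z U ζ) := rfl

/-- `gauge_curvature` for the frame `splitMap`: the Christoffel symbols are the gauge transform of
`connForm`, which is much simpler to differentiate. -/
theorem localCurvature_total (h : IsHessianChart T g Γ) {z : A × (B × B)}
    (hz : baseProj A B z ∈ T) (U W ζ : B × B) :
    localCurvature (localChristoffel (totalMetric g Γ)) z U W ζ =
      unsplitMap Γ z (frameCurvature g Γ z W (splitMap Γ z ζ) U) := by
  have hn := h.isOpen_total.mem_nhds hz
  have h1 : localCurvature (localChristoffel (totalMetric g Γ)) z U W ζ =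
      localCurvature (totalChristoffel g Γ) z U W ζ := by
    have h2 : ∀ u w, (fun z => localChristoffel (totalMetric g Γ) z u w) =ᶠ[𝓝 z]
        fun z => totalChristoffel g Γ z u w := fun u w => by
      filter_upwards [hn] with z hz using h.localChristoffel_totalMetric hz u w
    simp only [localCurvature, (h2 _ _).fderiv_eq, h.localChristoffel_totalMetric hz]
  have h3 := gauge_curvature ((splitMap_smooth h.conn_smooth).contDiffAt hn)
    ((h.connForm_smooth.contDiffAt hn).differentiableAt (by simp))
    (fun w t => ((h.totalChristoffel_smooth w t).contDiffAt hn).differentiableAt (by simp))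
    (Filter.Eventually.of_forall fun z U W => splitMap_totalChristoffel U W) U W ζ
  rw [h1, frameCurvature_apply, ← h3, unsplitMap_splitMap]

/-- The two terms are the diagonal blocks of the curvature endomorphism, on horizontal and on
vertical vectors. Write `w₁`, `w₂` for the parts of `W`, with `Γ` absorbed into `D`. The horizontal
block contributes `(D_a γ)(w₁, ζ₁) - (D_a γ)(w₂, ζ₂) - (D_{w₁} γ)(a, ζ₁)` and the vertical block
`-(D_{w₁} γ)(a, ζ₁)`. Each of them also contributes the real part of the commutator of `γ_a` with
the complex `γ_W`, applied to `ζ`. This real part therefore occurs twice, which is exactly what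
`differenceDeriv_comm` at `(w₁, a)` and at `(w₂, a)` absorbs. -/
theorem frameCurvature_trace_part (h : IsHessianChart T g Γ) {z : A × (B × B)}
    (hz : baseProj A B z ∈ T) (W ζ : B × B) (a : B) :
    (frameCurvature g Γ z W ζ (unsplitMap Γ z (a, 0))).1 +
      (frameCurvature g Γ z W ζ (unsplitMap Γ z (0, a))).2 =
    -differenceDeriv g Γ (baseProj A B z) W.1 a ζ.1 -
      differenceDeriv g Γ (baseProj A B z) (splitMap Γ z W).2 a ζ.2 := by
  have e5 : ∀ U, baseProj A B ((0 : A), U) = (0, U.1) := fun _ => rfl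
  have k1 := h.differenceDeriv_comm hz W.1 a ζ.1
  have k2 := h.differenceDeriv_comm hz (splitMap Γ z W).2 a ζ.2
  have f1 := h.flat _ hz a W.1 ζ.1
  have f2 := eq_sub_of_add_eq (h.flat _ hz a W.1 z.2.2)
  have cs := h.conn_symm _ hz
  have s1 : (splitMap Γ z W).1 = W.1 := rfl
  have s2 : W.2 = (splitMap Γ z W).2 - Γ (baseProj A B z) W.1 z.2.2 := by simp [splitMap_apply]
  have u1 : ∀ U, (unsplitMap Γ z U).1 = U.1 := fun _ => rfl
  have u2 : ∀ U, (unsplitMap Γ z U).2 = U.2 - Γ (baseProj A B z) U.1 z.2.2 := fun _ => rfl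
  simp only [frameCurvature_apply, connForm_apply, h.fderiv_connForm hz, h.fderiv_splitMap hz,
    splitMap_unsplitMap, complexDifference, e5, s1, u1, u2, s2]
  generalize (splitMap Γ z W).2 = b at *
  have z0 : ((0 : A), (0 : B)) = 0 := rfl
  simp only [differenceDeriv, map_zero, zero_apply, Prod.fst_add, Prod.snd_add, z0,
    Prod.fst_sub, Prod.snd_sub, map_add, map_sub, add_apply, sub_apply, f2] at k1 k2 f1 ⊢
  rw [cs a W.1] at k1
  rw [cs a b] at k2 ⊢
  linear_combination (norm := module) f1 - k1 + k2

/-- Cyclicity of the trace moves `unsplitMap` to the argument of the curvature, so that the trace is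
taken over horizontal and vertical vectors. Its blocks add up to the endomorphisms with traces
`-koszulTwo`. -/
theorem ricci_total (h : IsHessianChart T g Γ) {z : A × (B × B)} (hz : baseProj A B z ∈ T)
    (W ζ : B × B) {ι : Type*} [Fintype ι] (b : Module.Basis ι ℝ (B × B)) :
    ∑ i, b.coord i (localCurvature (localChristoffel (totalMetric g Γ)) z (b i) W ζ) =
      -koszulTwo g Γ (baseProj A B z) (splitMap Γ z W).1 (splitMap Γ z ζ).1 -
        koszulTwo g Γ (baseProj A B z) (splitMap Γ z W).2 (splitMap Γ z ζ).2 := by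
  classical
  simp only [h.localCurvature_total hz]
  set R : (B × B) →ₗ[ℝ] (B × B) := (frameCurvature g Γ z W (splitMap Γ z ζ)).toLinearMap with hR
  have h1 : ∑ i, b.coord i (unsplitMap Γ z (frameCurvature g Γ z W (splitMap Γ z ζ) (b i))) =
      LinearMap.trace ℝ (B × B) ((unsplitMap Γ z).toLinearMap ∘ₗ R) := by
    rw [LinearMap.trace_eq_matrix_trace ℝ b]
    simp [Matrix.trace, LinearMap.toMatrix_apply, hR]
  have h2 : ∀ a : B × B, (R ∘ₗ (unsplitMap Γ z).toLinearMap) a =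
    frameCurvature g Γ z W (splitMap Γ z ζ) (unsplitMap Γ z a) := fun _ => rfl
  -- `differenceDeriv` is a plain function of three vectors; a linear map in the middle one is
  -- needed for the trace.
  obtain ⟨N, hN⟩ : ∃ N : B → B → (B →ₗ[ℝ] B), ∀ a c v, N a c v =
      differenceDeriv g Γ (baseProj A B z) a v c :=
    ⟨fun a c => ((fderiv ℝ (differenceTensor g Γ) (baseProj A B z) (0, a)).flip c +
      (Γ (baseProj A B z) a).comp ((differenceTensor g Γ (baseProj A B z)).flip c) -
      ((differenceTensor g Γ (baseProj A B z)).comp (Γ (baseProj A B z) a)).flip c -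
      (differenceTensor g Γ (baseProj A B z)).flip (Γ (baseProj A B z) a c)).toLinearMap,
      fun _ _ _ => rfl⟩
  rw [h1, LinearMap.trace_comp_comm', trace_prod_eq, ← map_add,
    ← h.traceCLM_differenceDeriv hz _ _ (hN (splitMap Γ z W).1 (splitMap Γ z ζ).1),
    ← h.traceCLM_differenceDeriv hz _ _ (hN (splitMap Γ z W).2 (splitMap Γ z ζ).2),
    ← map_neg, ← map_sub]
  congr 1
  ext a
  simp only [LinearMap.add_apply, LinearMap.sub_apply, LinearMap.neg_apply, hN]
  exact h.frameCurvature_trace_part hz W (splitMap Γ z ζ) a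

end IsHessianChart

end TotalLocal

/-! ## Coordinate sections and coordinate fields -/

section Coordinate

variable {A B : Type*} [NormedAddCommGroup A] [NormedSpace ℝ A]
  [NormedAddCommGroup B] [NormedSpace ℝ B]
  {M : Type*} [TopologicalSpace M] [ChartedSpace (A × B) M] [IsFoliated A B M]

instance IsFoliated.isManifold_one : IsManifold 𝓘(ℝ, A × B) 1 M :=
  IsManifold.of_le (n := ∞) (by exact_mod_cast le_top)

instance IsFoliated.isManifold_two : IsManifold 𝓘(ℝ, A × B) 2 M :=
  IsManifold.of_le (n := ∞) (WithTop.coe_le_coe.2 (le_top : (2 : ℕ∞) ≤ ⊤))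

instance normalBundleCore_isContMDiff :
    (normalBundleCore A B M).IsContMDiff 𝓘(ℝ, A × B) ∞ where
  contMDiffOn_coordChange i j := by
    have : IsManifold 𝓘(ℝ, A × B) (∞ + 1) M := by simpa using IsFoliated.isManifold A B M
    have h := (tangentBundleCore.isContMDiff (I := 𝓘(ℝ, A × B)) (M := M) (n := ∞))
    have h1 := h.contMDiffOn_coordChange i j
    exact contMDiffOn_const.clm_comp (h1.clm_comp contMDiffOn_const)

instance normalBundle_contMDiffVectorBundle :
    ContMDiffVectorBundle ∞ B (NormalFiber A B : M → Type _) 𝓘(ℝ, A × B) :=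
  inferInstanceAs (ContMDiffVectorBundle ∞ B (normalBundleCore A B M).Fiber 𝓘(ℝ, A × B))

instance tangentBundle_contMDiffVectorBundle_of_isFoliated :
    ContMDiffVectorBundle ∞ (A × B) (TangentSpace 𝓘(ℝ, A × B) : M → Type _) 𝓘(ℝ, A × B) := by
  have : IsManifold 𝓘(ℝ, A × B) (∞ + 1) M := by simpa using IsFoliated.isManifold A B M
  exact TangentBundle.contMDiffVectorBundle

/-- The section of the normal bundle with constant components `u` in the chart at `x₀`. -/
def coordSection (x₀ : M) (u : B) (x : M) : NormalFiber A B x :=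
  (trivializationAt B (NormalFiber A B) x₀).symmₗ ℝ x u

/-- The vector field with constant components `X` in the chart at `x₀`. -/
def coordField (x₀ : M) (X : A × B) (x : M) : TangentSpace 𝓘(ℝ, A × B) x :=
  (trivializationAt (A × B) (TangentSpace 𝓘(ℝ, A × B)) x₀).symmₗ ℝ x X

/-- The components of a normal vector at `x` in the chart at `x₀`. -/
def normalComp (x₀ : M) (x : M) (u : NormalFiber A B x) : B :=
  (trivializationAt B (NormalFiber A B) x₀ ⟨x, u⟩).2

theorem coordSection_symm {x₀ x : M} (hx : x ∈ (chartAt (A × B) x₀).source) (u : B) :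
    coordSection (A := A) x₀ u x = (trivializationAt B (NormalFiber A B) x₀).symm x u :=
  Trivialization.symmₗ_apply _ hx u

theorem coordField_symm {x₀ x : M} (hx : x ∈ (chartAt (A × B) x₀).source) (X : A × B) :
    coordField x₀ X x =
      (trivializationAt (A × B) (TangentSpace 𝓘(ℝ, A × B)) x₀).symm x X :=
  Trivialization.symmₗ_apply _ hx X

theorem coordSection_eq {x₀ x : M} (hx : x ∈ (chartAt (A × B) x₀).source) (u : B) :
    coordSection (A := A) x₀ u x =
      (normalBundleCore A B M).coordChange (achart (A × B) x₀) (achart (A × B) x) x u := by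
  have : x ∈ (trivializationAt B (NormalFiber A B) x₀).baseSet := hx
  unfold coordSection
  rw [Trivialization.symmₗ_apply _ this, Trivialization.symm_apply _ this]
  rfl

theorem coordField_eq {x₀ x : M} (hx : x ∈ (chartAt (A × B) x₀).source) (X : A × B) :
    coordField x₀ X x =
      (tangentBundleCore 𝓘(ℝ, A × B) M).coordChange (achart (A × B) x₀) (achart (A × B) x) x X := by
  have : x ∈ (trivializationAt (A × B) (TangentSpace 𝓘(ℝ, A × B)) x₀).baseSet := hx
  unfold coordField
  rw [Trivialization.symmₗ_apply _ this, Trivialization.symm_apply _ this]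
  rfl

theorem normalComp_coordSection {x₀ x : M} (hx : x ∈ (chartAt (A × B) x₀).source) (u : B) :
    normalComp x₀ x (coordSection (A := A) x₀ u x) = u := by
  rw [coordSection_symm hx]
  exact congrArg Prod.snd ((trivializationAt B (NormalFiber A B) x₀).apply_mk_symm hx u)

theorem coordSection_normalComp {x₀ x : M} (hx : x ∈ (chartAt (A × B) x₀).source)
    (u : NormalFiber A B x) : coordSection (A := A) x₀ (normalComp x₀ x u) x = u := by
  rw [coordSection_symm hx]
  exact (trivializationAt B (NormalFiber A B) x₀).symm_apply_apply_mk hx u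

theorem normalComp_add {x₀ x : M} (u w : NormalFiber A B x) :
    normalComp x₀ x (u + w) = normalComp x₀ x u + normalComp x₀ x w :=
  map_add ((normalBundleCore A B M).coordChange (achart (A × B) x) (achart (A × B) x₀) x) u w

theorem normalComp_smul {x₀ x : M}
    (c : ℝ) (w : NormalFiber A B x) : normalComp x₀ x (c • w) = c • normalComp x₀ x w :=
  map_smul ((normalBundleCore A B M).coordChange (achart (A × B) x) (achart (A × B) x₀) x) c w

theorem coordSection_add (x₀ x : M) (u w : B) :
    coordSection (A := A) x₀ (u + w) x = coordSection x₀ u x + coordSection x₀ w x :=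
  map_add ((trivializationAt B (NormalFiber A B) x₀).symmₗ ℝ x) u w

theorem coordSection_smul (x₀ x : M) (c : ℝ) (w : B) :
    coordSection (A := A) x₀ (c • w) x = c • coordSection x₀ w x :=
  map_smul ((trivializationAt B (NormalFiber A B) x₀).symmₗ ℝ x) c w

theorem coordField_add (x₀ x : M) (u w : A × B) :
    coordField x₀ (u + w) x = coordField x₀ u x + coordField x₀ w x :=
  map_add ((trivializationAt (A × B) (TangentSpace 𝓘(ℝ, A × B)) x₀).symmₗ ℝ x) u w

theorem coordField_smul (x₀ x : M) (c : ℝ) (w : A × B) :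
    coordField x₀ (c • w) x = c • coordField x₀ w x :=
  map_smul ((trivializationAt (A × B) (TangentSpace 𝓘(ℝ, A × B)) x₀).symmₗ ℝ x) c w

theorem coordField_self (x : M) (X : A × B) : coordField x X x = X := by
  rw [coordField_eq (mem_chart_source _ x)]
  exact (tangentBundleCore 𝓘(ℝ, A × B) M).coordChange_self _ _ (mem_chart_source _ x) X

theorem normalComp_self (x : M) (u : NormalFiber A B x) : normalComp x x u = u :=
  (normalBundleCore A B M).coordChange_self _ _ (mem_chart_source _ x) u

/-- Changes of adapted charts do not let leaf components enter the transverse ones. Outside the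
chart both sides take the default value zero, so that the identity can be rewritten inside sections
without a membership condition. -/
theorem normalProj_coordField (x₀ x : M) (X : A × B) :
    normalProj A B x (coordField x₀ X x) = coordSection x₀ X.2 x := by
  by_cases hx : x ∈ (chartAt (A × B) x₀).source
  · rw [coordField_eq hx, coordSection_eq hx]
    have h := IsFoliated.tangent_coordChange_snd (achart (A × B) x₀) (achart (A × B) x) hx
      (mem_chart_source _ x) X.1
    have h2 : X = (X.1, 0) + (0, X.2) := by simp
    conv_lhs => rw [h2, map_add]
    change (_ + _ : A × B).2 = _
    rw [Prod.snd_add, h, zero_add]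
    rfl
  · have h1 : coordField x₀ X x = 0 := by
      exact Trivialization.symmₗ_apply_of_notMem _ hx _
    have h2 : coordSection (A := A) x₀ X.2 x = 0 := by
      exact Trivialization.symmₗ_apply_of_notMem _ hx _
    rw [h1, h2, map_zero]

theorem coordField_leaf (x₀ x : M) (a : A) :
    coordField x₀ (a, (0 : B)) x ∈ leafSpace A B x := by
  have h := normalProj_coordField (A := A) (B := B) x₀ x (a, 0)
  have h2 : coordSection (A := A) x₀ (0 : B) x = 0 :=
    map_zero ((trivializationAt B (NormalFiber A B) x₀).symmₗ ℝ x)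
  exact h.trans h2

theorem isSmoothSectionOn_iff {x₀ : M} {U : Set M} (hU : U ⊆ (chartAt (A × B) x₀).source)
    (hUo : IsOpen U)
    (Z : ∀ x : M, NormalFiber A B x) :
    IsSmoothSectionOn U Z ↔
      ContMDiffOn 𝓘(ℝ, A × B) 𝓘(ℝ, B) ∞ (fun x => normalComp x₀ x (Z x)) U :=
  Trivialization.contMDiffOn_section_iff (trivializationAt B (NormalFiber A B) x₀) hUo hU

theorem coordSection_smooth (x₀ : M) (u : B) :
    IsSmoothSectionOn (chartAt (A × B) x₀).source (coordSection (A := A) x₀ u) := by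
  rw [isSmoothSectionOn_iff (x₀ := x₀) subset_rfl (chartAt (A × B) x₀).open_source]
  exact contMDiffOn_const.congr fun x hx => normalComp_coordSection hx u

theorem coordField_smooth (x₀ : M) (X : A × B) :
    IsSmoothFieldOn (chartAt (A × B) x₀).source (coordField x₀ X) := by
  unfold IsSmoothFieldOn
  have := (Trivialization.contMDiffOn_section_iff (n := ∞) (IB := 𝓘(ℝ, A × B))
    (trivializationAt (A × B) (TangentSpace 𝓘(ℝ, A × B)) x₀)
    (s := coordField x₀ X) (chartAt (A × B) x₀).open_source subset_rfl)
  refine this.2 (contMDiffOn_const (c := X) |>.congr fun x hx => ?_)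
  simp only [coordField_symm hx]
  exact congrArg Prod.snd
    ((trivializationAt (A × B) (TangentSpace 𝓘(ℝ, A × B)) x₀).apply_mk_symm hx X)

/-- The derivative at `x` of a function read in the chart at `x₀`. -/
theorem hasMFDerivAt_comp_chart {G : Type*} [NormedAddCommGroup G] [NormedSpace ℝ G] {x₀ x : M}
    (hx : x ∈ (chartAt (A × B) x₀).source) {f : M → G} {F : A × B → G} {F' : A × B →L[ℝ] G}
    (hF : HasFDerivAt F F' (chartAt (A × B) x₀ x))
    (hf : f =ᶠ[𝓝 x] fun y => F (chartAt (A × B) x₀ y)) :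
    HasMFDerivAt 𝓘(ℝ, A × B) 𝓘(ℝ, G) f x
      (F'.comp ((tangentBundleCore 𝓘(ℝ, A × B) M).coordChange (achart (A × B) x)
        (achart (A × B) x₀) x)) := by
  have h1 : MDifferentiableAt 𝓘(ℝ, A × B) 𝓘(ℝ, A × B) (chartAt (A × B) x₀) x :=
    mdifferentiableAt_atlas (chart_mem_atlas _ x₀) hx
  have h2 := h1.hasMFDerivAt
  rw [mfderiv_chartAt_eq_tangentCoordChange hx] at h2
  exact (hF.hasMFDerivAt.comp x h2).congr_of_eventuallyEq hf

theorem mfderiv_coordField {G : Type*} [NormedAddCommGroup G] [NormedSpace ℝ G] {x₀ x : M}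
    (hx : x ∈ (chartAt (A × B) x₀).source) {f : M → G} {F : A × B → G}
    (hF : DifferentiableAt ℝ F (chartAt (A × B) x₀ x))
    (hf : f =ᶠ[𝓝 x] fun y => F (chartAt (A × B) x₀ y)) (X : A × B) :
    mfderiv 𝓘(ℝ, A × B) 𝓘(ℝ, G) f x (coordField x₀ X x) =
      fderiv ℝ F (chartAt (A × B) x₀ x) X := by
  rw [(hasMFDerivAt_comp_chart hx hF.hasFDerivAt hf).mfderiv, coordField_eq hx]
  have := (tangentBundleCore 𝓘(ℝ, A × B) M).coordChange_comp (achart (A × B) x₀)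
    (achart (A × B) x) (achart (A × B) x₀) x ⟨⟨hx, mem_chart_source _ x⟩, hx⟩ X
  rw [(tangentBundleCore 𝓘(ℝ, A × B) M).coordChange_self _ _ hx] at this
  exact congrArg (fderiv ℝ F (chartAt (A × B) x₀ x)) this

theorem exists_coordField {x₀ x : M} (hx : x ∈ (chartAt (A × B) x₀).source)
    (v : TangentSpace 𝓘(ℝ, A × B) x) : ∃ X, coordField x₀ X x = v :=
  ⟨_, (coordField_symm hx _).trans
    ((trivializationAt (A × B) (TangentSpace 𝓘(ℝ, A × B)) x₀).symm_apply_apply_mk hx v)⟩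

variable (A B) in
/-- The constant vector field of the model space. -/
def constField (X : A × B) (z : A × B) : TangentSpace 𝓘(ℝ, A × B) z := X

theorem constField_mdifferentiableAt (X z : A × B) :
    MDifferentiableAt 𝓘(ℝ, A × B) (𝓘(ℝ, A × B).prod 𝓘(ℝ, A × B))
      (fun z => (⟨z, constField A B X z⟩ : TangentBundle 𝓘(ℝ, A × B) (A × B))) z := by
  have h : ContDiffAt ℝ ∞ (fun _ : A × B => X) z := contDiffAt_const
  exact ((contMDiffAt_vectorSpace_iff_contDiffAt (V := constField A B X)).2 h).mdifferentiableAt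
    (by simp)

/-- Coordinate fields are the pullbacks of constant fields under the chart, and the Lie bracket is
natural under pullback. -/
theorem mlieBracket_coordField [CompleteSpace A] [CompleteSpace B] {x₀ x : M}
    (hx : x ∈ (chartAt (A × B) x₀).source) (X Y : A × B) :
    VectorField.mlieBracket 𝓘(ℝ, A × B) (coordField x₀ X) (coordField x₀ Y) x = 0 := by
  have hpb : ∀ Z : A × B, coordField x₀ Z =ᶠ[𝓝 x]
      VectorField.mpullback 𝓘(ℝ, A × B) 𝓘(ℝ, A × B) (chartAt (A × B) x₀) (constField A B Z) := by
    intro Z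
    filter_upwards [(chartAt (A × B) x₀).open_source.mem_nhds hx] with y hy
    have h1 := mfderiv_coordField hy (f := chartAt (A × B) x₀) (F := id)
      differentiableAt_id Filter.EventuallyEq.rfl Z
    have h2 : (mfderiv 𝓘(ℝ, A × B) 𝓘(ℝ, A × B) (chartAt (A × B) x₀) y).IsInvertible := by
      have := isInvertible_mfderiv_extChartAt (I := 𝓘(ℝ, A × B)) (x := x₀) (y := y)
        (by simpa using hy)
      simpa [mfld_simps] using! this
    rw [fderiv_id] at h1
    have h3 := h2.inverse_apply_eq (y := constField A B Z (chartAt (A × B) x₀ y))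
      (x := coordField x₀ Z y)
    exact (h3.2 h1.symm).symm
  rw [(hpb X).mlieBracket_vectorField_eq (hpb Y)]
  have : IsManifold 𝓘(ℝ, A × B) (minSmoothness ℝ 2) M := by
    rw [minSmoothness_of_isRCLikeNormedField]
    infer_instance
  have : IsManifold 𝓘(ℝ, A × B) (minSmoothness ℝ 2) (A × B) := by
    rw [minSmoothness_of_isRCLikeNormedField]
    infer_instance
  have h4 := VectorField.mpullback_mlieBracket (n := ∞) (I := 𝓘(ℝ, A × B)) (I' := 𝓘(ℝ, A × B))
    (f := chartAt (A × B) x₀) (x₀ := x)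
    (constField_mdifferentiableAt X _) (constField_mdifferentiableAt Y _)
    (contMDiffAt_of_mem_maximalAtlas
      (IsManifold.subset_maximalAtlas (chart_mem_atlas (A × B) x₀)) hx)
    (by simpa [minSmoothness_of_isRCLikeNormedField] using
      (WithTop.coe_le_coe.2 (le_top : (2 : ℕ∞) ≤ ⊤)))
  rw [← h4]
  have h5 : VectorField.mlieBracket 𝓘(ℝ, A × B) (constField A B X) (constField A B Y) = 0 := by
    ext1 z
    rw [← VectorField.mlieBracketWithin_univ, VectorField.mlieBracketWithin_eq_lieBracketWithin]
    have : fderivWithin ℝ (fun _ : A × B => X) univ z = 0 := by simp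
    have : fderivWithin ℝ (fun _ : A × B => Y) univ z = 0 := by simp
    unfold VectorField.lieBracketWithin constField
    simp
    rfl
  rw [h5, VectorField.mpullback_zero]
  rfl

end Coordinate

/-! ### Changes of adapted charts and the coefficients of a normal connection -/

section Connection

variable {A B : Type*} [NormedAddCommGroup A] [NormedSpace ℝ A]
  [NormedAddCommGroup B] [NormedSpace ℝ B]
  {M : Type*} [TopologicalSpace M] [ChartedSpace (A × B) M] [IsFoliated A B M]

/-! ### Changes of charts -/

/-- The change from the chart at `x₀` to the chart at `x₁`. -/
def chartChange (x₀ x₁ : M) : A × B → A × B := chartAt (A × B) x₁ ∘ (chartAt (A × B) x₀).symm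

theorem chartChange_contDiffAt {x₀ x₁ x : M} (h0 : x ∈ (chartAt (A × B) x₀).source)
    (h1 : x ∈ (chartAt (A × B) x₁).source) :
    ContDiffAt ℝ ∞ (chartChange (A := A) (B := B) x₀ x₁) (chartAt (A × B) x₀ x) :=
  (IsFoliated.transition (chart_mem_atlas _ x₀) (chart_mem_atlas _ x₁)).1.contDiffAt
    (((chartAt (A × B) x₀).symm.trans (chartAt (A × B) x₁)).open_source.mem_nhds
      (by simp [h0, h1]))

/-- The equation `∂y'/∂x = 0` holds on an open set, so it may be differentiated in any direction;
the symmetry of second derivatives exchanges the two slots. -/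
theorem chartChange_second_leaf {x₀ x₁ x : M} (h0 : x ∈ (chartAt (A × B) x₀).source)
    (h1 : x ∈ (chartAt (A × B) x₁).source) (X : A × B) (a : A) :
    (fderiv ℝ (fderiv ℝ (chartChange x₀ x₁)) (chartAt (A × B) x₀ x) (a, 0) X).2 = 0 := by
  have hc := chartChange_contDiffAt h0 h1
  have hsymm : IsSymmSndFDerivAt ℝ (chartChange x₀ x₁) (chartAt (A × B) x₀ x) :=
    hc.isSymmSndFDerivAt <| by
      simpa using WithTop.coe_le_coe.2 (le_top : (2 : ℕ∞) ≤ ⊤)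
  have hd : DifferentiableAt ℝ (fderiv ℝ (chartChange x₀ x₁)) (chartAt (A × B) x₀ x) :=
    (hc.fderiv_right (m := ∞) (by simp)).differentiableAt (by simp)
  rw [hsymm.eq]
  have e1 := (hd.hasFDerivAt.clm_apply (hasFDerivAt_const ((a, 0) : A × B) _)).snd
  have hS := ((chartAt (A × B) x₀).symm.trans (chartAt (A × B) x₁)).open_source.mem_nhds
    (x := chartAt (A × B) x₀ x) (by simp [h0, h1])
  have e2 : (fun z => (fderiv ℝ (chartChange x₀ x₁) z (a, 0)).2)
      =ᶠ[𝓝 (chartAt (A × B) x₀ x)] fun _ => 0 :=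
    Filter.eventually_of_mem hS fun z hz =>
      (IsFoliated.transition (chart_mem_atlas _ x₀) (chart_mem_atlas _ x₁)).2 z hz a
  have e3 := e1.unique ((hasFDerivAt_const (0 : B) _).congr_of_eventuallyEq e2)
  simpa using congrArg (fun L => L X) e3

theorem normalComp_coordSection_change {x₀ x₁ x : M} (h0 : x ∈ (chartAt (A × B) x₀).source)
    (h1 : x ∈ (chartAt (A × B) x₁).source) (u : B) :
    normalComp x₁ x (coordSection (A := A) x₀ u x) =
      (fderiv ℝ (chartChange x₀ x₁) (chartAt (A × B) x₀ x) (0, u)).2 := by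
  refine (congrArg (normalComp x₁ x) (coordSection_eq h0 u)).trans ?_
  have := (normalBundleCore A B M).coordChange_comp (achart (A × B) x₀)
    (achart (A × B) x) (achart (A × B) x₁) x ⟨⟨h0, mem_chart_source _ x⟩, h1⟩ u
  refine Eq.trans this ?_
  change ((tangentBundleCore 𝓘(ℝ, A × B) M).coordChange _ _ x (0, u)).2 = _
  rw [IsFoliated.tangent_coordChange]
  rfl

theorem exists_coordField_leaf {x₀ x : M} (hx : x ∈ (chartAt (A × B) x₀).source)
    {v : TangentSpace 𝓘(ℝ, A × B) x} (hv : v ∈ leafSpace A B x) :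
    ∃ a : A, coordField x₀ (a, (0 : B)) x = v := by
  obtain ⟨X, rfl⟩ := exists_coordField hx v
  refine ⟨X.1, ?_⟩
  have h1 : normalProj A B x (coordField x₀ X x) = 0 := hv
  rw [normalProj_coordField] at h1
  have h2 := normalComp_coordSection (A := A) hx X.2
  rw [h1] at h2
  have h3 : X.2 = 0 := by
    rw [← h2]
    exact map_zero ((normalBundleCore A B M).coordChange (achart (A × B) x) (achart (A × B) x₀) x)
  rw [← h3]

/-- In another adapted chart the components are `(∂y'/∂y) u`, and their leafwise derivative is a
mixed second derivative of `y'`. This is what lets the axioms on foliated sections be tested on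
coordinate sections. -/
theorem coordSection_foliated (x₀ : M) (u : B) :
    IsFoliatedSectionOn (chartAt (A × B) x₀).source (coordSection (A := A) x₀ u) := by
  refine ⟨coordSection_smooth x₀ u, fun x₁ x hx v hv => ?_⟩
  obtain ⟨a, rfl⟩ := exists_coordField_leaf hx.1 hv
  have hd : DifferentiableAt ℝ (fderiv ℝ (chartChange x₀ x₁)) (chartAt (A × B) x₀ x) :=
    ((chartChange_contDiffAt hx.1 hx.2).fderiv_right (m := ∞) (by simp)).differentiableAt
      (by simp)
  have e1 := (hd.hasFDerivAt.clm_apply (hasFDerivAt_const ((0, u) : A × B) _)).snd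
  have h1 := mfderiv_coordField hx.1
    (f := fun y => normalComp x₁ y (coordSection (A := A) x₀ u y)) e1.differentiableAt
    (by
      filter_upwards [(chartAt (A × B) x₀).open_source.mem_nhds hx.1,
        (chartAt (A × B) x₁).open_source.mem_nhds hx.2] with y h0 h1
      exact normalComp_coordSection_change h0 h1 u) (a, 0)
  refine h1.trans ?_
  rw [e1.fderiv]
  change (_ : B) = 0
  simpa using chartChange_second_leaf hx.1 hx.2 (0, u) a

theorem coordField_infAut (x₀ : M) (X : A × B) :
    IsInfAutOn (chartAt (A × B) x₀).source (coordField x₀ X) := by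
  refine ⟨coordField_smooth x₀ X, ?_⟩
  simp only [normalProj_coordField]
  exact coordSection_foliated x₀ X.2

/-! ### The connection in a chart -/

theorem section_mdifferentiableAt {x₀ x : M} (hx : x ∈ (chartAt (A × B) x₀).source)
    {Z : ∀ x : M, NormalFiber A B x} {ζ : A × B → B}
    (hζ : DifferentiableAt ℝ ζ (chartAt (A × B) x₀ x))
    (hZ : ∀ᶠ y in 𝓝 x, normalComp x₀ y (Z y) = ζ (chartAt (A × B) x₀ y)) :
    MDifferentiableAt 𝓘(ℝ, A × B) (𝓘(ℝ, A × B).prod 𝓘(ℝ, B))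
      (fun y => (⟨y, Z y⟩ : NormalBundle A B M)) x := by
  have h := (hasMFDerivAt_comp_chart hx (f := fun y => normalComp x₀ y (Z y)) hζ.hasFDerivAt
    hZ).mdifferentiableAt
  exact (Trivialization.mdifferentiableAt_section_iff 𝓘(ℝ, A × B)
    (trivializationAt B (NormalFiber A B) x₀) Z hx).2 h

theorem coordSection_mdifferentiableAt {x₀ x : M} (hx : x ∈ (chartAt (A × B) x₀).source) (u : B) :
    MDifferentiableAt 𝓘(ℝ, A × B) (𝓘(ℝ, A × B).prod 𝓘(ℝ, B))
      (fun y => (⟨y, coordSection x₀ u y⟩ : NormalBundle A B M)) x :=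
  section_mdifferentiableAt hx (differentiableAt_const u) <| by
    filter_upwards [(chartAt (A × B) x₀).open_source.mem_nhds hx] with y hy
    exact normalComp_coordSection hy u

theorem NormalConnection.congr (D : NormalConnection A B M) {x₀ x : M}
    (hx : x ∈ (chartAt (A × B) x₀).source)
    {Z Z' : ∀ x : M, NormalFiber A B x} {ζ : A × B → B}
    (hζ : DifferentiableAt ℝ ζ (chartAt (A × B) x₀ x))
    (hZ : ∀ᶠ y in 𝓝 x, normalComp x₀ y (Z y) = ζ (chartAt (A × B) x₀ y))
    (hZ' : ∀ᶠ y in 𝓝 x, Z y = Z' y) : D Z x = D Z' x :=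
  D.isCovariantDerivativeOnUniv.congr_of_eventuallyEq (section_mdifferentiableAt hx hζ hZ)
    (section_mdifferentiableAt hx hζ (by filter_upwards [hZ, hZ'] with y h1 h2; rw [← h2, h1]))
    Filter.univ_mem hZ'

theorem NormalConnection.sum (D : NormalConnection A B M) {x : M} {ι : Type*} (s : Finset ι)
    (f : ι → M → ℝ) (σ : ι → ∀ x : M, NormalFiber A B x)
    (hf : ∀ i, MDifferentiableAt 𝓘(ℝ, A × B) 𝓘(ℝ, ℝ) (f i) x)
    (hσ : ∀ i, MDifferentiableAt 𝓘(ℝ, A × B) (𝓘(ℝ, A × B).prod 𝓘(ℝ, B))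
      (fun y => (⟨y, σ i y⟩ : NormalBundle A B M)) x) (v : TangentSpace 𝓘(ℝ, A × B) x) :
    D (∑ i ∈ s, f i • σ i) x v =
      ∑ i ∈ s, (f i x • D (σ i) x v + dirDeriv (A := A) (B := B) (f i) x v • σ i x) := by
  classical
  induction s using Finset.induction_on with
  | empty => simp
  | insert i s hi ih =>
    rw [Finset.sum_insert hi, Finset.sum_insert hi, ← ih]
    have h1 : MDifferentiableAt 𝓘(ℝ, A × B) (𝓘(ℝ, A × B).prod 𝓘(ℝ, B))
        (fun y => (⟨y, (f i • σ i) y⟩ : NormalBundle A B M)) x := (hf i).smul_section (hσ i)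
    have h2 : MDifferentiableAt 𝓘(ℝ, A × B) (𝓘(ℝ, A × B).prod 𝓘(ℝ, B))
        (fun y => (⟨y, (∑ i ∈ s, f i • σ i) y⟩ : NormalBundle A B M)) x := by
      simp only [Finset.sum_apply]
      exact MDifferentiableAt.sum_section fun i _ => (hf i).smul_section (hσ i)
    rw [D.isCovariantDerivativeOnUniv.add h1 h2,
      D.isCovariantDerivativeOnUniv.leibniz (hσ i) (hf i)]
    rfl

/-- The coefficients of the connection in the chart at `x₀`. -/
def connComp (D : NormalConnection A B M) (x₀ : M) (z X : A × B) (u : B) : B :=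
  normalComp x₀ ((chartAt (A × B) x₀).symm z)
    (D (coordSection x₀ u) ((chartAt (A × B) x₀).symm z)
      (coordField x₀ X ((chartAt (A × B) x₀).symm z)))

theorem connComp_apply (D : NormalConnection A B M) {x₀ x : M}
    (hx : x ∈ (chartAt (A × B) x₀).source) (X : A × B) (u : B) :
    connComp D x₀ (chartAt (A × B) x₀ x) X u =
      normalComp x₀ x (D (coordSection x₀ u) x (coordField x₀ X x)) := by
  unfold connComp
  rw [(chartAt (A × B) x₀).left_inv hx]

theorem connComp_add_left (D : NormalConnection A B M) (x₀ : M) (z X Y : A × B) (u : B) :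
    connComp D x₀ z (X + Y) u = connComp D x₀ z X u + connComp D x₀ z Y u := by
  unfold connComp
  rw [coordField_add, map_add, normalComp_add]

theorem connComp_smul_left (D : NormalConnection A B M) (x₀ : M) (z X : A × B) (c : ℝ) (u : B) :
    connComp D x₀ z (c • X) u = c • connComp D x₀ z X u := by
  unfold connComp
  rw [coordField_smul, map_smul, normalComp_smul]

theorem connComp_add_right (D : NormalConnection A B M) {x₀ : M} {z : A × B}
    (hz : z ∈ (chartAt (A × B) x₀).target) (X : A × B) (u w : B) :
    connComp D x₀ z X (u + w) = connComp D x₀ z X u + connComp D x₀ z X w := by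
  have hx := (chartAt (A × B) x₀).map_target hz
  have h1 : coordSection (A := A) x₀ (u + w) = coordSection x₀ u + coordSection x₀ w :=
    funext fun y => coordSection_add x₀ y u w
  unfold connComp
  rw [h1, D.isCovariantDerivativeOnUniv.add (coordSection_mdifferentiableAt hx u)
    (coordSection_mdifferentiableAt hx w), add_apply, normalComp_add]

theorem connComp_smul_right (D : NormalConnection A B M) {x₀ : M} {z : A × B}
    (hz : z ∈ (chartAt (A × B) x₀).target) (X : A × B) (c : ℝ) (u : B) :
    connComp D x₀ z X (c • u) = c • connComp D x₀ z X u := by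
  have hx := (chartAt (A × B) x₀).map_target hz
  have h1 : coordSection (A := A) x₀ (c • u) = c • coordSection x₀ u :=
    funext fun y => coordSection_smul x₀ y c u
  unfold connComp
  rw [h1, D.isCovariantDerivativeOnUniv.smul_const c (coordSection_mdifferentiableAt hx u),
    smul_apply, normalComp_smul]

/-- The covariant derivative of a section with components `ζ`. -/
theorem normalComp_conn [FiniteDimensional ℝ B] (D : NormalConnection A B M) {x₀ x : M}
    (hx : x ∈ (chartAt (A × B) x₀).source)
    {Z : ∀ x : M, NormalFiber A B x} {ζ : A × B → B}
    (hζ : DifferentiableAt ℝ ζ (chartAt (A × B) x₀ x))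
    (hZ : ∀ᶠ y in 𝓝 x, normalComp x₀ y (Z y) = ζ (chartAt (A × B) x₀ y)) (X : A × B) :
    normalComp x₀ x (D Z x (coordField x₀ X x)) =
      fderiv ℝ ζ (chartAt (A × B) x₀ x) X +
        connComp D x₀ (chartAt (A × B) x₀ x) X (ζ (chartAt (A × B) x₀ x)) := by
  set b := Module.finBasis ℝ B
  set z := chartAt (A × B) x₀ x with hz
  have hzt : z ∈ (chartAt (A × B) x₀).target := (chartAt (A × B) x₀).map_source hx
  set f : Fin (Module.finrank ℝ B) → M → ℝ := fun i y =>
    LinearMap.toContinuousLinearMap (b.coord i) (ζ (chartAt (A × B) x₀ y)) with hf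
  have hcoord : ∀ i, HasFDerivAt (fun z => LinearMap.toContinuousLinearMap (b.coord i) (ζ z))
      ((LinearMap.toContinuousLinearMap (b.coord i)).comp (fderiv ℝ ζ z)) z := fun i =>
    (LinearMap.toContinuousLinearMap (b.coord i)).hasFDerivAt.comp z hζ.hasFDerivAt
  have hfd : ∀ i, MDifferentiableAt 𝓘(ℝ, A × B) 𝓘(ℝ, ℝ) (f i) x := fun i =>
    (hasMFDerivAt_comp_chart hx (hcoord i) Filter.EventuallyEq.rfl).mdifferentiableAt
  -- Near `x` the section is a combination of finitely many coordinate sections, and the Leibniz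
  -- rule applies term by term.
  have h1 : ∀ᶠ y in 𝓝 x, Z y = (∑ i, f i • coordSection (A := A) x₀ (b i)) y := by
    filter_upwards [hZ, (chartAt (A × B) x₀).open_source.mem_nhds hx] with y hy hys
    rw [← coordSection_normalComp hys (Z y), hy]
    conv_lhs => rw [← b.sum_repr (ζ (chartAt (A × B) x₀ y))]
    rw [Finset.sum_apply]
    unfold coordSection
    rw [map_sum]
    refine Finset.sum_congr rfl fun i _ => ?_
    rw [map_smul]
    rfl
  have hN : ∀ (v : Fin (Module.finrank ℝ B) → NormalFiber A B x),
      normalComp x₀ x (∑ i, v i) = ∑ i, normalComp x₀ x (v i) := fun v =>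
    map_sum (AddMonoidHom.mk' (normalComp x₀ x) fun u w => normalComp_add u w) v _
  have h2 : ∀ i, dirDeriv (A := A) (B := B) (f i) x (coordField x₀ X x) =
      b.coord i (fderiv ℝ ζ z X) := fun i => by
    unfold dirDeriv
    rw [mfderiv_coordField hx (hcoord i).differentiableAt Filter.EventuallyEq.rfl X,
      (hcoord i).fderiv]
    rfl
  rw [D.congr hx hζ hZ h1, D.sum _ _ _ hfd fun i => coordSection_mdifferentiableAt hx (b i), hN]
  simp only [normalComp_add, normalComp_smul, normalComp_coordSection hx, h2,
    ← connComp_apply D hx]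
  rw [Finset.sum_add_distrib, add_comm]
  congr 1
  · exact b.sum_repr _
  · let L : B →ₗ[ℝ] B :=
      { toFun := connComp D x₀ z X
        map_add' := connComp_add_right D hzt X
        map_smul' := connComp_smul_right D hzt X }
    change ∑ i, f i x • L (b i) = L (ζ z)
    conv_rhs => rw [← b.sum_repr (ζ z), map_sum]
    simp only [map_smul]
    rfl

end Connection

/-! ## A normal Hessian structure in an adapted chart -/

section HessianChart

variable {A B : Type*} [NormedAddCommGroup A] [NormedSpace ℝ A]
  [NormedAddCommGroup B] [NormedSpace ℝ B]
  {M : Type*} [TopologicalSpace M] [ChartedSpace (A × B) M] [IsFoliated A B M]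

theorem normalVector_eq {x₀ : M} {z : A × B} (hz : z ∈ (chartAt (A × B) x₀).target) (u : B) :
    normalVector x₀ z u = coordSection x₀ u ((chartAt (A × B) x₀).symm z) :=
  (coordSection_symm ((chartAt (A × B) x₀).map_target hz) u).symm

theorem formInChart_eq (g : ∀ x : M, LinearMap.BilinForm ℝ (NormalFiber A B x)) {x₀ : M}
    {z : A × B} (hz : z ∈ (chartAt (A × B) x₀).target) (u w : B) :
    formInChart g x₀ z u w = g ((chartAt (A × B) x₀).symm z)
      (coordSection x₀ u ((chartAt (A × B) x₀).symm z))
      (coordSection x₀ w ((chartAt (A × B) x₀).symm z)) := by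
  unfold formInChart
  rw [normalVector_eq hz, normalVector_eq hz]

theorem formInChart_bilinear (g : ∀ x : M, LinearMap.BilinForm ℝ (NormalFiber A B x)) {x₀ : M}
    {z : A × B} (hz : z ∈ (chartAt (A × B) x₀).target) :
    IsBilinearMap ℝ (formInChart g x₀ z) where
  add_left u u' w := by
    simp only [formInChart_eq g hz, coordSection_add, map_add, LinearMap.add_apply]
  smul_left c u w := by
    simp only [formInChart_eq g hz, coordSection_smul, map_smul, LinearMap.smul_apply]
  add_right u w w' := by
    simp only [formInChart_eq g hz, coordSection_add, map_add]
  smul_right c u w := by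
    simp only [formInChart_eq g hz, coordSection_smul, map_smul]

theorem formInChart_apply (g : ∀ x : M, LinearMap.BilinForm ℝ (NormalFiber A B x)) {x₀ x : M}
    (hx : x ∈ (chartAt (A × B) x₀).source) (u w : B) :
    formInChart g x₀ (chartAt (A × B) x₀ x) u w =
      g x (coordSection x₀ u x) (coordSection x₀ w x) := by
  rw [formInChart_eq g ((chartAt (A × B) x₀).map_source hx), (chartAt (A × B) x₀).left_inv hx]

variable [FiniteDimensional ℝ B]

/-- The coefficients of a metric in the chart at `x₀`. -/
def metricCoeff (g : ∀ x : M, LinearMap.BilinForm ℝ (NormalFiber A B x)) (x₀ : M) (z : A × B) :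
    B →L[ℝ] B →L[ℝ] ℝ :=
  bilinearBundle (formInChart g x₀ z)

theorem metricCoeff_eq (g : ∀ x : M, LinearMap.BilinForm ℝ (NormalFiber A B x)) {x₀ : M}
    {z : A × B} (hz : z ∈ (chartAt (A × B) x₀).target) (u w : B) :
    metricCoeff g x₀ z u w = formInChart g x₀ z u w :=
  bilinearBundle_apply (formInChart_bilinear g hz) u w

theorem metricCoeff_apply (g : ∀ x : M, LinearMap.BilinForm ℝ (NormalFiber A B x)) {x₀ x : M}
    (hx : x ∈ (chartAt (A × B) x₀).source) (u w : B) :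
    metricCoeff g x₀ (chartAt (A × B) x₀ x) u w =
      g x (coordSection x₀ u x) (coordSection x₀ w x) := by
  rw [metricCoeff_eq g ((chartAt (A × B) x₀).map_source hx), formInChart_apply g hx]

theorem metricCoeff_normalComp (g : ∀ x : M, LinearMap.BilinForm ℝ (NormalFiber A B x)) {x₀ x : M}
    (hx : x ∈ (chartAt (A × B) x₀).source) (u w : NormalFiber A B x) :
    metricCoeff g x₀ (chartAt (A × B) x₀ x) (normalComp x₀ x u) (normalComp x₀ x w) = g x u w := by
  rw [metricCoeff_apply g hx, coordSection_normalComp hx, coordSection_normalComp hx]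

/-- The Christoffel symbols of a connection in the chart at `x₀`. -/
def connCoeff (D : NormalConnection A B M) (x₀ : M) (z : A × B) : B →L[ℝ] B →L[ℝ] B :=
  bilinearBundle fun w u => connComp D x₀ z (0, w) u

theorem connCoeff_apply (D : NormalConnection A B M) {x₀ : M} {z : A × B}
    (hz : z ∈ (chartAt (A × B) x₀).target) (w u : B) :
    connCoeff D x₀ z w u = connComp D x₀ z (0, w) u :=
  bilinearBundle_apply (f := fun w u => connComp D x₀ z (0, w) u)
    { add_left := fun u w t => by
        simp only [← connComp_add_left, Prod.mk_add_mk, add_zero]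
      smul_left := fun c u t => by
        simp only [← connComp_smul_left, Prod.smul_mk, smul_zero]
      add_right := fun u w t => connComp_add_right D hz _ _ _
      smul_right := fun c u t => connComp_smul_right D hz _ _ _ } w u

/-- The smoothness of `D` is stated for sections over all of `M`, whereas coordinate sections are
smooth only over their chart. A bump function extends them without changing the germ at the point
considered. -/
theorem connComp_smooth [FiniteDimensional ℝ A] [T2Space M] {D : NormalConnection A B M}
    (hD : CovariantDerivative.ContMDiffCovariantDerivative D ∞) (x₀ : M) (X : A × B) (u : B) :
    ContDiffOn ℝ ∞ (fun z => connComp D x₀ z X u) (chartAt (A × B) x₀).target := by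
  intro z hz
  refine ContDiffAt.contDiffWithinAt ?_
  set x := (chartAt (A × B) x₀).symm z with hxdef
  have hx : x ∈ (chartAt (A × B) x₀).source := (chartAt (A × B) x₀).map_target hz
  have hso := (chartAt (A × B) x₀).open_source
  obtain ⟨f, hf, -⟩ := (SmoothBumpFunction.nhds_basis_support (I := 𝓘(ℝ, A × B)) (c := x)
    (hso.mem_nhds hx)).mem_iff.1 (hso.mem_nhds hx)
  have hZ : ContMDiff 𝓘(ℝ, A × B) (𝓘(ℝ, A × B).prod 𝓘(ℝ, B)) ∞
      (fun y => (⟨y, ((f : M → ℝ) • coordSection (A := A) x₀ u) y⟩ : NormalBundle A B M)) :=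
    ContMDiffOn.smul_section_of_tsupport f.contMDiff.contMDiffOn hso hf (coordSection_smooth x₀ u)
  have h1 := hD.contMDiff.contMDiff (σ := (f : M → ℝ) • coordSection (A := A) x₀ u)
    (by simpa using hZ.contMDiffOn)
  have h2 := ContMDiffOn.clm_bundle_apply (h1.mono (subset_univ (chartAt (A × B) x₀).source))
    (coordField_smooth x₀ X)
  have h3 := (isSmoothSectionOn_iff (x₀ := x₀) subset_rfl hso _).1 h2
  have h4 : ∀ᶠ y in 𝓝 x, D ((f : M → ℝ) • coordSection (A := A) x₀ u) y =
      D (coordSection (A := A) x₀ u) y := by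
    -- `D` at a nearby point `y` depends on the germ there, so the bump function has to be `1`
    -- around every such `y`.
    have h5 := f.eventuallyEq_one.eventually_nhds
    filter_upwards [h5, hso.mem_nhds hx] with y hy hys
    have h6 : ∀ᶠ t in 𝓝 y, coordSection (A := A) x₀ u t =
        ((f : M → ℝ) • coordSection (A := A) x₀ u) t := by
      filter_upwards [hy] with t ht
      simp [ht]
    refine (D.congr hys (differentiableAt_const u) ?_ h6).symm
    filter_upwards [hso.mem_nhds hys] with t ht
    exact normalComp_coordSection ht u
  have h7 : ContMDiffAt 𝓘(ℝ, A × B) 𝓘(ℝ, B) ∞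
      (fun y => normalComp x₀ y (D (coordSection (A := A) x₀ u) y (coordField x₀ X y))) x := by
    refine (h3.contMDiffAt (hso.mem_nhds hx)).congr_of_eventuallyEq ?_
    filter_upwards [h4] with y hy
    rw [hy]
  have h8 : ContMDiffAt 𝓘(ℝ, A × B) 𝓘(ℝ, A × B) ∞ (chartAt (A × B) x₀).symm z :=
    contMDiffAt_symm_of_mem_maximalAtlas
      (IsManifold.subset_maximalAtlas (chart_mem_atlas (A × B) x₀)) hz
  exact (h7.comp z h8).contDiffAt

/-! ### The Hessian axioms in an adapted chart -/

section Structure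

variable {D : NormalConnection A B M}
  {g : ∀ x : M, LinearMap.BilinForm ℝ (NormalFiber A B x)}

namespace IsNormalHessian

omit [FiniteDimensional ℝ B] in
theorem connComp_leaf (h : IsNormalHessian D g) {x₀ : M} {z : A × B}
    (hz : z ∈ (chartAt (A × B) x₀).target) (a : A) (u : B) :
    connComp D x₀ z (a, 0) u = 0 := by
  have hx := (chartAt (A × B) x₀).map_target hz
  unfold connComp
  rw [h.normal _ (chartAt (A × B) x₀).open_source _ (coordSection_foliated x₀ u) _ hx _
    (coordField_leaf x₀ _ a)]
  exact map_zero ((normalBundleCore A B M).coordChange _ _ _)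

theorem connComp_eq (h : IsNormalHessian D g) {x₀ : M} {z : A × B}
    (hz : z ∈ (chartAt (A × B) x₀).target) (X : A × B) (u : B) :
    connComp D x₀ z X u = connCoeff D x₀ z X.2 u := by
  have hX : X = (X.1, 0) + (0, X.2) := by simp
  rw [connCoeff_apply D hz]
  conv_lhs => rw [hX, connComp_add_left, h.connComp_leaf hz, zero_add]

/-- The covariant derivative of a section with components `ζ`. -/
theorem normalComp_conn (h : IsNormalHessian D g) {x₀ x : M}
    (hx : x ∈ (chartAt (A × B) x₀).source)
    {Z : ∀ x : M, NormalFiber A B x} {ζ : A × B → B}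
    (hζ : DifferentiableAt ℝ ζ (chartAt (A × B) x₀ x))
    (hZ : ∀ᶠ y in 𝓝 x, normalComp x₀ y (Z y) = ζ (chartAt (A × B) x₀ y)) (X : A × B) :
    normalComp x₀ x (D Z x (coordField x₀ X x)) =
      fderiv ℝ ζ (chartAt (A × B) x₀ x) X +
        connCoeff D x₀ (chartAt (A × B) x₀ x) X.2 (ζ (chartAt (A × B) x₀ x)) := by
  rw [_root_.normalComp_conn D hx hζ hZ,
    h.connComp_eq ((chartAt (A × B) x₀).map_source hx)]

theorem normalComp_conn_coordSection (h : IsNormalHessian D g) {x₀ x : M}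
    (hx : x ∈ (chartAt (A × B) x₀).source) (u : B) (X : A × B) :
    normalComp x₀ x (D (coordSection x₀ u) x (coordField x₀ X x)) =
      connCoeff D x₀ (chartAt (A × B) x₀ x) X.2 u := by
  rw [← connComp_apply D hx, h.connComp_eq ((chartAt (A × B) x₀).map_source hx)]

theorem connCoeff_smooth [FiniteDimensional ℝ A] [T2Space M] (h : IsNormalHessian D g) (x₀ : M) :
    ContDiffOn ℝ ∞ (connCoeff D x₀) (chartAt (A × B) x₀).target :=
  contDiffOn_bilinear fun u w => (connComp_smooth h.smooth x₀ (0, u) w).congr fun _ hz =>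
    connCoeff_apply D hz u w

theorem metricCoeff_smooth (h : IsNormalHessian D g) (x₀ : M) :
    ContDiffOn ℝ ∞ (metricCoeff g x₀) (chartAt (A × B) x₀).target :=
  contDiffOn_bilinear fun u w => (h.metric.smooth x₀ u w).congr fun _ hz =>
    metricCoeff_eq g hz u w

/-- The directions are arbitrary coordinate vectors, leafwise ones included: transverse directions
give flatness, and one leafwise direction gives the basic character of `Γ`. The bracket term
vanishes for coordinate fields. -/
theorem connCoeff_curvature [FiniteDimensional ℝ A] [T2Space M] (h : IsNormalHessian D g)
    {x₀ x : M} (hx : x ∈ (chartAt (A × B) x₀).source) (X Y : A × B) (t : B) :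
    fderiv ℝ (connCoeff D x₀) (chartAt (A × B) x₀ x) X Y.2 t +
        connCoeff D x₀ (chartAt (A × B) x₀ x) X.2
          (connCoeff D x₀ (chartAt (A × B) x₀ x) Y.2 t) =
      fderiv ℝ (connCoeff D x₀) (chartAt (A × B) x₀ x) Y X.2 t +
        connCoeff D x₀ (chartAt (A × B) x₀ x) Y.2
          (connCoeff D x₀ (chartAt (A × B) x₀ x) X.2 t) := by
  have hso := (chartAt (A × B) x₀).open_source
  have hz := (chartAt (A × B) x₀).map_source hx
  have hd : DifferentiableAt ℝ (connCoeff D x₀) (chartAt (A × B) x₀ x) :=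
    ((h.connCoeff_smooth x₀).contDiffAt
      ((chartAt (A × B) x₀).open_target.mem_nhds hz)).differentiableAt (by simp)
  have key : ∀ X Y : A × B, normalComp x₀ x
      (D (fun y => D (coordSection x₀ t) y (coordField x₀ Y y)) x (coordField x₀ X x)) =
      fderiv ℝ (connCoeff D x₀) (chartAt (A × B) x₀ x) X Y.2 t +
        connCoeff D x₀ (chartAt (A × B) x₀ x) X.2
          (connCoeff D x₀ (chartAt (A × B) x₀ x) Y.2 t) := by
    intro X Y
    have hdd : DifferentiableAt ℝ (fun z => connCoeff D x₀ z Y.2 t) (chartAt (A × B) x₀ x) :=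
      (hd.clm_apply (differentiableAt_const _)).clm_apply (differentiableAt_const _)
    rw [h.normalComp_conn hx hdd, fderiv_bilinear_apply hd]
    filter_upwards [hso.mem_nhds hx] with y hy
    exact h.normalComp_conn_coordSection hy t Y
  have h1 := h.flat _ hso (coordField x₀ X) (coordField x₀ Y) (coordSection x₀ t)
    (coordField_smooth x₀ X) (coordField_smooth x₀ Y) (coordSection_smooth x₀ t) x hx
  have : CompleteSpace A := FiniteDimensional.complete ℝ A
  have : CompleteSpace B := FiniteDimensional.complete ℝ B
  rw [mlieBracket_coordField hx, map_zero, sub_zero, sub_eq_zero] at h1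
  rw [← key, ← key, h1]

theorem connCoeff_symm [FiniteDimensional ℝ A] (h : IsNormalHessian D g) {x₀ x : M}
    (hx : x ∈ (chartAt (A × B) x₀).source) (u w : B) :
    connCoeff D x₀ (chartAt (A × B) x₀ x) u w = connCoeff D x₀ (chartAt (A × B) x₀ x) w u := by
  have h1 := h.torsion_free _ (chartAt (A × B) x₀).open_source (coordField x₀ (0, u))
    (coordField x₀ (0, w)) (coordField_smooth x₀ _) (coordField_smooth x₀ _) x hx
  have : CompleteSpace A := FiniteDimensional.complete ℝ A
  have : CompleteSpace B := FiniteDimensional.complete ℝ B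
  rw [mlieBracket_coordField hx, map_zero, sub_eq_zero] at h1
  simp only [normalProj_coordField] at h1
  have h2 := h.normalComp_conn_coordSection hx w (0, u)
  have h3 := h.normalComp_conn_coordSection hx u (0, w)
  change _ = connCoeff D x₀ (chartAt (A × B) x₀ x) u w at h2
  change _ = connCoeff D x₀ (chartAt (A × B) x₀ x) w u at h3
  rw [← h2, ← h3]
  exact congrArg (normalComp x₀ x) h1

/-- Coordinate fields are infinitesimal automorphisms even when they are tangent to the leaves, so
the Codazzi equation also covers leafwise directions. There it expresses that `g` is foliated, which
the axioms do not state separately. -/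
theorem metricCoeff_codazzi (h : IsNormalHessian D g) {x₀ x : M}
    (hx : x ∈ (chartAt (A × B) x₀).source) (X Y : A × B) (t : B) :
    fderiv ℝ (metricCoeff g x₀) (chartAt (A × B) x₀ x) X Y.2 t -
        metricCoeff g x₀ (chartAt (A × B) x₀ x)
          (connCoeff D x₀ (chartAt (A × B) x₀ x) X.2 Y.2) t -
        metricCoeff g x₀ (chartAt (A × B) x₀ x) Y.2
          (connCoeff D x₀ (chartAt (A × B) x₀ x) X.2 t) =
      fderiv ℝ (metricCoeff g x₀) (chartAt (A × B) x₀ x) Y X.2 t -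
        metricCoeff g x₀ (chartAt (A × B) x₀ x)
          (connCoeff D x₀ (chartAt (A × B) x₀ x) Y.2 X.2) t -
        metricCoeff g x₀ (chartAt (A × B) x₀ x) X.2
          (connCoeff D x₀ (chartAt (A × B) x₀ x) Y.2 t) := by
  have hso := (chartAt (A × B) x₀).open_source
  have hz := (chartAt (A × B) x₀).map_source hx
  have hd : DifferentiableAt ℝ (metricCoeff g x₀) (chartAt (A × B) x₀ x) :=
    ((h.metricCoeff_smooth x₀).contDiffAt
      ((chartAt (A × B) x₀).open_target.mem_nhds hz)).differentiableAt (by simp)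
  have h1 := h.codazzi _ hso (coordField x₀ X) (coordField x₀ Y) (coordSection x₀ t)
    (coordField_infAut x₀ X) (coordField_infAut x₀ Y) (coordSection_foliated x₀ t) x hx
  simp only [normalProj_coordField] at h1
  have key : ∀ X Y : A × B, dirDeriv (A := A) (B := B)
      (fun y => g y (coordSection x₀ Y.2 y) (coordSection x₀ t y)) x (coordField x₀ X x) =
        fderiv ℝ (metricCoeff g x₀) (chartAt (A × B) x₀ x) X Y.2 t := by
    intro X Y
    have hdd : DifferentiableAt ℝ (fun z => metricCoeff g x₀ z Y.2 t) (chartAt (A × B) x₀ x) :=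
      (hd.clm_apply (differentiableAt_const _)).clm_apply (differentiableAt_const _)
    rw [fderiv_bilinear_apply hd]
    refine mfderiv_coordField hx hdd ?_ X
    filter_upwards [hso.mem_nhds hx] with y hy
    exact (metricCoeff_apply g hy Y.2 t).symm
  have key2 : ∀ (X : A × B) (u t : B), g x (D (coordSection x₀ u) x (coordField x₀ X x))
      (coordSection x₀ t x) = metricCoeff g x₀ (chartAt (A × B) x₀ x)
          (connCoeff D x₀ (chartAt (A × B) x₀ x) X.2 u) t := by
    intro X u t
    rw [← metricCoeff_normalComp g hx, h.normalComp_conn_coordSection hx,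
      normalComp_coordSection hx]
  have key3 : ∀ (X : A × B) (u t : B), g x (coordSection x₀ u x)
      (D (coordSection x₀ t) x (coordField x₀ X x)) =
        metricCoeff g x₀ (chartAt (A × B) x₀ x) u
          (connCoeff D x₀ (chartAt (A × B) x₀ x) X.2 t) := by
    intro X u t
    rw [← metricCoeff_normalComp g hx, h.normalComp_conn_coordSection hx,
      normalComp_coordSection hx]
  simpa only [key, key2, key3] using h1

theorem isHessianChart [FiniteDimensional ℝ A] [T2Space M] (h : IsNormalHessian D g) (x₀ : M) :
    IsHessianChart (chartAt (A × B) x₀).target (metricCoeff g x₀) (connCoeff D x₀) := by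
  have hx : ∀ z ∈ (chartAt (A × B) x₀).target, ∃ x ∈ (chartAt (A × B) x₀).source,
      chartAt (A × B) x₀ x = z := fun z hz =>
    ⟨_, (chartAt (A × B) x₀).map_target hz, (chartAt (A × B) x₀).right_inv hz⟩
  refine ⟨(chartAt (A × B) x₀).open_target, h.metricCoeff_smooth x₀, h.connCoeff_smooth x₀,
    ?_, ?_, ?_, ?_, ?_, ?_, ?_⟩
  · intro z hz u w
    rw [metricCoeff_eq g hz, metricCoeff_eq g hz]
    exact h.metric.symm _ _ _
  · intro z hz u hu
    obtain ⟨x, hx, rfl⟩ := hx z hz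
    rw [metricCoeff_apply g hx]
    refine h.metric.pos _ _ fun h0 => hu ?_
    rw [← normalComp_coordSection (A := A) hx u, h0]
    exact map_zero ((normalBundleCore A B M).coordChange _ _ _)
  -- Codazzi with one leafwise direction: every term but the leafwise derivative of `g` has a zero
  -- argument.
  · intro z hz a
    obtain ⟨x, hx, rfl⟩ := hx z hz
    ext u t
    simpa using h.metricCoeff_codazzi hx (a, 0) (0, u) t
  -- Flatness with one leafwise direction, by the same mechanism.
  · intro z hz a
    obtain ⟨x, hx, rfl⟩ := hx z hz
    ext u t
    simpa using h.connCoeff_curvature hx (a, 0) (0, u) t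
  · intro z hz u w
    obtain ⟨x, hx, rfl⟩ := hx z hz
    exact h.connCoeff_symm hx u w
  · intro z hz u w t
    obtain ⟨x, hx, rfl⟩ := hx z hz
    exact h.connCoeff_curvature hx (0, u) (0, w) t
  · intro z hz u w t
    obtain ⟨x, hx, rfl⟩ := hx z hz
    exact h.metricCoeff_codazzi hx (0, u) (0, w) t

end IsNormalHessian

end Structure

end HessianChart

/-! ## The induced structure in the charts of the total space -/

section TotalSpaceChart

variable {A B : Type*} [NormedAddCommGroup A] [NormedSpace ℝ A]
  [NormedAddCommGroup B] [NormedSpace ℝ B]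
  {M : Type*} [TopologicalSpace M] [ChartedSpace (A × B) M] [IsFoliated A B M]

theorem baseProj_chartAt (v₀ v : NormalBundle A B M) :
    baseProj A B (chartAt (A × (B × B)) v₀ v) = chartAt (A × B) v₀.1 v.1 := rfl

theorem chartAt_fibre (v₀ v : NormalBundle A B M) :
    (chartAt (A × (B × B)) v₀ v).2.2 = normalComp v₀.1 v.1 v.2 := rfl

theorem mem_total_source {v₀ v : NormalBundle A B M} :
    v ∈ (chartAt (A × (B × B)) v₀).source ↔ v.1 ∈ (chartAt (A × B) v₀.1).source :=
  mem_normalBundleChart_source _ v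

theorem total_target (v₀ : NormalBundle A B M) :
    (chartAt (A × (B × B)) v₀).target = baseProj A B ⁻¹' (chartAt (A × B) v₀.1).target :=
  Set.ext fun z => mem_normalBundleChart_target (achart (A × B) v₀.1) z

theorem normalComp_injective (x : M) : Function.Injective (normalComp (A := A) (B := B) x x) :=
  fun u w h => by rwa [normalComp_self, normalComp_self] at h

/-- The change `(x, y, dy) ↦ (x', y', (∂y'/∂y) dy)` is differentiated by the product rule; its fibre
component produces a second derivative of the base change. -/
theorem fderiv_total_chartChange {v₀ v : NormalBundle A B M}
    (hv : v.1 ∈ (chartAt (A × B) v₀.1).source) (U : B × B) :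
    (fderiv ℝ (chartChange (A := A) (B := B × B) v₀ v) (chartAt (A × (B × B)) v₀ v) (0, U)).2 =
      ((fderiv ℝ (chartChange v₀.1 v.1) (chartAt (A × B) v₀.1 v.1) (0, U.1)).2,
        (fderiv ℝ (fderiv ℝ (chartChange v₀.1 v.1)) (chartAt (A × B) v₀.1 v.1) (0, U.1)
          (0, normalComp v₀.1 v.1 v.2)).2 +
        (fderiv ℝ (chartChange v₀.1 v.1) (chartAt (A × B) v₀.1 v.1) (0, U.2)).2) := by
  set τ := chartChange (A := A) (B := B) v₀.1 v.1 with hτ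
  set z := chartAt (A × (B × B)) v₀ v with hz
  have hx := mem_chart_source (A × B) v.1
  have hc := chartChange_contDiffAt hv hx
  have hd := hc.differentiableAt (by simp)
  have hdd : DifferentiableAt ℝ (fderiv ℝ τ) (chartAt (A × B) v₀.1 v.1) :=
    (hc.fderiv_right (m := ∞) (by simp)).differentiableAt (by simp)
  set qL : A × (B × B) →L[ℝ] A × B := (ContinuousLinearMap.inr ℝ A B).comp
      ((ContinuousLinearMap.snd ℝ B B).comp (ContinuousLinearMap.snd ℝ A (B × B))) with hqL
  have hp : HasFDerivAt (fun z => baseProj A B z) (baseProj A B) z := (baseProj A B).hasFDerivAt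
  have e1 : HasFDerivAt (fun z => τ (baseProj A B z))
      ((fderiv ℝ τ (chartAt (A × B) v₀.1 v.1)).comp (baseProj A B)) z :=
    HasFDerivAt.comp (g := τ) z hd.hasFDerivAt hp
  have e2 : HasFDerivAt (fun z => fderiv ℝ τ (baseProj A B z))
      ((fderiv ℝ (fderiv ℝ τ) (chartAt (A × B) v₀.1 v.1)).comp (baseProj A B)) z :=
    HasFDerivAt.comp (g := fderiv ℝ τ) z hdd.hasFDerivAt hp
  have e3 := e2.clm_apply (qL.hasFDerivAt (x := z))
  have e4 := e1.fst.prodMk (e1.snd.prodMk e3.snd)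
  have e5 : (chartChange (A := A) (B := B × B) v₀ v) =ᶠ[𝓝 z] fun z =>
      ((τ (baseProj A B z)).1, ((τ (baseProj A B z)).2,
        (fderiv ℝ τ (baseProj A B z) (qL z)).2)) := by
    have hS := ((chartAt (A × B) v₀.1).symm.trans (chartAt (A × B) v.1)).open_source.preimage
      (baseProj A B).continuous
    have hz' : baseProj A B z ∈
        ((chartAt (A × B) v₀.1).symm.trans (chartAt (A × B) v.1)).source := by
      rw [hz, baseProj_chartAt]
      simp [hv]
    filter_upwards [hS.mem_nhds hz'] with w hw
    exact normalBundleChart_transition (achart (A × B) v₀.1) (achart (A × B) v.1) w hw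
  rw [e5.fderiv_eq, e4.fderiv]
  have e6 : baseProj A B ((0 : A), U) = (0, U.1) := rfl
  have e7 : qL ((0 : A), U) = (0, U.2) := rfl
  have e8 : qL z = (0, normalComp v₀.1 v.1 v.2) := rfl
  have e9 : baseProj A B z = chartAt (A × B) v₀.1 v.1 := rfl
  simp only [ContinuousLinearMap.prod_apply, ContinuousLinearMap.comp_apply,
    add_apply, ContinuousLinearMap.flip_apply, e6, e7, e8, e9, ContinuousLinearMap.coe_snd',
    Prod.snd_add]
  rw [add_comm]

theorem coordSection_total {v₀ v : NormalBundle A B M}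
    (hv : v.1 ∈ (chartAt (A × B) v₀.1).source) (U : B × B) :
    normalComp (A := A) (B := B × B) v v (coordSection v₀ U v) =
      (normalComp (A := A) (B := B) v.1 v.1 (coordSection v₀.1 U.1 v.1),
        (fderiv ℝ (fderiv ℝ (chartChange v₀.1 v.1)) (chartAt (A × B) v₀.1 v.1) (0, U.1)
          (0, normalComp v₀.1 v.1 v.2)).2 +
          normalComp (A := A) (B := B) v.1 v.1 (coordSection v₀.1 U.2 v.1)) := by
  have hx := mem_chart_source (A × B) v.1
  have h1 := normalComp_coordSection_change (A := A) (B := B × B) (mem_total_source.2 hv)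
    (mem_chart_source (A × (B × B)) v) U
  have h2 := normalComp_coordSection_change (A := A) (B := B) hv hx
  refine h1.trans ((fderiv_total_chartChange hv U).trans ?_)
  rw [h2, h2]

theorem normalBundleProj_coordSection {v₀ v : NormalBundle A B M}
    (hv : v.1 ∈ (chartAt (A × B) v₀.1).source) (U : B × B) :
    normalBundleProj v (coordSection v₀ U v) = coordSection v₀.1 U.1 v.1 :=
  (congrArg Prod.fst (normalComp_self v (coordSection v₀ U v))).symm.trans
    ((congrArg Prod.fst (coordSection_total hv U)).trans (normalComp_self _ _))

variable [FiniteDimensional ℝ B] {D : NormalConnection A B M}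
  {g : ∀ x : M, LinearMap.BilinForm ℝ (NormalFiber A B x)}

omit [FiniteDimensional ℝ B] in
theorem connectionTerm_eq (D : NormalConnection A B M) (v : NormalBundle A B M)
    (a : NormalFiber A B v.1) :
    connectionTerm D v a =
      D (coordSection v.1 (normalComp v.1 v.1 v.2)) v.1 (transverseLift A B v.1 a) := by
  have hx := mem_chart_source (A × B) v.1
  have h1 : ∀ᶠ y in 𝓝 v.1, coordSection (A := A) v.1 (normalComp v.1 v.1 v.2) y =
      (trivializationAt B (NormalFiber A B) v.1).symm y
        (trivializationAt B (NormalFiber A B) v.1 v).2 := by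
    filter_upwards [(chartAt (A × B) v.1).open_source.mem_nhds hx] with y hy
    rw [coordSection_symm hy]
    rfl
  have h2 := D.congr hx (differentiableAt_const (normalComp v.1 v.1 v.2)) (by
    filter_upwards [(chartAt (A × B) v.1).open_source.mem_nhds hx] with y hy
    exact normalComp_coordSection hy _) h1
  rw [h2]
  rfl

omit [FiniteDimensional ℝ B] in
theorem IsNormalHessian.connection_eq_of_normalProj (h : IsNormalHessian D g) {U : Set M}
    (hU : IsOpen U) {Z : ∀ x : M, NormalFiber A B x} (hZ : IsFoliatedSectionOn U Z) {x : M}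
    (hx : x ∈ U) {X Y : TangentSpace 𝓘(ℝ, A × B) x}
    (hXY : normalProj A B x X = normalProj A B x Y) : D Z x X = D Z x Y := by
  rw [← sub_eq_zero, ← map_sub]
  refine h.normal U hU Z hZ x hx _ ?_
  have h1 : normalProj A B x (X - Y) = 0 := by rw [map_sub, hXY, sub_self]
  exact h1

/-- The transformation law of Christoffel symbols, whose inhomogeneous term is the second derivative
of the change of charts. The same term, with the same sign, occurs in `coordSection_total`, and this
makes the connector independent of the chart. -/
theorem IsNormalHessian.connectionTerm_coordSection (h : IsNormalHessian D g)
    {v₀ v : NormalBundle A B M} (hv : v.1 ∈ (chartAt (A × B) v₀.1).source) (u : B) :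
    normalComp v.1 v.1 (coordSection (A := A) v₀.1
        (connCoeff D v₀.1 (chartAt (A × B) v₀.1 v.1) u (normalComp v₀.1 v.1 v.2)) v.1) =
      (fderiv ℝ (fderiv ℝ (chartChange v₀.1 v.1)) (chartAt (A × B) v₀.1 v.1) (0, u)
          (0, normalComp v₀.1 v.1 v.2)).2 +
        normalComp v.1 v.1 (connectionTerm D v (coordSection v₀.1 u v.1)) := by
  set x₀ := v₀.1
  set x := v.1 with hxdef
  set η := normalComp x₀ x v.2 with hη
  have hx := mem_chart_source (A × B) x
  set F : A × B → B := fun z => (fderiv ℝ (chartChange x₀ x) z (0, η)).2 with hF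
  have hc := chartChange_contDiffAt hv hx
  have hdd : DifferentiableAt ℝ (fderiv ℝ (chartChange x₀ x)) (chartAt (A × B) x₀ x) :=
    (hc.fderiv_right (m := ∞) (by simp)).differentiableAt (by simp)
  have hFd := (hdd.hasFDerivAt.clm_apply (hasFDerivAt_const ((0, η) : A × B) _)).snd
  have hcx : chartChange x x₀ (chartAt (A × B) x x) = chartAt (A × B) x₀ x := by
    simp [chartChange]
  set ζ : A × B → B := F ∘ chartChange x x₀ with hζ
  have hζd : DifferentiableAt ℝ ζ (chartAt (A × B) x x) := by
    refine DifferentiableAt.comp _ ?_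
      ((chartChange_contDiffAt hx hv).differentiableAt (by simp))
    rw [hcx]
    exact hFd.differentiableAt
  have hcomp : ∀ᶠ y in 𝓝 x, normalComp x y (coordSection (A := A) x₀ η y) =
      F (chartAt (A × B) x₀ y) := by
    filter_upwards [(chartAt (A × B) x₀).open_source.mem_nhds hv,
      (chartAt (A × B) x).open_source.mem_nhds hx] with y h0 h1
    exact normalComp_coordSection_change h0 h1 η
  have hcomp' : ∀ᶠ y in 𝓝 x, normalComp x y (coordSection (A := A) x₀ η y) =
      ζ (chartAt (A × B) x y) := by
    filter_upwards [hcomp, (chartAt (A × B) x).open_source.mem_nhds hx] with y hy h1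
    rw [hy]
    simp [hζ, chartChange, h1]
  set Y : A × B := coordField x₀ (0, u) x with hY
  have hYx : coordField x Y x = coordField x₀ (0, u) x := coordField_self x Y
  have hsec : coordSection (A := A) x₀ η x = v.2 := coordSection_normalComp hv v.2
  -- The section with constant components `η` in the chart at `x₀` has the value `v.2` at `x`. Its
  -- covariant derivative is computed here in the chart at `x`, where its components vary; the final
  -- lines compute it in the chart at `x₀`.
  have e1 := _root_.normalComp_conn D hx hζd hcomp' Y
  have e2 : fderiv ℝ ζ (chartAt (A × B) x x) Y = fderiv ℝ F (chartAt (A × B) x₀ x) (0, u) := by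
    rw [← mfderiv_coordField hx hζd hcomp' Y, hYx]
    exact mfderiv_coordField hv hFd.differentiableAt hcomp (0, u)
  have e3 : ζ (chartAt (A × B) x x) = normalComp x x v.2 := by
    rw [← hcomp'.self_of_nhds, hsec]
  have e4 : fderiv ℝ F (chartAt (A × B) x₀ x) (0, u) =
      (fderiv ℝ (fderiv ℝ (chartChange x₀ x)) (chartAt (A × B) x₀ x) (0, u) (0, η)).2 := by
    rw [hFd.fderiv]
    simp
  have e5 : connComp D x (chartAt (A × B) x x) Y (normalComp x x v.2) =
      normalComp x x (connectionTerm D v (coordSection x₀ u x)) := by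
    rw [connComp_apply D hx, hYx, connectionTerm_eq]
    congr 1
    -- The coordinate field and the transverse lift may differ by a leafwise vector, which `D`
    -- annihilates on foliated sections.
    refine h.connection_eq_of_normalProj (chartAt (A × B) x).open_source
      (coordSection_foliated x _) hx ?_
    rw [normalProj_coordField]
    rfl
  rw [e2, e3, e4, e5, hYx] at e1
  refine Eq.trans ?_ e1
  rw [← h.normalComp_conn_coordSection hv η (0, u), coordSection_normalComp hv]

/-- The connector is defined in the preferred chart of its own point, but derivatives on the total
space need one fixed chart around that point. The second derivative terms of `coordSection_total`
and `connectionTerm_coordSection` combine, so that the formula `b + Γ(a) dy` holds in every induced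
chart. -/
theorem IsNormalHessian.connector_coordSection (h : IsNormalHessian D g)
    {v₀ v : NormalBundle A B M} (hv : v.1 ∈ (chartAt (A × B) v₀.1).source) (U : B × B) :
    connector D v (coordSection v₀ U v) = coordSection v₀.1
      (splitMap (connCoeff D v₀.1) (chartAt (A × (B × B)) v₀ v) U).2 v.1 := by
  have h1 : connector D v (coordSection v₀ U v) = fibreComponent v (coordSection v₀ U v) +
      connectionTerm D v (normalBundleProj v (coordSection v₀ U v)) := rfl
  have h2 : normalComp v.1 v.1 (fibreComponent v (coordSection v₀ U v)) = _ :=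
    (normalComp_self v.1 (fibreComponent v (coordSection v₀ U v))).trans
      ((congrArg Prod.snd (normalComp_self v (coordSection v₀ U v))).symm.trans
        (congrArg Prod.snd (coordSection_total (A := A) hv U)))
  apply normalComp_injective v.1
  rw [h1, normalBundleProj_coordSection hv, normalComp_add, h2, splitMap_apply, coordSection_add,
    normalComp_add, baseProj_chartAt, chartAt_fibre, h.connectionTerm_coordSection hv]
  exact (add_assoc _ _ _).trans (add_left_comm _ _ _)

omit [FiniteDimensional ℝ B] in
theorem total_ext (D : NormalConnection A B M) {v : NormalBundle A B M}
    {V W : NormalFiber A (B × B) v} (h1 : normalBundleProj v V = normalBundleProj v W)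
    (h2 : connector D v V = connector D v W) : V = W := by
  have h3 : fibreComponent v V + connectionTerm D v (normalBundleProj v V) =
      fibreComponent v W + connectionTerm D v (normalBundleProj v W) := h2
  rw [h1] at h3
  have h4 : fibreComponent v V = fibreComponent v W := add_right_cancel h3
  exact Prod.ext h1 h4

omit [FiniteDimensional ℝ B] in
theorem normalBundleProj_horizontalLift (D : NormalConnection A B M) (v : NormalBundle A B M)
    (a : NormalFiber A B v.1) : normalBundleProj v (horizontalLift D v a) = a := by
  have h1 : ∀ a, normalBundleProj v (verticalLift v a) = 0 := fun a => rfl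
  have h2 : ∀ a, normalBundleProj v (coordinateLift v a) = a := fun a => rfl
  have h3 : horizontalLift D v a =
    coordinateLift v a - verticalLift v (connectionTerm D v a) := rfl
  rw [h3, map_sub, h1, h2, sub_zero]

omit [FiniteDimensional ℝ B] in
theorem connector_verticalLift (D : NormalConnection A B M) (v : NormalBundle A B M)
    (a : NormalFiber A B v.1) : connector D v (verticalLift v a) = a := by
  change fibreComponent v (verticalLift v a) +
    connectionTerm D v (normalBundleProj v (verticalLift v a)) = a
  have h2 : normalBundleProj v (verticalLift v a) = 0 := rfl
  have h3 : fibreComponent v (verticalLift v a) = a := rfl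
  rw [h2, h3, map_zero, add_zero]

omit [FiniteDimensional ℝ B] in
theorem connector_horizontalLift (D : NormalConnection A B M) (v : NormalBundle A B M)
    (a : NormalFiber A B v.1) : connector D v (horizontalLift D v a) = 0 := by
  have h4 : connector D v (coordinateLift v a) = connectionTerm D v a := by
    change fibreComponent v (coordinateLift v a) +
      connectionTerm D v (normalBundleProj v (coordinateLift v a)) = _
    have h2 : normalBundleProj v (coordinateLift v a) = a := rfl
    have h3 : fibreComponent v (coordinateLift v a) = 0 := rfl
    rw [h2, h3, zero_add]
  have h6 : horizontalLift D v a =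
    coordinateLift v a - verticalLift v (connectionTerm D v a) := rfl
  rw [h6, map_sub, connector_verticalLift, h4, sub_self]

omit [FiniteDimensional ℝ B] in
theorem normalBundleProj_inducedComplex (D : NormalConnection A B M) (v : NormalBundle A B M)
    (V : NormalFiber A (B × B) v) :
    normalBundleProj v (inducedComplex D v V) = -connector D v V := by
  have h1 : ∀ a, normalBundleProj v (verticalLift v a) = 0 := fun a => rfl
  have h3 : inducedComplex D v V = verticalLift v (normalBundleProj v V) -
    horizontalLift D v (connector D v V) := rfl
  rw [h3, map_sub, h1, normalBundleProj_horizontalLift, zero_sub]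

omit [FiniteDimensional ℝ B] in
theorem connector_inducedComplex (D : NormalConnection A B M) (v : NormalBundle A B M)
    (V : NormalFiber A (B × B) v) :
    connector D v (inducedComplex D v V) = normalBundleProj v V := by
  have h7 : inducedComplex D v V = verticalLift v (normalBundleProj v V) -
    horizontalLift D v (connector D v V) := rfl
  rw [h7, map_sub, connector_verticalLift, connector_horizontalLift, sub_zero]

omit [FiniteDimensional ℝ B] in
theorem inducedMetric_apply (D : NormalConnection A B M)
    (g : ∀ x : M, LinearMap.BilinForm ℝ (NormalFiber A B x)) (v : NormalBundle A B M)
    (V W : NormalFiber A (B × B) v) : inducedMetric D g v V W =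
      g v.1 (normalBundleProj v V) (normalBundleProj v W) +
        g v.1 (connector D v V) (connector D v W) := rfl

/-! ### The induced Kähler structure and its Ricci tensor in the charts of the total space -/

namespace IsNormalHessian

theorem inducedMetric_coordSection (h : IsNormalHessian D g)
    {v₀ v : NormalBundle A B M} (hv : v.1 ∈ (chartAt (A × B) v₀.1).source) (U W : B × B) :
    inducedMetric D g v (coordSection v₀ U v) (coordSection v₀ W v) =
      totalMetric (metricCoeff g v₀.1) (connCoeff D v₀.1) (chartAt (A × (B × B)) v₀ v) U W := by
  rw [inducedMetric_apply, normalBundleProj_coordSection hv, normalBundleProj_coordSection hv,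
    h.connector_coordSection hv, h.connector_coordSection hv, ← metricCoeff_apply g hv,
    ← metricCoeff_apply g hv]
  rfl

theorem formInChart_inducedMetric (h : IsNormalHessian D g) {v₀ : NormalBundle A B M}
    {z : A × (B × B)} (hz : baseProj A B z ∈ (chartAt (A × B) v₀.1).target) (U W : B × B) :
    formInChart (inducedMetric D g) v₀ z U W =
      totalMetric (metricCoeff g v₀.1) (connCoeff D v₀.1) z U W := by
  have hz' : z ∈ (chartAt (A × (B × B)) v₀).target := by rwa [total_target]
  have hv := (chartAt (A × (B × B)) v₀).map_target hz'
  conv_lhs => rw [← (chartAt (A × (B × B)) v₀).right_inv hz']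
  rw [formInChart_apply _ hv, h.inducedMetric_coordSection (mem_total_source.1 hv),
    (chartAt (A × (B × B)) v₀).right_inv hz']

theorem inducedComplex_coordSection (h : IsNormalHessian D g)
    {v₀ v : NormalBundle A B M} (hv : v.1 ∈ (chartAt (A × B) v₀.1).source) (U : B × B) :
    inducedComplex D v (coordSection v₀ U v) =
      coordSection v₀ (totalComplex (connCoeff D v₀.1) (chartAt (A × (B × B)) v₀ v) U) v := by
  have h1 : splitMap (connCoeff D v₀.1) (chartAt (A × (B × B)) v₀ v)
      (totalComplex (connCoeff D v₀.1) (chartAt (A × (B × B)) v₀ v) U) =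
      complexRotation B (splitMap (connCoeff D v₀.1) (chartAt (A × (B × B)) v₀ v) U) :=
    splitMap_unsplitMap _ _ _
  refine total_ext D ?_ ?_
  · rw [normalBundleProj_inducedComplex, normalBundleProj_coordSection hv,
      h.connector_coordSection hv]
    change _ = coordSection v₀.1 (-(splitMap (connCoeff D v₀.1) (chartAt (A × (B × B)) v₀ v) U).2)
      v.1
    rw [← neg_one_smul ℝ, ← neg_one_smul ℝ (splitMap _ _ _).2, coordSection_smul]
  · rw [connector_inducedComplex, normalBundleProj_coordSection hv,
      h.connector_coordSection hv, h1]
    rfl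

theorem endInChart_inducedComplex (h : IsNormalHessian D g) {v₀ : NormalBundle A B M}
    {z : A × (B × B)} (hz : baseProj A B z ∈ (chartAt (A × B) v₀.1).target) (U : B × B) :
    endInChart (inducedComplex D) v₀ z U = totalComplex (connCoeff D v₀.1) z U := by
  have hz' : z ∈ (chartAt (A × (B × B)) v₀).target := by rwa [total_target]
  have hv := (chartAt (A × (B × B)) v₀).map_target hz'
  have h1 : endInChart (inducedComplex D) v₀ z U = normalComp v₀ _
    (inducedComplex D _ (normalVector v₀ z U)) := rfl
  rw [h1, normalVector_eq hz', h.inducedComplex_coordSection (mem_total_source.1 hv),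
    normalComp_coordSection hv, (chartAt (A × (B × B)) v₀).right_inv hz']

variable [FiniteDimensional ℝ A] [T2Space M]

theorem christoffel_inducedMetric (h : IsNormalHessian D g) {v₀ : NormalBundle A B M}
    {z : A × (B × B)} (hz : baseProj A B z ∈ (chartAt (A × B) v₀.1).target) (U W : B × B) :
    christoffel (inducedMetric D g) v₀ z U W =
      localChristoffel (totalMetric (metricCoeff g v₀.1) (connCoeff D v₀.1)) z U W := by
  have hn := (h.isHessianChart v₀.1).isOpen_total.mem_nhds hz
  have h1 : ∀ U W, (fun z => formInChart (inducedMetric D g) v₀ z U W) =ᶠ[𝓝 z]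
      fun z => totalMetric (metricCoeff g v₀.1) (connCoeff D v₀.1) z U W := fun U W => by
    filter_upwards [hn] with w hw
    exact h.formInChart_inducedMetric hw U W
  unfold christoffel localChristoffel
  simp only [(h1 _ _).fderiv_eq, h.formInChart_inducedMetric hz]

/-- No Einstein condition enters. The pointwise identities follow from the horizontal and vertical
parts; smoothness, the foliated conditions and parallelism are read off from the local formulas. -/
theorem isNormalKahler (h : IsNormalHessian D g) :
    IsNormalKahler (inducedComplex D) (inducedMetric D g) := by
  have hT : ∀ v₀ : NormalBundle A B M, ∀ z ∈ (chartAt (A × (B × B)) v₀).target,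
      baseProj A B z ∈ (chartAt (A × B) v₀.1).target := fun v₀ z hz => by
    rwa [total_target] at hz
  have hn : ∀ v₀ : NormalBundle A B M, ∀ z ∈ (chartAt (A × (B × B)) v₀).target,
      ∀ᶠ w in 𝓝 z, baseProj A B w ∈ (chartAt (A × B) v₀.1).target := fun v₀ z hz =>
    (h.isHessianChart v₀.1).isOpen_total.mem_nhds (hT v₀ z hz)
  refine ⟨⟨?_, ?_, ?_⟩, ?_, ?_, ?_, ?_, ?_, ?_⟩
  · intro v V W
    rw [inducedMetric_apply, inducedMetric_apply, h.metric.symm _ (normalBundleProj v V),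
      h.metric.symm _ (connector D v V)]
  · intro v V hV
    rw [inducedMetric_apply]
    have hnn : ∀ u, 0 ≤ g v.1 u u := fun u => by
      by_cases hu : u = 0
      · simp [hu]
      · exact (h.metric.pos _ _ hu).le
    by_cases h1 : normalBundleProj v V = 0
    · have h2 : connector D v V ≠ 0 := fun h2 => hV <| total_ext D (by rw [h1, map_zero])
        (by rw [h2, map_zero])
      exact add_pos_of_nonneg_of_pos (hnn _) (h.metric.pos _ _ h2)
    · exact add_pos_of_pos_of_nonneg (h.metric.pos _ _ h1) (hnn _)
  · intro v₀ U W
    rw [total_target]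
    exact ((h.isHessianChart v₀.1).totalMetric_smooth U W).congr fun z hz =>
      h.formInChart_inducedMetric hz U W
  · intro v₀ U W z hz a
    have h1 : (fun z => formInChart (inducedMetric D g) v₀ z U W) =ᶠ[𝓝 z] _ :=
      (hn v₀ z hz).mono fun w hw => h.formInChart_inducedMetric hw U W
    rw [h1.fderiv_eq]
    exact (h.isHessianChart v₀.1).fderiv_totalMetric_leaf (hT v₀ z hz) a U W
  · intro v₀ U
    rw [total_target]
    exact ((h.isHessianChart v₀.1).totalComplex_smooth U).congr fun z hz =>
      h.endInChart_inducedComplex hz U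
  · intro v₀ U z hz a
    have h1 : (fun z => endInChart (inducedComplex D) v₀ z U) =ᶠ[𝓝 z] _ :=
      (hn v₀ z hz).mono fun w hw => h.endInChart_inducedComplex hw U
    rw [h1.fderiv_eq]
    exact (h.isHessianChart v₀.1).fderiv_totalComplex_leaf (hT v₀ z hz) a U
  · intro v V
    refine total_ext D ?_ ?_
    · rw [normalBundleProj_inducedComplex, connector_inducedComplex, map_neg]
    · rw [connector_inducedComplex, normalBundleProj_inducedComplex, map_neg]
  · intro v V W
    rw [inducedMetric_apply, inducedMetric_apply, normalBundleProj_inducedComplex,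
      normalBundleProj_inducedComplex, connector_inducedComplex, connector_inducedComplex,
      LinearMap.map_neg₂, map_neg, neg_neg, add_comm]
  · intro v₀ U W z hz
    have h1 : (fun z => endInChart (inducedComplex D) v₀ z W) =ᶠ[𝓝 z] _ :=
      (hn v₀ z hz).mono fun w hw => h.endInChart_inducedComplex hw W
    have hz' := hT v₀ z hz
    rw [h1.fderiv_eq, h.endInChart_inducedComplex hz', h.endInChart_inducedComplex hz',
      h.christoffel_inducedMetric hz', h.christoffel_inducedMetric hz',
      (h.isHessianChart v₀.1).localChristoffel_totalMetric hz',
      (h.isHessianChart v₀.1).localChristoffel_totalMetric hz']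
    exact (h.isHessianChart v₀.1).totalComplex_parallel hz' U W

theorem normalCurvature_inducedMetric (h : IsNormalHessian D g) {v₀ : NormalBundle A B M}
    {z : A × (B × B)} (hz : baseProj A B z ∈ (chartAt (A × B) v₀.1).target) (U W ζ : B × B) :
    normalCurvature (inducedMetric D g) v₀ z U W ζ =
      localCurvature (localChristoffel (totalMetric (metricCoeff g v₀.1) (connCoeff D v₀.1)))
        z U W ζ := by
  have hn := (h.isHessianChart v₀.1).isOpen_total.mem_nhds hz
  have h1 : ∀ U W, (fun z => christoffel (inducedMetric D g) v₀ z U W) =ᶠ[𝓝 z]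
      fun z => localChristoffel (totalMetric (metricCoeff g v₀.1) (connCoeff D v₀.1)) z U W :=
    fun U W => by
      filter_upwards [hn] with w hw
      exact h.christoffel_inducedMetric hw U W
  unfold normalCurvature localCurvature
  simp only [(h1 _ _).fderiv_eq, h.christoffel_inducedMetric hz]

/-- The Ricci tensor of the induced metric. -/
theorem normalRicci_inducedMetric (h : IsNormalHessian D g) (v : NormalBundle A B M)
    (V W : NormalFiber A (B × B) v) :
    normalRicci (inducedMetric D g) v V W =
      -koszulTwo (metricCoeff g v.1) (connCoeff D v.1) (chartAt (A × B) v.1 v.1)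
          (normalComp v.1 v.1 (normalBundleProj v V)) (normalComp v.1 v.1 (normalBundleProj v W)) -
        koszulTwo (metricCoeff g v.1) (connCoeff D v.1) (chartAt (A × B) v.1 v.1)
          (normalComp v.1 v.1 (connector D v V)) (normalComp v.1 v.1 (connector D v W)) := by
  have hx := mem_chart_source (A × B) v.1
  have hz : baseProj A B (chartAt (A × (B × B)) v v) ∈ (chartAt (A × B) v.1).target :=
    (chartAt (A × B) v.1).map_source hx
  have h1 := (h.isHessianChart v.1).ricci_total hz (normalComp v v V) (normalComp v v W)
    (Module.finBasis ℝ (B × B))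
  have h2 : ∀ V, normalComp v.1 v.1 (normalBundleProj v V) =
      (splitMap (connCoeff D v.1) (chartAt (A × (B × B)) v v) (normalComp v v V)).1 := fun V => by
    conv_lhs => rw [← coordSection_normalComp (mem_chart_source (A × (B × B)) v) V]
    rw [normalBundleProj_coordSection hx, normalComp_coordSection hx]
    rfl
  have h3 : ∀ V, normalComp v.1 v.1 (connector D v V) =
      (splitMap (connCoeff D v.1) (chartAt (A × (B × B)) v v) (normalComp v v V)).2 := fun V => by
    conv_lhs => rw [← coordSection_normalComp (mem_chart_source (A × (B × B)) v) V]
    rw [h.connector_coordSection hx, normalComp_coordSection hx]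
  rw [h2, h2, h3, h3]
  refine Eq.trans ?_ h1
  unfold normalRicci
  refine Finset.sum_congr rfl fun i _ => ?_
  rw [h.normalCurvature_inducedMetric hz]
  rfl

end IsNormalHessian

end TotalSpaceChart

/-! ## Determinants and Gram matrices -/

section Det

variable {n : Type*} [Fintype n] [DecidableEq n]

/-- Each summand is the cofactor expansion along its replaced row, obtained here from Cramer's rule.
The formula serves both the derivative of a determinant and the derivation property of the trace. -/
theorem Matrix.sum_det_updateRow (M N : Matrix n n ℝ) :
    ∑ i, (M.updateRow i (N i)).det = (M.adjugate * N).trace := by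
  have h1 : ∀ i, (M.updateRow i (N i)).det = ∑ k, M.adjugate k i * N i k := fun i => by
    rw [← Matrix.cramer_transpose_apply, Matrix.cramer_eq_adjugate_mulVec,
      ← Matrix.adjugate_transpose]
    rfl
  simp only [h1, Matrix.trace, Matrix.diag, Matrix.mul_apply]
  exact Finset.sum_comm

variable (n) in
/-- The determinant as a continuous multilinear function of the rows. -/
def detMultilinear : ContinuousMultilinearMap ℝ (fun _ : n => n → ℝ) ℝ where
  toMultilinearMap := (Matrix.detRowAlternating (R := ℝ) (n := n)).toMultilinearMap
  cont := Continuous.matrix_det (A := fun m : n → n → ℝ => Matrix.of m) continuous_id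

/-- Jacobi's formula. -/
theorem hasFDerivAt_det {E : Type*} [NormedAddCommGroup E] [NormedSpace ℝ E]
    {m : E → n → n → ℝ} {m' : E →L[ℝ] n → n → ℝ} {z : E} (hm : HasFDerivAt m m' z) :
    ∃ L : E →L[ℝ] ℝ, HasFDerivAt (fun z => (Matrix.of (m z)).det) L z ∧
      ∀ X, L X = ((Matrix.of (m z)).adjugate * Matrix.of (m' X)).trace := by
  refine ⟨_, ((detMultilinear n).hasFDerivAt (m z)).comp z hm, fun X => ?_⟩
  rw [← Matrix.sum_det_updateRow]
  change (detMultilinear n).linearDeriv (m z) (m' X) = _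
  rw [ContinuousMultilinearMap.linearDeriv_apply]
  rfl

end Det

section Gram

variable {B : Type*} [NormedAddCommGroup B] [NormedSpace ℝ B] [FiniteDimensional ℝ B]
  {n : Type*} [Fintype n] [DecidableEq n] (b : Module.Basis n ℝ B)

/-- The matrix whose rows are the components of the vectors `v i`. -/
def rowMatrix (v : n → B) : Matrix n n ℝ := Matrix.of fun i j => b.repr (v i) j

omit [FiniteDimensional ℝ B] in
theorem rowMatrix_det_basis : (rowMatrix b b).det = 1 := by
  have : rowMatrix b b = 1 := by
    ext i j
    simp [rowMatrix, Matrix.one_apply, Finsupp.single_apply]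
  rw [this, Matrix.det_one]

omit [FiniteDimensional ℝ B] in
theorem rowMatrix_map (L : B →ₗ[ℝ] B) (v : n → B) :
    rowMatrix b (fun i => L (v i)) = rowMatrix b v * (LinearMap.toMatrix b b L).transpose := by
  ext i j
  rw [Matrix.mul_apply]
  simp only [rowMatrix, Matrix.of_apply, Matrix.transpose_apply, LinearMap.toMatrix_apply]
  conv_lhs => rw [← b.sum_repr (v i)]
  simp only [map_sum, map_smul, Finsupp.coe_finsetSum, Finset.sum_apply, Finsupp.smul_apply,
    smul_eq_mul]

omit [FiniteDimensional ℝ B] in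
-- An endomorphism acts as a derivation on top-degree forms by its trace: the adjugate times the row
-- matrix is the determinant times the identity.
theorem sum_det_update (L : B →ₗ[ℝ] B) (v : n → B) :
    ∑ i, (rowMatrix b (Function.update v i (L (v i)))).det =
      LinearMap.trace ℝ B L * (rowMatrix b v).det := by
  have h1 : ∀ i, rowMatrix b (Function.update v i (L (v i))) =
      (rowMatrix b v).updateRow i (rowMatrix b (fun i => L (v i)) i) := fun i => by
    ext k j
    by_cases hk : k = i
    · subst hk
      simp [rowMatrix]
    · simp [rowMatrix, hk]
  simp only [h1]
  rw [Matrix.sum_det_updateRow, rowMatrix_map, ← mul_assoc, Matrix.adjugate_mul, Matrix.smul_mul,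
    one_mul, Matrix.trace_smul, Matrix.trace_transpose, LinearMap.trace_eq_matrix_trace ℝ b,
    smul_eq_mul, mul_comm]

/-- The Gram matrix of a basis. -/
def gramMatrix (g : B →L[ℝ] B →L[ℝ] ℝ) : Matrix n n ℝ := Matrix.of fun i j => g (b i) (b j)

omit [FiniteDimensional ℝ B] in
theorem gram_det (g : B →L[ℝ] B →L[ℝ] ℝ) (v : n → B) :
    (Matrix.of fun i j => g (v i) (v j)).det =
      (rowMatrix b v).det ^ 2 * (gramMatrix b g).det := by
  have h1 : (Matrix.of fun i j => g (v i) (v j)) =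
      rowMatrix b v * gramMatrix b g * (rowMatrix b v).transpose := by
    ext i j
    simp only [Matrix.mul_apply, rowMatrix, gramMatrix, Matrix.of_apply, Matrix.transpose_apply]
    conv_lhs => rw [← b.sum_repr (v i), ← b.sum_repr (v j)]
    simp only [map_sum, map_smul, sum_apply, smul_apply, smul_eq_mul, Finset.mul_sum,
      Finset.sum_mul]
    refine Finset.sum_congr rfl fun k _ => Finset.sum_congr rfl fun l _ => by ring
  rw [h1, Matrix.det_mul, Matrix.det_mul, Matrix.det_transpose]
  ring

variable {A : Type*} [NormedAddCommGroup A] [NormedSpace ℝ A] {T : Set (A × B)}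
  {g : A × B → B →L[ℝ] B →L[ℝ] ℝ} {Γ : A × B → B →L[ℝ] B →L[ℝ] B}

namespace IsHessianChart

omit [FiniteDimensional ℝ B] in
theorem gram_det_pos (h : IsHessianChart T g Γ) {z : A × B} (hz : z ∈ T) :
    0 < (gramMatrix b (g z)).det := by
  refine Matrix.PosDef.det_pos (Matrix.PosDef.of_dotProduct_mulVec_pos ?_ fun c hc => ?_)
  · ext i j
    simp [gramMatrix, h.metric_symm z hz (b i)]
  · have h1 : dotProduct (star c) ((gramMatrix b (g z)).mulVec c) =
        g z (∑ i, c i • b i) (∑ i, c i • b i) := by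
      simp only [dotProduct, Matrix.mulVec, gramMatrix, Matrix.of_apply, map_sum, map_smul,
        sum_apply, smul_apply, smul_eq_mul, Pi.star_apply, star_trivial, Finset.mul_sum]
      rw [Finset.sum_comm]
      refine Finset.sum_congr rfl fun k _ => Finset.sum_congr rfl fun l _ => by ring
    rw [h1]
    refine h.metric_pos z hz _ fun h0 => hc ?_
    ext i
    exact Fintype.linearIndependent_iff.1 b.linearIndependent c h0 i

/-- `Γ + γ` is metric, so with `N` the matrix of `Γ_X + γ_X` the derivative of the Gram matrix `G`
is `Nᵀ G + G N`. By Jacobi's formula each of the two summands contributes `tr N · det G`. -/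
theorem hasFDerivAt_gram_det (h : IsHessianChart T g Γ) {z : A × B} (hz : z ∈ T) :
    ∃ L : A × B →L[ℝ] ℝ, HasFDerivAt (fun z => (gramMatrix b (g z)).det) L z ∧ ∀ X,
      L X = 2 * (traceCLM B (Γ z X.2) + koszulOne g Γ z X.2) * (gramMatrix b (g z)).det := by
  have hd := ((h.metric_smooth.contDiffAt (h.isOpen.mem_nhds hz)).differentiableAt
    (by simp)).hasFDerivAt
  have hm : HasFDerivAt (fun z i j => g z (b i) (b j)) _ z :=
    hasFDerivAt_pi.2 fun i => hasFDerivAt_pi.2 fun j =>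
      (hd.clm_apply (hasFDerivAt_const (b i) z)).clm_apply (hasFDerivAt_const (b j) z)
  obtain ⟨L, hL, hLX⟩ := hasFDerivAt_det hm
  refine ⟨L, hL, fun X => ?_⟩
  rw [hLX]
  set N := LinearMap.toMatrix b b
    ((Γ z X.2 + differenceTensor g Γ z X.2 : B →L[ℝ] B) : B →ₗ[ℝ] B) with hN
  have hX : X = (X.1, 0) + (0, X.2) := by simp
  have h1 : ∀ i, Γ z X.2 (b i) + differenceTensor g Γ z X.2 (b i) = ∑ k, N k i • b k :=
    fun i => by
      rw [← b.sum_repr (Γ z X.2 (b i) + differenceTensor g Γ z X.2 (b i))]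
      simp [hN, LinearMap.toMatrix_apply]
  have h2 : Matrix.of (fun i j => fderiv ℝ g z X (b i) (b j)) =
      N.transpose * gramMatrix b (g z) + gramMatrix b (g z) * N := by
    ext i j
    have h3 := h.fderiv_metric hz X.2 (b i) (b j)
    rw [h1, h1] at h3
    conv_lhs => rw [hX]
    rw [map_add, h.metric_leaf z hz, zero_add, Matrix.of_apply, h3]
    simp only [Matrix.add_apply, Matrix.mul_apply, gramMatrix, Matrix.of_apply,
      Matrix.transpose_apply, map_sum, map_smul, sum_apply, smul_apply, smul_eq_mul]
    congr 1
    exact Finset.sum_congr rfl fun k _ => mul_comm _ _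
  have h4 : (Matrix.of fun i j => g z (b i) (b j)) = gramMatrix b (g z) := rfl
  have h5 : N.trace = traceCLM B (Γ z X.2) + koszulOne g Γ z X.2 := by
    rw [hN, ← LinearMap.trace_eq_matrix_trace ℝ b, ← traceCLM_apply, map_add]
    rfl
  have h6 : ((gramMatrix b (g z)).adjugate *
      Matrix.of (fun i j => fderiv ℝ g z X (b i) (b j))).trace =
      2 * N.trace * (gramMatrix b (g z)).det := by
    rw [h2, mul_add, Matrix.trace_add, ← mul_assoc, ← mul_assoc, Matrix.trace_mul_comm,
      ← mul_assoc, Matrix.mul_adjugate, Matrix.adjugate_mul]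
    simp only [Matrix.smul_mul, one_mul, Matrix.trace_smul, Matrix.trace_transpose, smul_eq_mul]
    ring
  rw [← h5, ← h6, h4]
  congr 3
  ext i j
  simp

/-- The leafwise derivative of the defining equation of `γ`: the leafwise derivatives of `g`, of its
first derivatives and of `Γ` all vanish, and `g` can be cancelled. -/
theorem fderiv_differenceTensor_leaf (h : IsHessianChart T g Γ) {z : A × B} (hz : z ∈ T)
    (a : A) : fderiv ℝ (differenceTensor g Γ) z (a, 0) = 0 := by
  have hn := h.isOpen.mem_nhds hz
  have hg := h.metric_smooth.contDiffAt hn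
  have hg1 := hg.differentiableAt (by simp)
  have hg2 : DifferentiableAt ℝ (fderiv ℝ g) z :=
    (hg.fderiv_right (m := ∞) (by simp)).differentiableAt (by simp)
  have hΓ := (h.conn_smooth.contDiffAt hn).differentiableAt (by simp)
  have hγ := (h.differenceTensor_smooth.contDiffAt hn).differentiableAt (by simp)
  have hsymm : IsSymmSndFDerivAt ℝ g z := hg.isSymmSndFDerivAt <| by
    simpa using WithTop.coe_le_coe.2 (le_top : (2 : ℕ∞) ≤ ⊤)
  have cst : ∀ b : B, HasFDerivAt (fun _ : A × B => b) (0 : A × B →L[ℝ] B) z :=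
    fun b => hasFDerivAt_const b z
  have h2 : ∀ X, fderiv ℝ (fderiv ℝ g) z (a, 0) X = 0 := fun X => by
    rw [hsymm.eq]
    have e1 := hg2.hasFDerivAt.clm_apply (hasFDerivAt_const ((a, 0) : A × B) z)
    have e2 := e1.unique ((hasFDerivAt_const (0 : B →L[ℝ] B →L[ℝ] ℝ) z).congr_of_eventuallyEq
      (by filter_upwards [hn] with z hz using h.metric_leaf z hz a))
    simpa using congrArg (fun L => L X) e2
  ext b c
  refine h.eq_of_metric hz fun d => ?_
  have e1 := ((hg1.hasFDerivAt.clm_apply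
    ((hγ.hasFDerivAt.clm_apply (cst b)).clm_apply (cst c))).clm_apply (cst d)).const_mul 2
  have e2 := ((hg2.hasFDerivAt.clm_apply (hasFDerivAt_const ((0 : A), b) z)).clm_apply
    (cst c)).clm_apply (cst d)
  have e3 := (hg1.hasFDerivAt.clm_apply
    ((hΓ.hasFDerivAt.clm_apply (cst b)).clm_apply (cst c))).clm_apply (cst d)
  have e4 := (hg1.hasFDerivAt.clm_apply (cst c)).clm_apply
    ((hΓ.hasFDerivAt.clm_apply (cst b)).clm_apply (cst d))
  have e5 := ((e2.sub e3).sub e4).congr_of_eventuallyEq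
    (f₁ := fun z => 2 * g z (differenceTensor g Γ z b c) d) (by
      filter_upwards [hn] with z hz using h.metric_differenceTensor hz b c d)
  have e6 := congrArg (fun L => L (a, 0)) (e1.unique e5)
  simp only [add_apply, sub_apply, smul_apply, ContinuousLinearMap.comp_apply,
    ContinuousLinearMap.flip_apply, zero_apply, map_zero, zero_add, smul_eq_mul, h2,
    h.metric_leaf z hz, h.conn_leaf z hz, add_zero, sub_zero] at e6
  simpa using e6

theorem fderiv_koszulOne_leaf (h : IsHessianChart T g Γ) {z : A × B} (hz : z ∈ T)
    (a : A) : fderiv ℝ (koszulOne g Γ) z (a, 0) = 0 := by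
  have hγ := (h.differenceTensor_smooth.contDiffAt (h.isOpen.mem_nhds hz)).differentiableAt
    (by simp)
  have h1 := (hasFDerivAt_const (traceCLM B) z).clm_comp hγ.hasFDerivAt
  unfold koszulOne
  rw [h1.fderiv]
  simp [h.fderiv_differenceTensor_leaf hz]

end IsHessianChart

end Gram

/-! ## Koszul forms of a normal Hessian structure -/

section KoszulForms

theorem smooth_comp {A B : Type*} [NormedAddCommGroup A] [NormedSpace ℝ A]
    [NormedAddCommGroup B] [NormedSpace ℝ B]
    {M : Type*} [TopologicalSpace M] [ChartedSpace (A × B) M] [IsFoliated A B M]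
    {G : Type*} [NormedAddCommGroup G] [NormedSpace ℝ G] {x₀ x : M}
    (hx : x ∈ (chartAt (A × B) x₀).source) {f : M → G}
    (hf : ContMDiffAt 𝓘(ℝ, A × B) 𝓘(ℝ, G) ∞ f x) :
    ContDiffAt ℝ ∞ (fun z => f ((chartAt (A × B) x₀).symm z)) (chartAt (A × B) x₀ x) := by
  have h8 : ContMDiffAt 𝓘(ℝ, A × B) 𝓘(ℝ, A × B) ∞ (chartAt (A × B) x₀).symm
      (chartAt (A × B) x₀ x) :=
    contMDiffAt_symm_of_mem_maximalAtlas
      (IsManifold.subset_maximalAtlas (chart_mem_atlas (A × B) x₀))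
      ((chartAt (A × B) x₀).map_source hx)
  rw [← (chartAt (A × B) x₀).left_inv hx] at hf
  exact (hf.comp _ h8).contDiffAt

/-- The components of a smooth section, as a smooth function of the coordinates. -/
theorem IsSmoothSectionOn.exists_components {A B : Type*} [NormedAddCommGroup A] [NormedSpace ℝ A]
    [NormedAddCommGroup B] [NormedSpace ℝ B]
    {M : Type*} [TopologicalSpace M] [ChartedSpace (A × B) M] [IsFoliated A B M]
    {U : Set M} (hU : IsOpen U) {Z : ∀ x : M, NormalFiber A B x} (hZ : IsSmoothSectionOn U Z)
    {x₀ x : M} (hxU : x ∈ U) (hx : x ∈ (chartAt (A × B) x₀).source) :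
    ∃ ζ : A × B → B, DifferentiableAt ℝ ζ (chartAt (A × B) x₀ x) ∧
      ∀ᶠ y in 𝓝 x, normalComp x₀ y (Z y) = ζ (chartAt (A × B) x₀ y) := by
  have hso := (chartAt (A × B) x₀).open_source
  have h1 : IsSmoothSectionOn (U ∩ (chartAt (A × B) x₀).source) Z := hZ.mono inter_subset_left
  rw [isSmoothSectionOn_iff inter_subset_right (hU.inter hso)] at h1
  refine ⟨_, (smooth_comp hx (h1.contMDiffAt ((hU.inter hso).mem_nhds ⟨hxU, hx⟩))).differentiableAt
    (by simp), ?_⟩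
  filter_upwards [hso.mem_nhds hx] with y hy
  rw [(chartAt (A × B) x₀).left_inv hy]

variable {A : Type*} [NormedAddCommGroup A] [NormedSpace ℝ A] [FiniteDimensional ℝ A] {q : ℕ}
  {M : Type*} [TopologicalSpace M] [T2Space M] [ChartedSpace (A × EuclideanSpace ℝ (Fin q)) M]
  [IsFoliated A (EuclideanSpace ℝ (Fin q)) M]

/-- The standard basis of the transverse model space. -/
def stdBasis (q : ℕ) : Module.Basis (Fin q) ℝ (EuclideanSpace ℝ (Fin q)) :=
  (EuclideanSpace.basisFun (Fin q) ℝ).toBasis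

omit [FiniteDimensional ℝ A] [T2Space M] in
-- Top-degree forms are multiples of the determinant, so a form is determined by its value on the
-- coordinate frame. All dependence on the point is thereby reduced to one scalar function and a
-- matrix of components.
theorem alternating_apply {x₀ x : M} (hx : x ∈ (chartAt (A × EuclideanSpace ℝ (Fin q)) x₀).source)
    (f : NormalFiber A (EuclideanSpace ℝ (Fin q)) x [⋀^Fin q]→ₗ[ℝ] ℝ)
    (v : Fin q → NormalFiber A (EuclideanSpace ℝ (Fin q)) x) :
    f v = f (fun i => coordSection x₀ (stdBasis q i) x) *
      (rowMatrix (stdBasis q) fun i => normalComp x₀ x (v i)).det := by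
  set L : (EuclideanSpace ℝ (Fin q)) →ₗ[ℝ] NormalFiber A (EuclideanSpace ℝ (Fin q)) x :=
    { toFun := fun u => coordSection x₀ u x
      map_add' := coordSection_add x₀ x
      map_smul' := coordSection_smul x₀ x } with hL
  have h1 := (f.compLinearMap L).eq_smul_basis_det (stdBasis q)
  have h2 := congrArg (fun f => f fun i => normalComp x₀ x (v i)) h1
  have h3 : (f.compLinearMap L) (fun i => normalComp x₀ x (v i)) = f v := by
    rw [AlternatingMap.compLinearMap_apply]
    congr 1
    funext i
    exact coordSection_normalComp hx (v i)
  change (f.compLinearMap L) (fun i => normalComp x₀ x (v i)) = _ at h2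
  rw [h3] at h2
  rw [h2, ← Matrix.det_transpose]
  rfl

variable {D : NormalConnection A (EuclideanSpace ℝ (Fin q)) M}
    {g : ∀ x : M, LinearMap.BilinForm ℝ (NormalFiber A (EuclideanSpace ℝ (Fin q)) x)}

namespace IsNormalHessian

/-- The covariant derivative of a normal volume form. -/
theorem volumeForm_deriv (h : IsNormalHessian D g) {U : Set M} (hU : IsOpen U)
    {vol : ∀ x : M, NormalFiber A (EuclideanSpace ℝ (Fin q)) x [⋀^Fin q]→ₗ[ℝ] ℝ}
    (hvol : IsVolumeFormOn g U vol)
    {Z : Fin q → ∀ x : M, NormalFiber A (EuclideanSpace ℝ (Fin q)) x}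
    (hZ : ∀ i, IsSmoothSectionOn U (Z i))
    {x₀ x : M} (hxU : x ∈ U) (hx : x ∈ (chartAt (A × EuclideanSpace ℝ (Fin q)) x₀).source)
    (X : TangentSpace 𝓘(ℝ, A × EuclideanSpace ℝ (Fin q)) x) :
    dirDeriv (A := A) (B := EuclideanSpace ℝ (Fin q)) (fun y => vol y fun i => Z i y) x X -
        ∑ i, vol x (Function.update (fun j => Z j x) i (D (Z i) x X)) =
      koszulOne (metricCoeff g x₀) (connCoeff D x₀) (chartAt (A × EuclideanSpace ℝ (Fin q)) x₀ x)
        (normalComp x₀ x (normalProj A (EuclideanSpace ℝ (Fin q)) x X)) * vol x fun i => Z i x := by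
  obtain ⟨X, rfl⟩ := exists_coordField hx X
  have hso := (chartAt (A × EuclideanSpace ℝ (Fin q)) x₀).open_source
  have hz := (chartAt (A × EuclideanSpace ℝ (Fin q)) x₀).map_source hx
  have hc := h.isHessianChart x₀
  set z := chartAt (A × EuclideanSpace ℝ (Fin q)) x₀ x with hzdef
  set b := stdBasis q
  choose ζ hζd hζ using fun i => (hZ i).exists_components hU hxU hx
  have hW := (hU.inter hso).mem_nhds ⟨hxU, hx⟩
  set f : M → ℝ := fun y => vol y fun i => coordSection x₀ (b i) y with hf
  have hfs : ContMDiffAt 𝓘(ℝ, A × EuclideanSpace ℝ (Fin q)) 𝓘(ℝ, ℝ) ∞ f x :=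
    (hvol.smooth (U ∩ (chartAt (A × EuclideanSpace ℝ (Fin q)) x₀).source) inter_subset_left
      (hU.inter hso)
      (fun i => coordSection x₀ (b i))
      fun i => (coordSection_smooth x₀ (b i)).mono inter_subset_right).contMDiffAt hW
  set F : A × EuclideanSpace ℝ (Fin q) → ℝ := fun z =>
    f ((chartAt (A × EuclideanSpace ℝ (Fin q)) x₀).symm z) with hF
  have hFd : DifferentiableAt ℝ F z := (smooth_comp hx hfs).differentiableAt (by simp)
  have hfF : ∀ᶠ y in 𝓝 x, f y = F (chartAt (A × EuclideanSpace ℝ (Fin q)) x₀ y) := by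
    filter_upwards [hso.mem_nhds hx] with y hy
    rw [hF]
    simp only [(chartAt (A × EuclideanSpace ℝ (Fin q)) x₀).left_inv hy]
  have hsq : ∀ y ∈ U ∩ (chartAt (A × EuclideanSpace ℝ (Fin q)) x₀).source,
      f y ^ 2 =
        (gramMatrix b (metricCoeff g x₀ (chartAt (A × EuclideanSpace ℝ (Fin q)) x₀ y))).det := by
    intro y hy
    rw [hf, hvol.sq y hy.1]
    congr 2
    funext i j
    exact (metricCoeff_apply g hy.2 (b i) (b j)).symm
  -- Only the square of the volume form is prescribed. The equation holds near `z`, so it can be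
  -- differentiated there whatever the sign of `F`.
  have hsqF : (fun z => F z ^ 2) =ᶠ[𝓝 z] fun z => (gramMatrix b (metricCoeff g x₀ z)).det := by
    have hcont : ContinuousAt (chartAt (A × EuclideanSpace ℝ (Fin q)) x₀).symm z :=
      (chartAt (A × EuclideanSpace ℝ (Fin q)) x₀).continuousAt_symm hz
    have h1 : (chartAt (A × EuclideanSpace ℝ (Fin q)) x₀).symm z = x :=
      (chartAt (A × EuclideanSpace ℝ (Fin q)) x₀).left_inv hx
    have h2 := hcont.preimage_mem_nhds (t := U ∩ (chartAt (A × EuclideanSpace ℝ (Fin q)) x₀).source)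
      (by rwa [h1])
    filter_upwards [h2, (chartAt (A × EuclideanSpace ℝ (Fin q)) x₀).open_target.mem_nhds hz]
      with w hw hwt
    have := hsq _ hw
    rwa [(chartAt (A × EuclideanSpace ℝ (Fin q)) x₀).right_inv hwt] at this
  have hFx : F z = f x := hfF.self_of_nhds.symm
  have hF2 : F z ^ 2 = (gramMatrix b (metricCoeff g x₀ z)).det := hsqF.self_of_nhds
  have hFne : F z ≠ 0 := fun h0 => by
    have := hc.gram_det_pos b hz
    rw [← hF2, h0] at this
    simp at this
  set θ := traceCLM (EuclideanSpace ℝ (Fin q)) (connCoeff D x₀ z X.2) +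
    koszulOne (metricCoeff g x₀) (connCoeff D x₀) z X.2 with hθ
  -- The derivative of `F² = det G` is `2 F F' = 2 θ F²`, and `F z ≠ 0` can be cancelled.
  have hFX : fderiv ℝ F z X = θ * F z := by
    obtain ⟨L, hL, hLX⟩ := hc.hasFDerivAt_gram_det b hz
    have h1 := (hFd.hasFDerivAt.pow 2).unique (hL.congr_of_eventuallyEq hsqF)
    have h2 := congrArg (fun L => L X) h1
    simp only [hLX, ← hF2, smul_apply, smul_eq_mul] at h2
    have h3 : 2 * F z * (fderiv ℝ F z X - θ * F z) = 0 := by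
      rw [hθ]
      norm_num at h2
      linear_combination h2
    rcases mul_eq_zero.1 h3 with h4 | h4
    · exact absurd h4 (by simpa using hFne)
    · linarith
  have hm : HasFDerivAt (fun z i j => b.repr (ζ i z) j)
      (ContinuousLinearMap.pi fun i => ContinuousLinearMap.pi fun j =>
        (LinearMap.toContinuousLinearMap (b.coord j)).comp (fderiv ℝ (ζ i) z)) z :=
    hasFDerivAt_pi.2 fun i => hasFDerivAt_pi.2 fun j =>
      (LinearMap.toContinuousLinearMap (b.coord j)).hasFDerivAt.comp z (hζd i).hasFDerivAt
  obtain ⟨L, hL, hLX⟩ := hasFDerivAt_det hm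
  have hvolF : (fun y => vol y fun i => Z i y) =ᶠ[𝓝 x] fun y =>
      (fun z => F z * (rowMatrix b fun i => ζ i z).det)
      (chartAt (A × EuclideanSpace ℝ (Fin q)) x₀ y) := by
    filter_upwards [hfF, Filter.eventually_all.2 hζ, hso.mem_nhds hx] with y h1 h2 hy
    rw [alternating_apply hy, ← h1]
    simp only [h2]
    rfl
  have hprod := hFd.hasFDerivAt.mul hL
  have hderiv : dirDeriv (A := A) (B := EuclideanSpace ℝ (Fin q))
    (fun y => vol y fun i => Z i y) x (coordField x₀ X x) =
      F z * ((rowMatrix b fun i => ζ i z).adjugate *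
        rowMatrix b fun i => fderiv ℝ (ζ i) z X).trace +
      (rowMatrix b fun i => ζ i z).det * (θ * F z) := by
    have h1 := mfderiv_coordField hx hprod.differentiableAt hvolF X
    refine h1.trans ?_
    rw [hprod.fderiv, ← hFX, add_apply, smul_apply, smul_apply, hLX]
    rfl
  have hζx : ∀ i, normalComp x₀ x (Z i x) = ζ i z := fun i => (hζ i).self_of_nhds
  have hcompD : ∀ i, normalComp x₀ x (D (Z i) x (coordField x₀ X x)) =
      fderiv ℝ (ζ i) z X + connCoeff D x₀ z X.2 (ζ i z) := fun i =>
    h.normalComp_conn hx (hζd i) (hζ i) X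
  -- The derivatives of the components cancel against the derivative of the determinant. The `Γ`
  -- terms add up to `tr Γ`, which leaves `θ - tr Γ = tr γ`.
  have hupd : ∀ i, vol x (Function.update (fun j => Z j x) i (D (Z i) x (coordField x₀ X x))) =
      F z * ((rowMatrix b fun i => ζ i z).updateRow i
          ((rowMatrix b fun i => fderiv ℝ (ζ i) z X) i)).det +
        F z * (rowMatrix b (Function.update (fun i => ζ i z) i
          (connCoeff D x₀ z X.2 (ζ i z)))).det := by
    intro i
    rw [alternating_apply hx, hFx, ← mul_add]
    congr 1
    have h1 : ∀ r : (EuclideanSpace ℝ (Fin q)), rowMatrix b (Function.update (fun i => ζ i z) i r) =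
        (rowMatrix b fun i => ζ i z).updateRow i (b.repr r) := fun r => by
      ext k j
      by_cases hk : k = i
      · subst hk
        simp [rowMatrix]
      · simp [rowMatrix, hk]
    have h2 : (fun j => normalComp x₀ x (Function.update (fun j => Z j x) i
        (D (Z i) x (coordField x₀ X x)) j)) = Function.update (fun i => ζ i z) i
        (fderiv ℝ (ζ i) z X + connCoeff D x₀ z X.2 (ζ i z)) := by
      funext k
      by_cases hk : k = i
      · subst hk
        simp [hcompD]
      · simp [hk, hζx]
    rw [h2, h1, h1, map_add, Finsupp.coe_add, Matrix.det_updateRow_add]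
    rfl
  have hsum := sum_det_update b
    (connCoeff D x₀ z X.2 : EuclideanSpace ℝ (Fin q) →ₗ[ℝ] EuclideanSpace ℝ (Fin q)) (fun i => ζ i z)
  have hvx : vol x (fun i => Z i x) = F z * (rowMatrix b fun i => ζ i z).det := by
    rw [alternating_apply hx, hFx]
    simp only [hζx]
    rfl
  rw [hderiv, Finset.sum_congr rfl fun i _ => hupd i, Finset.sum_add_distrib, ← Finset.mul_sum,
    ← Finset.mul_sum, Matrix.sum_det_updateRow, hvx, normalProj_coordField,
    normalComp_coordSection hx]
  have hsum' : ∑ i, (rowMatrix b (Function.update (fun i => ζ i z) i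
      (connCoeff D x₀ z X.2 (ζ i z)))).det =
      traceCLM (EuclideanSpace ℝ (Fin q)) (connCoeff D x₀ z X.2) *
        (rowMatrix b fun i => ζ i z).det := hsum
  rw [hsum', hθ]
  ring

end IsNormalHessian

end KoszulForms

/-! ### Existence and uniqueness of the Koszul forms, and the two Einstein conditions -/

section EinsteinHessian

variable {A : Type*} [NormedAddCommGroup A] [NormedSpace ℝ A] [FiniteDimensional ℝ A] {q : ℕ}
  {M : Type*} [TopologicalSpace M] [T2Space M] [ChartedSpace (A × EuclideanSpace ℝ (Fin q)) M]
  [IsFoliated A (EuclideanSpace ℝ (Fin q)) M]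
  {D : NormalConnection A (EuclideanSpace ℝ (Fin q)) M}
  {g : ∀ x : M, LinearMap.BilinForm ℝ (NormalFiber A (EuclideanSpace ℝ (Fin q)) x)}

/-- `normalComp` as a linear map. -/
def normalCompL (x₀ x : M) : NormalFiber A (EuclideanSpace ℝ (Fin q)) x
    →ₗ[ℝ] EuclideanSpace ℝ (Fin q) where
  toFun := normalComp x₀ x
  map_add' := normalComp_add
  map_smul' := normalComp_smul

/-- The positive volume form of `g` in the chart at `x₀`. -/
def chartVolume (g : ∀ x : M, LinearMap.BilinForm ℝ (NormalFiber A (EuclideanSpace ℝ (Fin q)) x))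
    (x₀ x : M) :
    NormalFiber A (EuclideanSpace ℝ (Fin q)) x [⋀^Fin q]→ₗ[ℝ] ℝ :=
  √(gramMatrix (stdBasis q) (metricCoeff g x₀ (chartAt (A × EuclideanSpace ℝ (Fin q)) x₀ x))).det •
    (stdBasis q).det.compLinearMap (normalCompL x₀ x)

omit [FiniteDimensional ℝ A] [T2Space M] in
theorem chartVolume_apply
    (g : ∀ x : M, LinearMap.BilinForm ℝ (NormalFiber A (EuclideanSpace ℝ (Fin q)) x)) (x₀ x : M)
    (v : Fin q → NormalFiber A (EuclideanSpace ℝ (Fin q)) x) : chartVolume g x₀ x v =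
      √(gramMatrix (stdBasis q)
          (metricCoeff g x₀ (chartAt (A × EuclideanSpace ℝ (Fin q)) x₀ x))).det *
        (rowMatrix (stdBasis q) fun i => normalComp x₀ x (v i)).det := by
  rw [← Matrix.det_transpose (rowMatrix _ _)]
  rfl

namespace IsNormalHessian

/-- The first Koszul form is characterised by all local volume forms at once, so its uniqueness
requires that one exists near every point. The square root is smooth because the Gram determinant is
positive. -/
theorem chartVolume_isVolumeFormOn (h : IsNormalHessian D g) (x₀ : M) :
    IsVolumeFormOn g (chartAt (A × EuclideanSpace ℝ (Fin q)) x₀).source (chartVolume g x₀) := by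
  have hc := h.isHessianChart x₀
  set b := stdBasis q
  refine ⟨fun x hx v => ?_, fun V hV hVo Z hZ => ?_⟩
  · have hz := (chartAt (A × EuclideanSpace ℝ (Fin q)) x₀).map_source hx
    have h1 := gram_det b (metricCoeff g x₀ (chartAt (A × EuclideanSpace ℝ (Fin q)) x₀ x))
      fun i => normalComp x₀ x (v i)
    simp only [metricCoeff_normalComp g hx] at h1
    rw [chartVolume_apply, mul_pow, Real.sq_sqrt (hc.gram_det_pos b hz).le, h1, mul_comm]
  · simp only [chartVolume_apply]
    have hG : ContDiffOn ℝ ∞ (fun z => (gramMatrix b (metricCoeff g x₀ z)).det)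
        (chartAt (A × EuclideanSpace ℝ (Fin q)) x₀).target :=
      (detMultilinear (Fin q)).contDiff.comp_contDiffOn
        (f := fun z i j => metricCoeff g x₀ z (b i) (b j))
        (contDiffOn_pi.2 fun i => contDiffOn_pi.2 fun j =>
          (hc.metric_smooth.clm_apply contDiffOn_const).clm_apply contDiffOn_const)
    have hsqrt := hG.sqrt fun z hz => (hc.gram_det_pos b hz).ne'
    have h1 : ContMDiffOn 𝓘(ℝ, A × EuclideanSpace ℝ (Fin q)) 𝓘(ℝ, ℝ) ∞
        (fun x => √(gramMatrix b
          (metricCoeff g x₀ (chartAt (A × EuclideanSpace ℝ (Fin q)) x₀ x))).det)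
        (chartAt (A × EuclideanSpace ℝ (Fin q)) x₀).source :=
      hsqrt.contMDiffOn.comp (contMDiffOn_of_mem_maximalAtlas
        (IsManifold.subset_maximalAtlas (chart_mem_atlas (A × EuclideanSpace ℝ (Fin q)) x₀)))
        fun x hx => (chartAt (A × EuclideanSpace ℝ (Fin q)) x₀).map_source hx
    have h2 : ContMDiffOn 𝓘(ℝ, A × EuclideanSpace ℝ (Fin q)) 𝓘(ℝ, Fin q → Fin q → ℝ) ∞
        (fun x i j => b.repr (normalComp x₀ x (Z i x)) j) V := by
      refine contMDiffOn_pi_space.2 fun i => contMDiffOn_pi_space.2 fun j => ?_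
      exact (LinearMap.toContinuousLinearMap (b.coord j)).contMDiff.comp_contMDiffOn
        ((isSmoothSectionOn_iff hV hVo _).1 (hZ i))
    exact (h1.mono hV).mul ((detMultilinear (Fin q)).contDiff.contMDiff.comp_contMDiffOn h2)

theorem chartVolume_ne_zero (h : IsNormalHessian D g) {x₀ x : M}
    (hx : x ∈ (chartAt (A × EuclideanSpace ℝ (Fin q)) x₀).source) :
    chartVolume g x₀ x (fun i => coordSection x₀ (stdBasis q i) x) ≠ 0 := by
  rw [chartVolume_apply]
  simp only [normalComp_coordSection hx]
  have h1 : (rowMatrix (stdBasis q) fun i => stdBasis q i).det = 1 :=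
    rowMatrix_det_basis (stdBasis q)
  rw [h1, mul_one]
  exact (Real.sqrt_pos.2 ((h.isHessianChart x₀).gram_det_pos _
    ((chartAt (A × EuclideanSpace ℝ (Fin q)) x₀).map_source hx))).ne'

/-- The first Koszul form in a chart. -/
theorem firstKoszulForm_eq (h : IsNormalHessian D g)
    {α : ∀ x : M, NormalFiber A (EuclideanSpace ℝ (Fin q)) x →ₗ[ℝ] ℝ} (hα : IsFirstKoszulForm D g α)
    {x₀ x : M} (hx : x ∈ (chartAt (A × EuclideanSpace ℝ (Fin q)) x₀).source)
    (u : NormalFiber A (EuclideanSpace ℝ (Fin q)) x) :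
    α x u = koszulOne (metricCoeff g x₀) (connCoeff D x₀)
      (chartAt (A × EuclideanSpace ℝ (Fin q)) x₀ x)
      (normalComp x₀ x u) := by
  have hso := (chartAt (A × EuclideanSpace ℝ (Fin q)) x₀).open_source
  set X := coordField x₀ ((0 : A), normalComp x₀ x u) x with hX
  have hXu : normalProj A (EuclideanSpace ℝ (Fin q)) x X = u := by
    rw [hX, normalProj_coordField]
    exact coordSection_normalComp hx u
  have hZ := fun i => coordSection_smooth (A := A) x₀ (stdBasis q i)
  have h1 := hα _ hso _ (h.chartVolume_isVolumeFormOn x₀) _ hZ x hx X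
  have h2 := h.volumeForm_deriv hso (h.chartVolume_isVolumeFormOn x₀) hZ hx hx X
  rw [h1, hXu] at h2
  exact mul_right_cancel₀ (h.chartVolume_ne_zero hx) h2

variable (D g) in
/-- The first Koszul form. -/
def _root_.firstKoszulForm (x : M) : NormalFiber A (EuclideanSpace ℝ (Fin q)) x →ₗ[ℝ] ℝ :=
  (koszulOne (metricCoeff g x) (connCoeff D x)
    (chartAt (A × EuclideanSpace ℝ (Fin q)) x x)).toLinearMap ∘ₗ
    normalCompL x x

/-- `firstKoszulForm` reads each fibre in the preferred chart of its own base point. This is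
harmless, since `volumeForm_deriv` holds in every chart around the point. -/
theorem isFirstKoszulForm (h : IsNormalHessian D g) :
    IsFirstKoszulForm D g (firstKoszulForm D g) :=
  fun _ hU _ hvol _ hZ x hx X => h.volumeForm_deriv hU hvol hZ hx (mem_chart_source _ x) X

/-- To differentiate `α(Y)` one chart must serve a whole neighbourhood, which `firstKoszulForm_eq`
provides. The product rule and the formula for `D Y` then leave the derivative of `koszulOne` minus
its `Γ` term. -/
theorem firstKoszulForm_deriv (h : IsNormalHessian D g)
    {α : ∀ x : M, NormalFiber A (EuclideanSpace ℝ (Fin q)) x →ₗ[ℝ] ℝ} (hα : IsFirstKoszulForm D g α)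
    {U : Set M} (hU : IsOpen U) {Y : ∀ x : M, NormalFiber A (EuclideanSpace ℝ (Fin q)) x}
    (hY : IsSmoothSectionOn U Y) {x : M} (hxU : x ∈ U)
    (X : TangentSpace 𝓘(ℝ, A × EuclideanSpace ℝ (Fin q)) x) :
    dirDeriv (A := A) (B := EuclideanSpace ℝ (Fin q)) (fun y => α y (Y y)) x X - α x (D Y x X) =
      koszulTwo (metricCoeff g x) (connCoeff D x) (chartAt (A × EuclideanSpace ℝ (Fin q)) x x)
        (normalComp x x (normalProj A (EuclideanSpace ℝ (Fin q)) x X)) (normalComp x x (Y x)) := by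
  have hx := mem_chart_source (A × EuclideanSpace ℝ (Fin q)) x
  obtain ⟨X, rfl⟩ := exists_coordField hx X
  obtain ⟨ζ, hζd, hζ⟩ := hY.exists_components hU hxU hx
  have hc := h.isHessianChart x
  have hz := (chartAt (A × EuclideanSpace ℝ (Fin q)) x).map_source hx
  set z := chartAt (A × EuclideanSpace ℝ (Fin q)) x x with hzdef
  set κ := koszulOne (metricCoeff g x) (connCoeff D x) with hκ
  have hκd : DifferentiableAt ℝ κ z :=
    (hc.koszulOne_smooth.contDiffAt (hc.isOpen.mem_nhds hz)).differentiableAt (by simp)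
  have h1 := hκd.hasFDerivAt.clm_apply hζd.hasFDerivAt
  have h2 : (fun y => α y (Y y)) =ᶠ[𝓝 x]
      fun y => (fun z => κ z (ζ z)) (chartAt (A × EuclideanSpace ℝ (Fin q)) x y) := by
    filter_upwards [hζ, (chartAt (A × EuclideanSpace ℝ (Fin q)) x).open_source.mem_nhds hx]
      with y hy hys
    rw [h.firstKoszulForm_eq hα hys, hy]
  have h3 : dirDeriv (A := A) (B := EuclideanSpace ℝ (Fin q))
    (fun y => α y (Y y)) x (coordField x X x) =
      κ z (fderiv ℝ ζ z X) + fderiv ℝ κ z X (ζ z) := by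
    refine (mfderiv_coordField hx h1.differentiableAt h2 X).trans ?_
    rw [h1.fderiv]
    rfl
  have hX : X = (X.1, 0) + (0, X.2) := by simp
  -- `koszulOne` is constant along the leaves; hence the result depends only on the normal part of
  -- `X`.
  have h4 : fderiv ℝ κ z X = fderiv ℝ κ z (0, X.2) := by
    conv_lhs => rw [hX, map_add, hc.fderiv_koszulOne_leaf hz, zero_add]
  rw [h3, h.firstKoszulForm_eq hα hx, h.normalComp_conn hx hζd hζ, normalProj_coordField,
    normalComp_coordSection hx, hζ.self_of_nhds, koszulTwo, h4, map_add]
  ring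

variable (D g) in
/-- The second Koszul form. -/
def _root_.secondKoszulForm (x : M) :
    LinearMap.BilinForm ℝ (NormalFiber A (EuclideanSpace ℝ (Fin q)) x) :=
  LinearMap.mk₂ ℝ (fun u w => koszulTwo (metricCoeff g x) (connCoeff D x)
    (chartAt (A × EuclideanSpace ℝ (Fin q)) x x)
      (normalComp x x u) (normalComp x x w))
    (fun u u' w => by
      have e : ((0 : A), normalComp x x u + normalComp x x u') =
        (0, normalComp x x u) + (0, normalComp x x u') := by simp
      simp only [koszulTwo, normalComp_add, e, map_add, add_apply]
      ring)
    (fun c u w => by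
      have e : ((0 : A), c • normalComp x x u) = c • (0, normalComp x x u) := by simp
      simp only [koszulTwo, normalComp_smul, e, map_smul, smul_apply, smul_eq_mul]
      ring)
    (fun u w w' => by
      simp only [koszulTwo, normalComp_add, map_add]
      ring)
    (fun c u w => by
      simp only [koszulTwo, normalComp_smul, map_smul, smul_eq_mul]
      ring)

theorem isSecondKoszulForm (h : IsNormalHessian D g) :
    IsSecondKoszulForm D (firstKoszulForm D g) (secondKoszulForm D g) :=
  fun _ hU _ hY _ hx X => h.firstKoszulForm_deriv h.isFirstKoszulForm hU hY hx X

theorem secondKoszulForm_eq (h : IsNormalHessian D g)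
    {α : ∀ x : M, NormalFiber A (EuclideanSpace ℝ (Fin q)) x →ₗ[ℝ] ℝ} (hα : IsFirstKoszulForm D g α)
    {β : ∀ x : M, LinearMap.BilinForm ℝ (NormalFiber A (EuclideanSpace ℝ (Fin q)) x)}
    (hβ : IsSecondKoszulForm D α β) (x : M) (u w : NormalFiber A (EuclideanSpace ℝ (Fin q)) x) :
    β x u w = secondKoszulForm D g x u w := by
  have hx := mem_chart_source (A × EuclideanSpace ℝ (Fin q)) x
  have hso := (chartAt (A × EuclideanSpace ℝ (Fin q)) x).open_source
  set X := coordField x ((0 : A), normalComp x x u) x with hX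
  have hXu : normalProj A (EuclideanSpace ℝ (Fin q)) x X = u := by
    rw [hX, normalProj_coordField]
    exact coordSection_normalComp hx u
  have hY := coordSection_smooth (A := A) x (normalComp x x w)
  have h1 := hβ _ hso _ hY x hx X
  have h2 := h.firstKoszulForm_deriv hα hso hY hx X
  rw [h1, hXu, coordSection_normalComp hx] at h2
  exact h2

/-- The Koszul forms exist and are unique, so the existential quantifier over them reduces to
`secondKoszulForm`. -/
theorem isEinsteinHessian_iff (h : IsNormalHessian D g) (l : M → ℝ) :
    IsEinsteinHessian D g l ↔ ∀ x u w, secondKoszulForm D g x u w = l x * g x u w := by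
  refine ⟨?_, fun hl => ⟨_, _, h.isFirstKoszulForm, h.isSecondKoszulForm, hl⟩⟩
  rintro ⟨α, β, hα, hβ, hl⟩ x u w
  rw [← h.secondKoszulForm_eq hα hβ, hl]

/-- Both `Ric` and `g^N` split into a horizontal and a vertical copy, of `-β` and of `g`
respectively, so the Einstein equation upstairs is the same condition on each copy. -/
theorem isEinsteinKahler_iff (h : IsNormalHessian D g)
    (μ : NormalBundle A (EuclideanSpace ℝ (Fin q)) M → ℝ) :
    IsEinsteinKahler (inducedComplex D) (inducedMetric D g) μ ↔
      ∀ v : NormalBundle A (EuclideanSpace ℝ (Fin q)) M, ∀ u w,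
        secondKoszulForm D g v.1 u w = -μ v * g v.1 u w := by
  have hric : ∀ (v : NormalBundle A (EuclideanSpace ℝ (Fin q)) M) V W,
    normalRicci (inducedMetric D g) v V W =
      -secondKoszulForm D g v.1 (normalBundleProj v V) (normalBundleProj v W) -
        secondKoszulForm D g v.1 (connector D v V) (connector D v W) :=
    h.normalRicci_inducedMetric
  constructor
  · rintro ⟨-, hμ⟩ v u w
    -- Vertical vectors suffice: they have no horizontal part, so only the second copy remains.
    have h1 := hμ v (verticalLift v u) (verticalLift v w)
    have h2 : ∀ u, normalBundleProj v (verticalLift v u) = 0 := fun u => rfl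
    rw [hric, inducedMetric_apply] at h1
    simp only [connector_verticalLift, h2, map_zero, neg_zero, zero_sub, zero_add] at h1
    linarith
  · intro hμ
    refine ⟨h.isNormalKahler, fun v V W => ?_⟩
    rw [hric, inducedMetric_apply, hμ, hμ]
    ring

end IsNormalHessian

end EinsteinHessian

end

theorem mainTheorem3 {p q : ℕ} {M : Type*} [TopologicalSpace M] [T2Space M]
    [SecondCountableTopology M]
    [ChartedSpace (EuclideanSpace ℝ (Fin p) × EuclideanSpace ℝ (Fin q)) M]
    [IsFoliated (EuclideanSpace ℝ (Fin p)) (EuclideanSpace ℝ (Fin q)) M]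
    (D : NormalConnection (EuclideanSpace ℝ (Fin p)) (EuclideanSpace ℝ (Fin q)) M)
    (g : ∀ x : M, LinearMap.BilinForm ℝ
      (NormalFiber (EuclideanSpace ℝ (Fin p)) (EuclideanSpace ℝ (Fin q)) x))
    (hDg : IsNormalHessian D g) :
    ((∃ l : M → ℝ, IsEinsteinHessian D g l) ↔
      ∃ μ : NormalBundle (EuclideanSpace ℝ (Fin p)) (EuclideanSpace ℝ (Fin q)) M → ℝ,
        IsEinsteinKahler (inducedComplex D) (inducedMetric D g) μ) ∧
    ((∃ c : ℝ, IsEinsteinHessian D g fun _ => c) ↔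
      ∃ c : ℝ, IsEinsteinKahler (inducedComplex D) (inducedMetric D g) fun _ => c) := by
  have h1 := hDg.isEinsteinHessian_iff
  have h2 := hDg.isEinsteinKahler_iff
  refine ⟨⟨?_, ?_⟩, ⟨?_, ?_⟩⟩
  · rintro ⟨l, hl⟩
    -- The factor is pulled back along the projection, with the sign of `Ric = -β`.
    refine ⟨fun v => -l v.1, (h2 _).2 fun v u w => ?_⟩
    rw [(h1 l).1 hl, neg_neg]
  · rintro ⟨μ, hμ⟩
    -- The condition holds at every `v` over `x`; one point of each fibre is enough, and the zero
    -- vector is always available.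
    exact ⟨fun x => -μ ⟨x, 0⟩, (h1 _).2 fun x => (h2 μ).1 hμ ⟨x, 0⟩⟩
  · rintro ⟨c, hc⟩
    refine ⟨-c, (h2 _).2 fun v u w => ?_⟩
    rw [(h1 _).1 hc, neg_neg]
  · rintro ⟨c, hc⟩
    exact ⟨-c, (h1 _).2 fun x => (h2 _).1 hc ⟨x, 0⟩⟩
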